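/- All graphs are finite, simple and undirected. A connected dominating set of a graph $G$ is a set $S\subseteq V(G)$ such that every vertex of $G$ is in $S$ or has a neighbor in $S$, and the induced subgraph $G[S]$ is connected (in particular nonempty). A graph $G=(V,E)$ is connected-domishold if there are a weight function $w:V\to\mathbb{R}_{\ge 0}$ and a threshold $t\in\mathbb{R}_{\ge 0}$ such that for every $S\subseteq V$ one has $\sum_{x\in S}w(x)\ge t$ if and only if $S$ is a connected dominating set of $G$; it is hereditarily connected-domishold if every induced subgraph of $G$ is connected-domishold. A graph is chordal if it has no induced cycle of length at least $4$, and split if its vertex set can be partitioned into a (possibly empty) clique and a (possibly empty) independent set. For a set $\mathcal F$ of graphs, $\mathcal F$-free means having no induced subgraph isomorphic to a member of $\mathcal F$. Let $F_1$ be the square of the path on $6$ vertices (vertices $0,\dots,5$, with $a\ne b$ adjacent iff $|a-b|\le 2$). Let $F_2$ be the graph consisting of a clique $\{0,1,2,3\}$, a vertex $4$ adjacent to exactly $0,1$, and a vertex $5$ adjacent to exactly $2,3$. A diamond is $K_4$ minus an edge; its two vertices of degree two are its tips. For $i\ge 1$ let $H_i$ be the graph on $i+6$ vertices consisting of two diamonds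 and a path $y_1,\dots,y_i$ such that $y_1$ is a tip of the first diamond, $y_i$ is a tip of the second one, and there are no further common vertices or edges (for $i=1$ the two diamonds share exactly the vertex $y_1$). The Weighted Connected Dominating Set problem (WCDS) is: given a connected graph $G$ and costs $c:V(G)\to\mathbb{R}_{\ge 0}$, compute a connected dominating set $S$ of $G$ minimizing $\sum_{v\in S}c(v)$. Running times are counted on a word RAM with words of $O(\log n)$ bits, which in addition has registers for real numbers (moved, added, subtracted and compared at unit cost). The input graph, on $n$ vertices, is given by its adjacency matrix. Then: 1. Every $F_2$-free split graph is hereditarily connected-domishold. 2. WCDS is solvable in time $O(n^3)$ in the class of $\{F_1,F_2,H_1,H_2,\ldots\}$-free chordal graphs. 3. In particular, WCDS is solvable in time $O(n^3)$ in the class of $F_2$-free split graphs. -/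

import Mathlib

open scoped Classical in
/-- The indicator of a proposition as a natural number. -/
noncomputable def WCDS.indicator (p : Prop) : ℕ := if p then 1 else 0

namespace WCDS

/-! ### Connected-domishold graphs and the graph classes -/

section Graphs

variable {V : Type*}

/-- `S` is dominating (every vertex is in `S` or has a neighbor in `S`) and induces a connected
subgraph (`SimpleGraph.Connected` includes that the vertex set is nonempty). -/
def IsConnectedDominating (G : SimpleGraph V) (S : Set V) : Prop :=
  (∀ v, v ∈ S ∨ ∃ u ∈ S, G.Adj v u) ∧ (G.induce S).Connected

/-- There are nonnegative weights `w` and a nonnegative threshold `t` such that the vertex sets of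
total weight at least `t` are exactly the connected dominating sets.  A disconnected graph has no
connected dominating sets and satisfies this with `w = 0`, `t = 1`. -/
def IsConnectedDomishold (G : SimpleGraph V) : Prop :=
  ∃ (w : V → ℝ) (t : ℝ), (∀ v, 0 ≤ w v) ∧ 0 ≤ t ∧
    ∀ S : Finset V, t ≤ ∑ v ∈ S, w v ↔ IsConnectedDominating G (S : Set V)

/-- Every induced subgraph is connected-domishold. -/
def IsHereditarilyConnectedDomishold (G : SimpleGraph V) : Prop :=
  ∀ U : Set V, IsConnectedDomishold (G.induce U)

/-- No induced cycle of length at least four. -/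
def IsChordal (G : SimpleGraph V) : Prop :=
  ∀ k, 4 ≤ k → ¬ (SimpleGraph.cycleGraph k).IsIndContained G

/-- The vertex set can be partitioned into a clique and an independent set. -/
def IsSplit (G : SimpleGraph V) : Prop :=
  ∃ K : Set V, G.IsClique K ∧ G.IsIndepSet Kᶜ

/-- The graph `F₁`: the square of the path on six vertices. -/
def F₁ : SimpleGraph (Fin 6) :=
  SimpleGraph.fromRel fun a b => b.val = a.val + 1 ∨ b.val = a.val + 2

/-- The graph `F₂`: a clique `{0, 1, 2, 3}`, a vertex `4` adjacent to exactly `0, 1`, and a vertex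
`5` adjacent to exactly `2, 3`. -/
def F₂ : SimpleGraph (Fin 6) :=
  SimpleGraph.fromRel fun a b =>
    (a.val < 4 ∧ b.val < 4) ∨ (a.val < 2 ∧ b.val = 4) ∨
      (2 ≤ a.val ∧ a.val < 4 ∧ b.val = 5)

/-- The graph `Hᵢ`, for `1 ≤ i`: two diamonds, on `{0, 1, 2, 3}` with tips `0, 3`, and on
`{i + 2, i + 3, i + 4, i + 5}` with tips `i + 2, i + 5`, and the path `3, 4, …, i + 2` on `i`
vertices that joins a tip of one to a tip of the other (for `i = 1` the two diamonds share the
vertex `3`). -/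
def H (i : ℕ) : SimpleGraph (Fin (i + 6)) :=
  SimpleGraph.fromRel fun a b =>
    b.val = a.val + 1 ∨
      (b.val = a.val + 2 ∧ (a.val = 0 ∨ a.val = 1 ∨ a.val = i + 2 ∨ a.val = i + 3))

/-- `G` has no induced subgraph isomorphic to `F₁`, `F₂` or some `Hᵢ` with `i ≥ 1`. -/
def IsF₁F₂HFree (G : SimpleGraph V) : Prop :=
  ¬ F₁.IsIndContained G ∧ ¬ F₂.IsIndContained G ∧ ∀ i, 1 ≤ i → ¬ (H i).IsIndContained G

/-- `S` is a connected dominating set of minimum total cost. -/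
def IsMinCostConnectedDominating (G : SimpleGraph V) (c : V → ℝ) (S : Finset V) : Prop :=
  IsConnectedDominating G (S : Set V) ∧
    ∀ S' : Finset V, IsConnectedDominating G (S' : Set V) → ∑ v ∈ S, c v ≤ ∑ v ∈ S', c v

end Graphs

/-! ### A word RAM with real registers

Programs are finite and contain only natural number constants.  Memory consists of arrays of
machine words and arrays of real numbers, addressed by words.  Arithmetic on words is modulo the
word modulus `W`; real numbers can only be moved, added, subtracted and compared.  Each operation,
each access to memory and each test costs one step. -/

/-- Word-valued expressions: `read a e` is the entry at address `e` of the array named `a`. -/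
inductive NExpr : Type
  | const (k : ℕ)
  | read (a : ℕ) (addr : NExpr)
  | add (e f : NExpr)
  | sub (e f : NExpr)
  | mul (e f : NExpr)

/-- Real-valued expressions. -/
inductive RExpr : Type
  | read (a : ℕ) (addr : NExpr)
  | add (e f : RExpr)
  | sub (e f : RExpr)

/-- Tests. -/
inductive Test : Type
  | ltN (e f : NExpr)
  | eqN (e f : NExpr)
  | ltR (e f : RExpr)
  | neg (b : Test)
  | conj (b d : Test)

/-- Programs. -/
inductive Prog : Type
  | nop
  | setN (a : ℕ) (addr e : NExpr)
  | setR (a : ℕ) (addr : NExpr) (e : RExpr)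
  | seq (p q : Prog)
  | cond (b : Test) (p q : Prog)
  | loop (b : Test) (p : Prog)

/-- The contents of the memory. -/
structure Store : Type where
  /-- entry of the word array with the given name at the given address -/
  word : ℕ → ℕ → ℕ
  /-- entry of the real array with the given name at the given address -/
  real : ℕ → ℕ → ℝ

def NExpr.eval (W : ℕ) (s : Store) : NExpr → ℕ
  | const k => k % W
  | read a addr => s.word a (addr.eval W s)
  | add e f => (e.eval W s + f.eval W s) % W
  | sub e f => (e.eval W s - f.eval W s) % W
  | mul e f => (e.eval W s * f.eval W s) % W

def NExpr.cost : NExpr → ℕ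
  | const _ => 1
  | read _ addr => addr.cost + 1
  | add e f => e.cost + f.cost + 1
  | sub e f => e.cost + f.cost + 1
  | mul e f => e.cost + f.cost + 1

noncomputable def RExpr.eval (W : ℕ) (s : Store) : RExpr → ℝ
  | read a addr => s.real a (addr.eval W s)
  | add e f => e.eval W s + f.eval W s
  | sub e f => e.eval W s - f.eval W s

def RExpr.cost : RExpr → ℕ
  | read _ addr => addr.cost + 1
  | add e f => e.cost + f.cost + 1
  | sub e f => e.cost + f.cost + 1

def Test.Holds (W : ℕ) (s : Store) : Test → Prop
  | ltN e f => e.eval W s < f.eval W s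
  | eqN e f => e.eval W s = f.eval W s
  | ltR e f => e.eval W s < f.eval W s
  | neg b => ¬ b.Holds W s
  | conj b d => b.Holds W s ∧ d.Holds W s

def Test.cost : Test → ℕ
  | ltN e f => e.cost + f.cost + 1
  | eqN e f => e.cost + f.cost + 1
  | ltR e f => e.cost + f.cost + 1
  | neg b => b.cost + 1
  | conj b d => b.cost + d.cost + 1

/-- Overwrite one entry of a word array. -/
def Store.setWord (s : Store) (a i x : ℕ) : Store :=
  { s with word := Function.update s.word a (Function.update (s.word a) i x) }

/-- Overwrite one entry of a real array. -/
def Store.setReal (s : Store) (a i : ℕ) (x : ℝ) : Store :=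
  { s with real := Function.update s.real a (Function.update (s.real a) i x) }

/-- `Exec W p s t s'`: with word modulus `W`, the program `p` started in `s` halts after exactly
`t` steps in `s'`. -/
inductive Exec (W : ℕ) : Prog → Store → ℕ → Store → Prop
  | nop (s : Store) : Exec W .nop s 1 s
  | setN (a : ℕ) (addr e : NExpr) (s : Store) :
      Exec W (.setN a addr e) s (addr.cost + e.cost + 1)
        (s.setWord a (addr.eval W s) (e.eval W s))
  | setR (a : ℕ) (addr : NExpr) (e : RExpr) (s : Store) :
      Exec W (.setR a addr e) s (addr.cost + e.cost + 1)
        (s.setReal a (addr.eval W s) (e.eval W s))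
  | seq {p q : Prog} {s s' s'' : Store} {t t' : ℕ} :
      Exec W p s t s' → Exec W q s' t' s'' → Exec W (.seq p q) s (t + t') s''
  | condTrue {b : Test} {p q : Prog} {s s' : Store} {t : ℕ} :
      b.Holds W s → Exec W p s t s' → Exec W (.cond b p q) s (b.cost + 1 + t) s'
  | condFalse {b : Test} {p q : Prog} {s s' : Store} {t : ℕ} :
      ¬ b.Holds W s → Exec W q s t s' → Exec W (.cond b p q) s (b.cost + 1 + t) s'
  | loopFalse {b : Test} {p : Prog} {s : Store} :
      ¬ b.Holds W s → Exec W (.loop b p) s (b.cost + 1) s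
  | loopTrue {b : Test} {p : Prog} {s s' s'' : Store} {t t' : ℕ} :
      b.Holds W s → Exec W p s t s' → Exec W (.loop b p) s' t' s'' →
        Exec W (.loop b p) s (b.cost + 1 + t + t') s''

/-- Execution is deterministic: the halting time and the final store are determined. -/
theorem Exec.det {W : ℕ} {p : Prog} {s s₁ s₂ : Store} {t₁ t₂ : ℕ}
    (h₁ : Exec W p s t₁ s₁) (h₂ : Exec W p s t₂ s₂) : t₁ = t₂ ∧ s₁ = s₂ := by
  induction h₁ generalizing t₂ s₂ with
  | nop => cases h₂; exact ⟨rfl, rfl⟩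
  | setN => cases h₂; exact ⟨rfl, rfl⟩
  | setR => cases h₂; exact ⟨rfl, rfl⟩
  | seq _ _ ih ih' =>
    cases h₂ with
    | seq k k' =>
      obtain ⟨rfl, rfl⟩ := ih k
      obtain ⟨rfl, rfl⟩ := ih' k'
      exact ⟨rfl, rfl⟩
  | condTrue hb _ ih =>
    cases h₂ with
    | condTrue _ k => obtain ⟨rfl, rfl⟩ := ih k; exact ⟨rfl, rfl⟩
    | condFalse hb' => exact absurd hb hb'
  | condFalse hb _ ih =>
    cases h₂ with
    | condFalse _ k => obtain ⟨rfl, rfl⟩ := ih k; exact ⟨rfl, rfl⟩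
    | condTrue hb' => exact absurd hb' hb
  | loopFalse hb =>
    cases h₂ with
    | loopFalse => exact ⟨rfl, rfl⟩
    | loopTrue hb' => exact absurd hb' hb
  | loopTrue hb _ _ ih ih' =>
    cases h₂ with
    | loopFalse hb' => exact absurd hb hb'
    | loopTrue _ k k' =>
      obtain ⟨rfl, rfl⟩ := ih k
      obtain ⟨rfl, rfl⟩ := ih' k'
      exact ⟨rfl, rfl⟩

/-! ### The weighted connected dominating set problem -/

/-- The input: word array `0` is the row-major adjacency matrix of `G`, word array `1` has `n` at
address `0`, real array `0` is the list of costs, and everything else is zero. -/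
noncomputable def inputStore {n : ℕ} (G : SimpleGraph (Fin n)) (c : Fin n → ℝ) : Store where
  word a x :=
    if a = 0 then indicator (∃ i j : Fin n, x = i.val * n + j.val ∧ G.Adj i j)
    else if a = 1 ∧ x = 0 then n
    else 0
  real a x := if h : a = 0 ∧ x < n then c ⟨x, h.2⟩ else 0

/-- The output: the vertices that are marked by a `1` in word array `2`. -/
def outputSet (n : ℕ) (s : Store) : Finset (Fin n) :=
  Finset.univ.filter fun v => s.word 2 v.val = 1

/-- One program solves the problem, for all connected graphs on `n` vertices in the class `𝒢` and
all nonnegative costs, in `O(T n)` steps.  Words have `O(log n)` bits: the program has to work as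
soon as the word modulus is at least a fixed power of `n + 1`. -/
def WCDSSolvableInTime (𝒢 : ∀ n : ℕ, SimpleGraph (Fin n) → Prop) (T : ℕ → ℕ) : Prop :=
  ∃ (p : Prog) (k C : ℕ), ∀ (n : ℕ) (G : SimpleGraph (Fin n)) (c : Fin n → ℝ) (W : ℕ),
    𝒢 n G → G.Connected → (∀ v, 0 ≤ c v) → (n + 1) ^ k ≤ W →
      ∃ (t : ℕ) (s : Store), Exec W p (inputStore G c) t s ∧ t ≤ C * T n ∧
        IsMinCostConnectedDominating G c (outputSet n s)

end WCDS

/-! Call a vertex set a cut if deleting it leaves a disconnected or empty graph. The connected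
dominating sets are exactly the sets that meet every cut (`isConnectedDominating_iff`), hence every
minimal cut, so everything is about hitting the family of minimal cuts.

In a chordal graph minimal cuts are cliques, and each component left over contains a vertex complete
to the cut. If two minimal cuts S and T both had two vertices outside the other, sweeping a clique
from S to T through the region between them would uncover `F₁`, `F₂` or some `H i`
(`hasObstruction_of_sweep`). So in the class at hand, of two minimal cuts one has at most one vertex
outside the other: the family is one-Sperner. Such a family splits at a suitable vertex
(`IsOneSperner.exists_split`), and recursion along the split produces separating weights
(`IsOneSperner.isThreshold`). The claim on split graphs follows because long induced cycles, `F₁`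
and `H i` are not split, so the `F₂`-free split graphs lie in the class, and they are closed under
induced subgraphs.

For the algorithm, fix a simplicial vertex r. Every minimal cut is `sepSet G r v` for some v
(`IsChordal.exists_sepSet_eq`), so there are at most n of them, each computed by one graph search.
Keep the minimal sets once each and order them by size: then every set has exactly one vertex
outside each later one. Under this condition a cheapest hitting set can be assembled from intervals
of the list. With d 0 = 0, let d j be the minimum of d i + c w over i < j and vertices w common to
the sets i, ..., j - 1. Tracing back yields a hitting set of cost at most d m, and `chain_bound`
shows that no hitting set is cheaper.

For the running time, the program is written in a language `Code` whose loops all run n times;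
nesting depth three then means cubic time (`Code.exec_toProg`). -/

namespace WCDS

open Relation

/-! ### Connected sets, components and induced paths -/

section Connectivity

variable {V : Type*} {G : SimpleGraph V}

/-- The vertices that can be reached from `a` by a walk all of whose later vertices lie in `X`. -/
def comp (G : SimpleGraph V) (X : Set V) (a : V) : Set V :=
  {b | ReflTransGen (fun u v => G.Adj u v ∧ v ∈ X) a b}

/-- Every proper nonempty part of `X` is joined by an edge to the rest of `X`. -/
def EdgeConn (G : SimpleGraph V) (X : Set V) : Prop :=
  ∀ Y ⊆ X, Y.Nonempty → (X \ Y).Nonempty → ∃ y ∈ Y, ∃ z ∈ X \ Y, G.Adj y z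

theorem mem_comp_self (X : Set V) (a : V) : a ∈ comp G X a := ReflTransGen.refl

theorem comp_subset {X : Set V} {a : V} (ha : a ∈ X) : comp G X a ⊆ X := by
  intro b hb
  induction hb with
  | refl => exact ha
  | tail _ h _ => exact h.2

theorem comp_closed {X : Set V} {a u v : V} (hu : u ∈ comp G X a) (h : G.Adj u v) (hv : v ∈ X) :
    v ∈ comp G X a := ReflTransGen.tail hu ⟨h, hv⟩

theorem comp_subset_of_closed {X Y : Set V} {a : V} (ha : a ∈ Y)
    (h : ∀ u ∈ Y, ∀ v ∈ X, G.Adj u v → v ∈ Y) : comp G X a ⊆ Y := by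
  intro b hb
  induction hb with
  | refl => exact ha
  | tail _ h1 ih => exact h _ ih _ h1.2 h1.1

theorem edgeConn_comp (X : Set V) (a : V) : EdgeConn G (comp G X a) := by
  intro Y hY hne hne'
  by_contra hcon
  push Not at hcon
  by_cases haY : a ∈ Y
  · obtain ⟨z, hz, hzY⟩ := hne'
    refine hzY (comp_subset_of_closed (Y := Y) haY ?_ hz)
    intro u hu v hv huv
    by_contra hvY
    exact hcon u hu v ⟨comp_closed (hY hu) huv hv, hvY⟩ huv
  · obtain ⟨y, hy⟩ := hne
    refine (comp_subset_of_closed (Y := comp G X a \ Y) ⟨mem_comp_self X a, haY⟩ ?_ (hY hy)).2 hy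
    intro u hu v hv huv
    refine ⟨comp_closed hu.1 huv hv, fun hvY => ?_⟩
    exact hcon v hvY u hu huv.symm

theorem EdgeConn.subset_comp {X Y : Set V} {a : V} (hX : EdgeConn G X) (ha : a ∈ X)
    (hXY : X ⊆ Y) : X ⊆ comp G Y a := by
  by_contra hcon
  obtain ⟨b, hb, hbn⟩ := Set.not_subset.1 hcon
  obtain ⟨y, hy, z, hz, hyz⟩ := hX (X ∩ comp G Y a) Set.inter_subset_left
    ⟨a, ha, mem_comp_self _ _⟩ ⟨b, hb, fun h => hbn h.2⟩
  exact hz.2 ⟨hz.1, comp_closed hy.2 hyz (hXY hz.1)⟩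

theorem edgeConn_iff_preconnected {X : Set V} :
    EdgeConn G X ↔ (G.induce X).Preconnected := by
  constructor
  · intro h a b
    by_contra hab
    obtain ⟨y, ⟨hyX, hy⟩, z, hz, hyz⟩ := h {c | ∃ hc : c ∈ X, (G.induce X).Reachable a ⟨c, hc⟩}
      (fun c hc => hc.1) ⟨a, a.2, SimpleGraph.Reachable.refl _⟩ ⟨b, b.2, fun hb => hab hb.2⟩
    refine hz.2 ⟨hz.1, hy.trans ?_⟩
    exact SimpleGraph.Adj.reachable (G := G.induce X) (u := ⟨y, hyX⟩) (v := ⟨z, hz.1⟩) hyz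
  · intro h Y hY ⟨y, hy⟩ ⟨z, hz⟩
    obtain ⟨p⟩ := h ⟨y, hY hy⟩ ⟨z, hz.1⟩
    obtain ⟨d, _, hd1, hd2⟩ := p.exists_boundary_dart {c | c.1 ∈ Y} hy hz.2
    exact ⟨d.fst, hd1, d.snd, ⟨d.snd.2, hd2⟩, d.adj⟩

theorem EdgeConn.insert {X : Set V} {a b : V} (hX : EdgeConn G X) (hb : b ∈ X) (hab : G.Adj a b) :
    EdgeConn G (insert a X) := by
  have hXm : X ⊆ comp G (Insert.insert a X) b := hX.subset_comp hb (Set.subset_insert _ _)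
  have heq : comp G (Insert.insert a X) b = Insert.insert a X := by
    refine subset_antisymm (comp_subset (Set.mem_insert_of_mem _ hb)) ?_
    rintro y (rfl | hy)
    · exact comp_closed (mem_comp_self _ _) hab.symm (Set.mem_insert _ _)
    · exact hXm hy
  rw [← heq]
  exact edgeConn_comp _ _

theorem isIndContained_of {α : Type*} {F : SimpleGraph α} (f : α → V) (hinj : Function.Injective f)
    (hadj : ∀ a b, G.Adj (f a) (f b) ↔ F.Adj a b) : F.IsIndContained G :=
  ⟨⟨⟨f, hinj⟩, fun {a b} => hadj a b⟩⟩

/-- `f 0, …, f k` is an induced path. -/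
structure IndPath (G : SimpleGraph V) (k : ℕ) (f : ℕ → V) : Prop where
  adj : ∀ i j, i ≤ k → j ≤ k → (G.Adj (f i) (f j) ↔ i + 1 = j ∨ j + 1 = i)
  inj : ∀ i j, i ≤ k → j ≤ k → f i = f j → i = j

theorem IndPath.shift {k : ℕ} {f : ℕ → V} (h : IndPath G k f) {l m : ℕ} (hm : l + m ≤ k) :
    IndPath G m (fun i => f (l + i)) where
  adj i j hi hj := by
    rw [h.adj _ _ (by omega) (by omega)]; omega
  inj i j hi hj hij := by
    have := h.inj _ _ (by omega) (by omega) hij; omega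

theorem exists_seq_of_mem_comp {X : Set V} {a b : V} (ha : a ∈ X) (hb : b ∈ comp G X a) :
    ∃ (k : ℕ) (f : ℕ → V), f 0 = a ∧ f k = b ∧ (∀ i ≤ k, f i ∈ X) ∧
      ∀ i < k, G.Adj (f i) (f (i + 1)) := by
  induction hb with
  | refl => exact ⟨0, fun _ => a, rfl, rfl, fun _ _ => ha, fun i hi => absurd hi (by omega)⟩
  | @tail c d _ h ih =>
    obtain ⟨k, f, h0, hk, hX, hadj⟩ := ih
    refine ⟨k + 1, fun i => if i ≤ k then f i else d, by simp [h0], by simp, ?_, ?_⟩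
    · intro i hi
      by_cases hik : i ≤ k
      · simpa [hik] using hX i hik
      · simpa [hik] using h.2
    · intro i hi
      by_cases hik : i < k
      · have h1 : i ≤ k := by omega
        have h2 : i + 1 ≤ k := by omega
        simpa [h1, h2] using hadj i hik
      · have h1 : i = k := by omega
        subst h1
        simpa [hk] using h.1

theorem EdgeConn.exists_indPath {X : Set V} {a b : V} (hX : EdgeConn G X) (ha : a ∈ X)
    (hb : b ∈ X) : ∃ (k : ℕ) (f : ℕ → V), IndPath G k f ∧ f 0 = a ∧ f k = b ∧ ∀ i ≤ k, f i ∈ X := by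
  classical
  -- A shortest sequence is an induced path: a repetition (`key`) or a chord (`key2`) would allow a
  -- shortcut.
  have hex := exists_seq_of_mem_comp (G := G) ha (hX.subset_comp ha subset_rfl hb)
  obtain ⟨f, h0, hk, hfX, hadj⟩ := Nat.find_spec hex
  have hmin := fun m (hm : m < Nat.find hex) => Nat.find_min hex hm
  set k := Nat.find hex
  have key : ∀ i j, i < j → j ≤ k → ¬ f i = f j := by
    intro i j hij hj he
    refine hmin (k - (j - i)) (by omega) ⟨fun n => if n ≤ i then f n else f (n + (j - i)), ?_, ?_,
      ?_, ?_⟩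
    · simp [h0]
    · dsimp only
      by_cases h : k - (j - i) ≤ i
      · have h1 : k - (j - i) = i := by omega
        have h2 : j = k := by omega
        rw [if_pos h, h1, he, h2, hk]
      · rw [if_neg h, show k - (j - i) + (j - i) = k by omega, hk]
    · intro n hn
      dsimp only
      split_ifs <;> exact hfX _ (by omega)
    · intro n hn
      by_cases h : n + 1 ≤ i
      · have h1 : n ≤ i := by omega
        simpa [h, h1] using hadj n (by omega)
      · by_cases h' : n ≤ i
        · have h1 : n = i := by omega
          subst h1
          simp only [le_refl, if_true, h, if_false, he]
          rw [show n + 1 + (j - n) = j + 1 by omega]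
          exact hadj j (by omega)
        · simp only [h, h', if_false]
          rw [show n + 1 + (j - i) = n + (j - i) + 1 by omega]
          exact hadj _ (by omega)
  have key2 : ∀ i j, i + 1 < j → j ≤ k → ¬ G.Adj (f i) (f j) := by
    intro i j hij hj he
    refine hmin (k - (j - i - 1)) (by omega)
      ⟨fun n => if n ≤ i then f n else f (n + (j - i - 1)), ?_, ?_, ?_, ?_⟩
    · simp [h0]
    · have h : ¬ k - (j - i - 1) ≤ i := by omega
      simp only [h, if_false]
      rw [show k - (j - i - 1) + (j - i - 1) = k by omega, hk]
    · intro n hn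
      dsimp only
      split_ifs <;> exact hfX _ (by omega)
    · intro n hn
      by_cases h : n + 1 ≤ i
      · have h1 : n ≤ i := by omega
        simpa [h, h1] using hadj n (by omega)
      · by_cases h' : n ≤ i
        · have h1 : n = i := by omega
          subst h1
          simp only [le_refl, if_true, h, if_false]
          rw [show n + 1 + (j - n - 1) = j by omega]
          exact he
        · simp only [h, h', if_false]
          rw [show n + 1 + (j - i - 1) = n + (j - i - 1) + 1 by omega]
          exact hadj _ (by omega)
  refine ⟨k, f, ⟨?_, ?_⟩, h0, hk, hfX⟩
  · intro i j hi hj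
    constructor
    · intro h
      rcases lt_trichotomy i j with hij | rfl | hij
      · left
        by_contra hne
        exact key2 i j (by omega) hj h
      · exact absurd rfl h.ne
      · right
        by_contra hne
        exact key2 j i (by omega) hi h.symm
    · rintro (rfl | rfl)
      · exact hadj i (by omega)
      · exact (hadj j (by omega)).symm
  · intro i j hi hj hij
    rcases lt_trichotomy i j with h | h | h
    · exact absurd hij (key i j h hj)
    · exact h
    · exact absurd hij.symm (key j i h hi)

end Connectivity

/-! ### Chordal graphs: fans, complete vertices, Dirac's theorem -/

section Chordal

variable {V : Type*} {G : SimpleGraph V}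

/-- The path closes up through `t` to an induced cycle of length `k + 2`, and `2 ≤ k` makes this at
least four. -/
theorem IsChordal.not_cycle (hG : IsChordal G) {k : ℕ} {f : ℕ → V} (hk : 2 ≤ k)
    (hf : IndPath G k f) {t : V} (ht : ∀ i ≤ k, t ≠ f i) (h0 : G.Adj t (f 0))
    (h1 : G.Adj t (f k)) (hn : ∀ i, 0 < i → i < k → ¬ G.Adj t (f i)) : False := by
  refine hG (k + 2) (by omega)
    (isIndContained_of (fun i => if i.val ≤ k then f i.val else t) ?_ ?_)
  · intro i j hij
    have hi := i.2
    have hj := j.2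
    ext
    dsimp only at hij
    split_ifs at hij with h h' h'
    · exact hf.inj _ _ h h' hij
    · exact absurd hij.symm (ht _ h)
    · exact absurd hij (ht _ h')
    · omega
  · intro i j
    have hi := i.2
    have hj := j.2
    -- Differences in `Fin (k + 2)` wrap around; the second alternative is the edge between `f 0`
    -- and `t`, which sits at position `k + 1`.
    have e : ∀ x y : Fin (k + 2), (x - y).val = 1 ↔ x.val = y.val + 1 ∨
        (x.val = 0 ∧ y.val = k + 1) := by
      intro x y
      have hx := x.2
      have hy := y.2
      rw [Fin.sub_def]
      dsimp only
      by_cases hxy : y.val ≤ x.val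
      · rw [show k + 2 - y.val + x.val = (x.val - y.val) + (k + 2) by omega, Nat.add_mod_right,
          Nat.mod_eq_of_lt (by omega)]
        omega
      · rw [Nat.mod_eq_of_lt (by omega)]
        omega
    have hc : (SimpleGraph.cycleGraph (k + 2)).Adj i j ↔
      i.val = j.val + 1 ∨ (i.val = 0 ∧ j.val = k + 1) ∨
        j.val = i.val + 1 ∨ (j.val = 0 ∧ i.val = k + 1) := by
      rw [SimpleGraph.cycleGraph_adj', e, e]
      tauto
    rw [hc]
    split_ifs with h h' h'
    · rw [hf.adj _ _ h h']; omega
    · rw [SimpleGraph.adj_comm]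
      constructor
      · intro ha
        by_contra hcon
        exact hn i.val (by omega) (by omega) ha
      · intro hij
        have : i.val = 0 ∨ i.val = k := by omega
        rcases this with h2 | h2 <;> rw [h2] <;> assumption
    · constructor
      · intro ha
        by_contra hcon
        exact hn j.val (by omega) (by omega) ha
      · intro hij
        have : j.val = 0 ∨ j.val = k := by omega
        rcases this with h2 | h2 <;> rw [h2] <;> assumption
    · constructor
      · intro ha; exact absurd rfl ha.ne
      · omega

/-- In a chordal graph, a vertex adjacent to both ends of an induced path is adjacent to all of
it. -/
theorem IsChordal.fan (hG : IsChordal G) {t : V} : ∀ (k : ℕ) (f : ℕ → V), IndPath G k f →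
    (∀ i ≤ k, t ≠ f i) → G.Adj t (f 0) → G.Adj t (f k) → ∀ i ≤ k, G.Adj t (f i) := by
  intro k
  induction k using Nat.strong_induction_on with
  | _ k ih =>
    intro f hf ht h0 h1 i hi
    by_contra hni
    have hi0 : 0 < i := by
      rcases Nat.eq_zero_or_pos i with rfl | h
      · exact absurd h0 hni
      · exact h
    have hik : i < k := by
      rcases hi.eq_or_lt with rfl | h
      · exact absurd h1 hni
      · exact h
    -- An interior neighbor of `t` splits the path into two shorter ones; if there is none, `t`
    -- closes an induced cycle.
    by_cases hex : ∃ j, 0 < j ∧ j < k ∧ G.Adj t (f j)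
    · obtain ⟨j, hj0, hjk, hj⟩ := hex
      by_cases hij : i ≤ j
      · have := ih j hjk (fun i => f (0 + i)) (hf.shift (by omega))
          (fun i hi => ht _ (by omega)) (by simpa using h0) (by simpa using hj) i hij
        exact hni (by simpa using this)
      · have := ih (k - j) (by omega) (fun i => f (j + i)) (hf.shift (by omega))
          (fun i hi => ht _ (by omega)) (by simpa using hj)
          (by simpa [show j + (k - j) = k by omega] using h1) (i - j) (by omega)
        exact hni (by simpa [show j + (i - j) = i by omega] using this)
    · push Not at hex
      exact hG.not_cycle (by omega) hf ht h0 h1 hex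

/-- In a chordal graph, the neighbors of `a` that are adjacent to a connected set without neighbors
of `a` are pairwise adjacent. -/
theorem IsChordal.adj_of_adj_edgeConn (hG : IsChordal G) {a c c' : V} {X : Set V}
    (hX : EdgeConn G X) (haX : a ∉ X) (hanti : ∀ x ∈ X, ¬ G.Adj a x) (hc : G.Adj a c)
    (hc' : G.Adj a c') (hcc : c ≠ c') {x x' : V} (hx : x ∈ X) (hx' : x' ∈ X)
    (hcx : G.Adj c x) (hcx' : G.Adj c' x') : G.Adj c c' := by
  by_contra hncc
  -- An induced path from `c` to `c'` has its interior in `X`, and the interior is nonempty if `c`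
  -- and `c'` are not adjacent. By `fan`, `a` would be adjacent to it.
  have hconn : EdgeConn G (insert c (insert c' X)) :=
    (hX.insert hx' hcx').insert (Set.mem_insert_of_mem _ hx) hcx
  obtain ⟨k, f, hf, h0, hk, hfX⟩ := hconn.exists_indPath (Or.inl rfl) (Or.inr (Or.inl rfl))
  have hk2 : 2 ≤ k := by
    by_contra hk2
    have : k = 0 ∨ k = 1 := by omega
    rcases this with rfl | rfl
    · exact hcc (h0.symm.trans hk)
    · have := (hf.adj 0 1 (by omega) (by omega)).2 (by simp)
      rw [h0, hk] at this
      exact hncc this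
  have hat : ∀ i ≤ k, a ≠ f i := by
    intro i hi he
    rcases hfX i hi with h | h | h
    · exact hc.ne (he.trans h)
    · exact hc'.ne (he.trans h)
    · exact haX (he ▸ h)
  have h1 := hG.fan k f hf hat (h0 ▸ hc) (hk ▸ hc') 1 (by omega)
  rcases hfX 1 (by omega) with h | h | h
  · exact absurd (hf.inj 1 0 (by omega) (by omega) (h.trans h0.symm)) (by omega)
  · exact absurd (hf.inj 1 k (by omega) (by omega) (h.trans hk.symm)) (by omega)
  · exact hanti _ h h1

/-- In a chordal graph, a connected set every vertex of a clique `S` has a neighbor in contains a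
vertex adjacent to all of `S`. -/
theorem IsChordal.exists_complete [Finite V] (hG : IsChordal G) {S A : Set V} (hS : G.IsClique S)
    (hA : EdgeConn G A) (hne : A.Nonempty) (hdisj : ∀ s ∈ S, s ∉ A)
    (hnb : ∀ s ∈ S, ∃ a ∈ A, G.Adj s a) : ∃ a ∈ A, ∀ s ∈ S, G.Adj s a := by
  -- A vertex of `A` with the most neighbors in `S` works. If it missed `s`, the last vertex before
  -- `s` on an induced path from `a` to `s` would be adjacent to `s` and, by `fan`, to all neighbors
  -- of `a` in `S`.
  obtain ⟨a, ha, hmax⟩ := Set.exists_max_image A (fun a => {s | s ∈ S ∧ G.Adj s a}.ncard)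
    (Set.toFinite A) hne
  refine ⟨a, ha, fun s hs => ?_⟩
  by_contra hsa
  have hconn : EdgeConn G (insert s A) := by
    obtain ⟨b, hb, hsb⟩ := hnb s hs
    exact hA.insert hb hsb
  obtain ⟨k, f, hf, h0, hk, hfX⟩ := hconn.exists_indPath (Or.inr ha) (Or.inl rfl)
  have hk2 : 2 ≤ k := by
    by_contra hk2
    have : k = 0 ∨ k = 1 := by omega
    rcases this with rfl | rfl
    · exact hdisj s hs (by rw [← hk, h0]; exact ha)
    · have := (hf.adj 0 1 (by omega) (by omega)).2 (by simp)
      rw [h0, hk] at this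
      exact hsa this.symm
  have hfA : ∀ i < k, f i ∈ A := by
    intro i hi
    rcases hfX i hi.le with h | h
    · exact absurd (hf.inj i k (by omega) (by omega) (h.trans hk.symm)) (by omega)
    · exact h
  have hlt := hmax (f (k - 1)) (hfA _ (by omega))
  refine absurd hlt (not_le.2 (Set.ncard_lt_ncard (LE.le.ssubset_of_not_superset ?_ ?_)
    (Set.toFinite _)))
  · rintro t ⟨ht, hta⟩
    refine ⟨ht, ?_⟩
    have hts : t ≠ s := by
      rintro rfl
      exact hsa hta
    refine hG.fan k f hf ?_ (h0 ▸ hta) (hk ▸ hS ht hs hts) (k - 1) (by omega)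
    intro i hi he
    rcases hfX i hi with h | h
    · exact hts (he.trans h)
    · exact hdisj t ht (he ▸ h)
  · intro hsub
    have : s ∈ {s | s ∈ S ∧ G.Adj s (f (k - 1))} := by
      refine ⟨hs, ?_⟩
      have := (hf.adj k (k - 1) (by omega) (by omega)).2 (by omega)
      rwa [hk] at this
    exact hsa (hsub this).2

/-- Dirac's theorem, for the induced subgraph on `U`. -/
theorem IsChordal.clique_or_simplicial_pair [Finite V] (hG : IsChordal G) (m : ℕ) :
    ∀ U : Set V, U.ncard = m → G.IsClique U ∨ ∃ u ∈ U, ∃ v ∈ U, u ≠ v ∧ ¬ G.Adj u v ∧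
      G.IsClique {w | w ∈ U ∧ G.Adj u w} ∧ G.IsClique {w | w ∈ U ∧ G.Adj v w} := by
  induction m using Nat.strong_induction_on with
  | _ m ih =>
    intro U hU
    by_cases hcl : G.IsClique U
    · exact Or.inl hcl
    right
    have : ∃ a ∈ U, ∃ b ∈ U, a ≠ b ∧ ¬ G.Adj a b := by
      by_contra hcon
      push Not at hcon
      exact hcl fun a ha b hb hab => hcon a ha b hb hab
    obtain ⟨a, ha, b, hb, hab, hnab⟩ := this
    -- `B` is the component of `b` off the closed neighborhood of `a`, and the clique `C` separates
    -- it from `a`. Induction on `B ∪ C` gives a simplicial vertex in `B`, induction on `U \ B` one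
    -- outside `B ∪ C`, because the clique `C` contains at most one of two nonadjacent vertices.
    set X : Set V := {x | x ∈ U ∧ x ≠ a ∧ ¬ G.Adj a x} with hXdef
    have hbX : b ∈ X := ⟨hb, hab.symm, hnab⟩
    set B := comp G X b with hBdef
    have hBX : B ⊆ X := comp_subset hbX
    set C : Set V := {c | c ∈ U ∧ G.Adj a c ∧ ∃ x ∈ B, G.Adj c x} with hCdef
    have hCcl : G.IsClique C := by
      rintro c ⟨_, hac, x, hx, hcx⟩ c' ⟨_, hac', x', hx', hcx'⟩ hcc
      exact hG.adj_of_adj_edgeConn (edgeConn_comp X b) (fun h => (hBX h).2.1 rfl)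
        (fun x hx => (hBX hx).2.2) hac hac' hcc hx hx' hcx hcx'
    have hBnb : ∀ x ∈ B, ∀ y ∈ U, G.Adj x y → y ∈ B ∪ C := by
      intro x hx y hy hxy
      by_cases hya : G.Adj a y
      · exact Or.inr ⟨hy, hya, x, hx, hxy.symm⟩
      · refine Or.inl (comp_closed hx hxy ⟨hy, ?_, hya⟩)
        rintro rfl
        exact (hBX hx).2.2 hxy.symm
    have hBU : B ⊆ U := fun x hx => (hBX hx).1
    have hfin := Set.toFinite U
    have hu : ∃ u ∈ B, G.IsClique {w | w ∈ U ∧ G.Adj u w} := by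
      have hsub : B ∪ C ⊆ U := Set.union_subset hBU fun c hc => hc.1
      have key : ∀ u ∈ B, G.IsClique {w | w ∈ B ∪ C ∧ G.Adj u w} →
          G.IsClique {w | w ∈ U ∧ G.Adj u w} := fun u hu h =>
        h.subset fun w (hw : w ∈ U ∧ G.Adj u w) =>
          (⟨hBnb u hu w hw.1 hw.2, hw.2⟩ : w ∈ B ∪ C ∧ G.Adj u w)
      have hlt : (B ∪ C).ncard < m := by
        rw [← hU]
        refine Set.ncard_lt_ncard (t := U) (Set.ssubset_iff_subset_ne.2 ⟨hsub, fun h => ?_⟩) hfin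
        rcases h.symm ▸ ha with h1 | h1
        · exact (hBX h1).2.1 rfl
        · exact absurd rfl h1.2.1.ne
      rcases ih _ hlt (B ∪ C) rfl with h | ⟨u, hu, v, hv, huv, hnuv, h1, h2⟩
      · exact ⟨b, mem_comp_self _ _, key b (mem_comp_self _ _) (h.subset fun w hw => hw.1)⟩
      · rcases hu with hu | hu
        · exact ⟨u, hu, key u hu h1⟩
        · rcases hv with hv | hv
          · exact ⟨v, hv, key v hv h2⟩
          · exact absurd (hCcl hu hv huv) hnuv
    have hv : ∃ v ∈ U \ B, v ∉ C ∧ G.IsClique {w | w ∈ U ∧ G.Adj v w} := by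
      have key : ∀ v ∈ U \ B, v ∉ C → G.IsClique {w | w ∈ U \ B ∧ G.Adj v w} →
          G.IsClique {w | w ∈ U ∧ G.Adj v w} := by
        intro v hv hvC h
        refine h.subset fun w (hw : w ∈ U ∧ G.Adj v w) =>
          (⟨⟨hw.1, fun hwB => ?_⟩, hw.2⟩ : w ∈ U \ B ∧ G.Adj v w)
        rcases hBnb w hwB v hv.1 hw.2.symm with h1 | h1
        · exact hv.2 h1
        · exact hvC h1
      have hlt : (U \ B).ncard < m := by
        rw [← hU]
        exact Set.ncard_lt_ncard (t := U) (Set.ssubset_iff_subset_ne.2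
          ⟨Set.sdiff_subset, fun h => (h.symm ▸ hb : b ∈ U \ B).2 (mem_comp_self _ _)⟩) hfin
      have haB : a ∈ U \ B := ⟨ha, fun h => (hBX h).2.1 rfl⟩
      have haC : a ∉ C := fun h => absurd rfl h.2.1.ne
      rcases ih _ hlt (U \ B) rfl with h | ⟨u, hu, v, hv, huv, hnuv, h1, h2⟩
      · exact ⟨a, haB, haC, key a haB haC (h.subset fun w hw => hw.1)⟩
      · by_cases huC : u ∈ C
        · by_cases hvC : v ∈ C
          · exact absurd (hCcl huC hvC huv) hnuv
          · exact ⟨v, hv, hvC, key v hv hvC h2⟩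
        · exact ⟨u, hu, huC, key u hu huC h1⟩
    obtain ⟨u, huB, hu⟩ := hu
    obtain ⟨v, hvB, hvC, hv⟩ := hv
    refine ⟨u, hBU huB, v, hvB.1, ?_, ?_, hu, hv⟩
    · rintro rfl
      exact hvB.2 huB
    · intro h
      rcases hBnb u huB v hvB.1 h with h1 | h1
      · exact hvB.2 h1
      · exact hvC h1

theorem IsChordal.exists_simplicial [Finite V] [Nonempty V] (hG : IsChordal G) :
    ∃ r, G.IsClique {w | G.Adj r w} := by
  rcases hG.clique_or_simplicial_pair _ Set.univ rfl with h | ⟨u, _, _, _, _, _, h, _⟩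
  · exact ⟨Classical.arbitrary V, h.subset (Set.subset_univ _)⟩
  · exact ⟨u, by simpa using h⟩

end Chordal

/-! ### Recognizing the forbidden induced subgraphs -/

section Obstructions

variable {V : Type*} {G : SimpleGraph V}

/-- `G` contains `F₁`, `F₂` or some `Hᵢ` with `i ≥ 1` as an induced subgraph. -/
def HasObstruction (G : SimpleGraph V) : Prop :=
  F₁.IsIndContained G ∨ F₂.IsIndContained G ∨ ∃ i, 1 ≤ i ∧ (H i).IsIndContained G

theorem IsF₁F₂HFree.not_hasObstruction (h : IsF₁F₂HFree G) : ¬ HasObstruction G := by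
  rintro (h1 | h1 | ⟨i, hi, h1⟩)
  exacts [h.1 h1, h.2.1 h1, h.2.2 i hi h1]

/-- Injectivity of `f` comes for free: two vertices of `F` with the same image would have the same
neighborhood. -/
theorem isIndContained_of_lt {n : ℕ} {F : SimpleGraph (Fin n)}
    (hF : ∀ a b, (∀ c, F.Adj a c ↔ F.Adj b c) → a = b) (f : Fin n → V)
    (hadj : ∀ a b, a < b → (G.Adj (f a) (f b) ↔ F.Adj a b)) : F.IsIndContained G := by
  have hadj' : ∀ a b, G.Adj (f a) (f b) ↔ F.Adj a b := by
    intro a b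
    rcases lt_trichotomy a b with h | rfl | h
    · exact hadj a b h
    · simp
    · rw [G.adj_comm, F.adj_comm]; exact hadj b a h
  refine isIndContained_of f (fun a b hab => hF a b fun c => ?_) hadj'
  rw [← hadj', ← hadj', hab]

instance : DecidableRel F₁.Adj := fun a b => by unfold F₁; infer_instance

instance : DecidableRel F₂.Adj := fun a b => by unfold F₂; infer_instance

theorem F₁_isIndContained {v₀ v₁ v₂ v₃ v₄ v₅ : V} (h01 : G.Adj v₀ v₁) (h02 : G.Adj v₀ v₂)
    (h12 : G.Adj v₁ v₂) (h13 : G.Adj v₁ v₃) (h23 : G.Adj v₂ v₃) (h24 : G.Adj v₂ v₄)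
    (h34 : G.Adj v₃ v₄) (h35 : G.Adj v₃ v₅) (h45 : G.Adj v₄ v₅) (h03 : ¬ G.Adj v₀ v₃)
    (h04 : ¬ G.Adj v₀ v₄) (h05 : ¬ G.Adj v₀ v₅) (h14 : ¬ G.Adj v₁ v₄) (h15 : ¬ G.Adj v₁ v₅)
    (h25 : ¬ G.Adj v₂ v₅) : F₁.IsIndContained G := by
  refine isIndContained_of_lt (by decide) ![v₀, v₁, v₂, v₃, v₄, v₅] ?_
  intro a b hab
  fin_cases a <;> fin_cases b <;> first
    | exact absurd hab (by decide)
    | exact iff_of_true (by assumption) (by decide)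
    | exact iff_of_false (by assumption) (by decide)

theorem F₂_isIndContained {v₀ v₁ v₂ v₃ v₄ v₅ : V} (h01 : G.Adj v₀ v₁) (h02 : G.Adj v₀ v₂)
    (h03 : G.Adj v₀ v₃) (h12 : G.Adj v₁ v₂) (h13 : G.Adj v₁ v₃) (h23 : G.Adj v₂ v₃)
    (h04 : G.Adj v₀ v₄) (h14 : G.Adj v₁ v₄) (h25 : G.Adj v₂ v₅) (h35 : G.Adj v₃ v₅)
    (h24 : ¬ G.Adj v₂ v₄) (h34 : ¬ G.Adj v₃ v₄) (h05 : ¬ G.Adj v₀ v₅) (h15 : ¬ G.Adj v₁ v₅)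
    (h45 : ¬ G.Adj v₄ v₅) : F₂.IsIndContained G := by
  refine isIndContained_of_lt (by decide) ![v₀, v₁, v₂, v₃, v₄, v₅] ?_
  intro a b hab
  fin_cases a <;> fin_cases b <;> first
    | exact absurd hab (by decide)
    | exact iff_of_true (by assumption) (by decide)
    | exact iff_of_false (by assumption) (by decide)

theorem H_adj_of_lt {i : ℕ} {a b : Fin (i + 6)} (hab : a < b) : (H i).Adj a b ↔
    b.val = a.val + 1 ∨
      (b.val = a.val + 2 ∧ (a.val = 0 ∨ a.val = 1 ∨ a.val = i + 2 ∨ a.val = i + 3)) := by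
  unfold H
  rw [SimpleGraph.fromRel_adj]
  have h : a.val < b.val := hab
  constructor
  · rintro ⟨_, h1 | h1⟩ <;> omega
  · intro h1
    exact ⟨hab.ne, Or.inl h1⟩

/-- For twins `a < b`, the neighbor `a + 1` of `a` must be adjacent to `b`, and the neighbor `b + 1`
of `b` to `a`, or, if `b` is the last vertex, `a - 1` to `b`. The adjacency pattern does not allow
this. -/
theorem H_twin_free {i : ℕ} (a b : Fin (i + 6)) (h : ∀ c, (H i).Adj a c ↔ (H i).Adj b c) :
    a = b := by
  wlog hab : a < b generalizing a b
  · rcases lt_trichotomy a b with h1 | h1 | h1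
    · exact absurd h1 hab
    · exact h1
    · exact (this b a (fun c => (h c).symm) h1).symm
  exfalso
  have hlt : a.val < b.val := hab
  have hb := b.2
  have hnab : ¬ (H i).Adj a b := by
    rw [h b]; exact (H i).loopless.irrefl b
  rw [H_adj_of_lt hab] at hnab
  have h1 : (H i).Adj b ⟨a.val + 1, by omega⟩ :=
    (h _).1 ((H_adj_of_lt (a := a) (b := ⟨a.val + 1, by omega⟩)
      (show a.val < a.val + 1 by omega)).2 (Or.inl rfl))
  have h2 : (⟨a.val + 1, by omega⟩ : Fin (i + 6)) < b := show a.val + 1 < b.val by omega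
  rw [SimpleGraph.adj_comm, H_adj_of_lt h2] at h1
  dsimp only at h1
  by_cases hb5 : b.val + 1 < i + 6
  · have h3 : (H i).Adj a ⟨b.val + 1, hb5⟩ :=
      (h _).2 ((H_adj_of_lt (a := b) (b := ⟨b.val + 1, hb5⟩)
        (show b.val < b.val + 1 by omega)).2 (Or.inl rfl))
    rw [H_adj_of_lt (show a.val < b.val + 1 by omega)] at h3
    dsimp only at h3
    omega
  · have h3 : (H i).Adj b ⟨a.val - 1, by omega⟩ := by
      rw [← h, SimpleGraph.adj_comm, H_adj_of_lt (show a.val - 1 < a.val by omega)]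
      dsimp only
      omega
    rw [SimpleGraph.adj_comm, H_adj_of_lt (show a.val - 1 < b.val by omega)] at h3
    dsimp only at h3
    omega

-- The diamonds are `x, s₁, s₂, y 0` and `y k, r₁, r₂, u`. The path `y 0, …, y k` has `k + 1`
-- vertices, hence the index.
set_option maxHeartbeats 1000000 in
theorem H_isIndContained {k : ℕ} {y : ℕ → V} (hy : IndPath G k y) {x s₁ s₂ r₁ r₂ u : V}
    (hx1 : G.Adj x s₁) (hx2 : G.Adj x s₂) (hs : G.Adj s₁ s₂) (hs1 : G.Adj s₁ (y 0))
    (hs2 : G.Adj s₂ (y 0)) (hxy : ∀ i ≤ k, ¬ G.Adj x (y i))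
    (hsy1 : ∀ i ≤ k, 0 < i → ¬ G.Adj s₁ (y i)) (hsy2 : ∀ i ≤ k, 0 < i → ¬ G.Adj s₂ (y i))
    (hxr1 : ¬ G.Adj x r₁) (hxr2 : ¬ G.Adj x r₂) (hxu : ¬ G.Adj x u)
    (hs1r1 : ¬ G.Adj s₁ r₁) (hs1r2 : ¬ G.Adj s₁ r₂) (hs1u : ¬ G.Adj s₁ u)
    (hs2r1 : ¬ G.Adj s₂ r₁) (hs2r2 : ¬ G.Adj s₂ r₂) (hs2u : ¬ G.Adj s₂ u)
    (hr1 : G.Adj (y k) r₁) (hr2 : G.Adj (y k) r₂) (hr : G.Adj r₁ r₂)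
    (hu1 : G.Adj r₁ u) (hu2 : G.Adj r₂ u) (hyr1 : ∀ i < k, ¬ G.Adj (y i) r₁)
    (hyr2 : ∀ i < k, ¬ G.Adj (y i) r₂) (hyu : ∀ i ≤ k, ¬ G.Adj (y i) u) :
    (H (k + 1)).IsIndContained G := by
  let f : Fin (k + 1 + 6) → V := fun i =>
    if i.val = 0 then x else if i.val = 1 then s₁ else if i.val = 2 then s₂ else
      if i.val < k + 4 then y (i.val - 3) else if i.val = k + 4 then r₁ else
        if i.val = k + 5 then r₂ else u
  refine isIndContained_of_lt H_twin_free f ?_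
  intro a b hab
  rw [H_adj_of_lt hab]
  have hlt : a.val < b.val := hab
  have hb := b.2
  have yy : ∀ i j, i ≤ k → j ≤ k → i < j → (G.Adj (y i) (y j) ↔ j = i + 1) := by
    intro i j hi hj hij
    rw [hy.adj i j hi hj]; omega
  have y0 : ∀ i, G.Adj s₁ (y i) ∧ G.Adj s₂ (y i) ∨ i ≠ 0 := by
    intro i
    rcases Nat.eq_zero_or_pos i with rfl | h
    · exact Or.inl ⟨hs1, hs2⟩
    · exact Or.inr h.ne'
  have yk : ∀ i, G.Adj (y i) r₁ ∧ G.Adj (y i) r₂ ∨ i ≠ k := by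
    intro i
    by_cases h : i = k
    · subst h; exact Or.inl ⟨hr1, hr2⟩
    · exact Or.inr h
  simp only [f]
  split_ifs <;> first
    | (exfalso; omega)
    | exact iff_of_true (by assumption) (by omega)
    | exact iff_of_false (by assumption) (by omega)
    | (rw [yy _ _ (by omega) (by omega) (by omega)]; omega)
    | exact iff_of_false (hxy _ (by omega)) (by omega)
    | exact iff_of_false (hyu _ (by omega)) (by omega)
    | (rcases y0 (b.val - 3) with h | h
       · first
          | exact iff_of_true h.1 (by by_contra; exact hsy1 (b.val - 3) (by omega) (by omega) h.1)
          | exact iff_of_true h.2 (by by_contra; exact hsy2 (b.val - 3) (by omega) (by omega) h.2)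
       · first
          | exact iff_of_false (hsy1 _ (by omega) (by omega)) (by omega)
          | exact iff_of_false (hsy2 _ (by omega) (by omega)) (by omega))
    | (rcases yk (a.val - 3) with h | h
       · first
          | exact iff_of_true h.1 (by by_contra; exact hyr1 (a.val - 3) (by omega) h.1)
          | exact iff_of_true h.2 (by by_contra; exact hyr2 (a.val - 3) (by omega) h.2)
       · first
          | exact iff_of_false (hyr1 _ (by omega)) (by omega)
          | exact iff_of_false (hyr2 _ (by omega)) (by omega))

/-- A strip of four triangles `x s₁ s₂`, `s₁ s₂ t`, `s₁ t v`, `t v u`. -/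
theorem hasObstruction_of_strip {x s₁ s₂ t v u : V} (hx1 : G.Adj x s₁) (hx2 : G.Adj x s₂)
    (hs : G.Adj s₁ s₂) (ht1 : G.Adj t s₁) (ht2 : G.Adj t s₂) (hvt : G.Adj v t) (hv1 : G.Adj v s₁)
    (hut : G.Adj u t) (huv : G.Adj u v) (hxt : ¬ G.Adj x t) (hxv : ¬ G.Adj x v)
    (hxu : ¬ G.Adj x u) (hu1 : ¬ G.Adj u s₁) (hu2 : ¬ G.Adj u s₂) : HasObstruction G := by
  -- The one undetermined pair decides between `F₂`, with clique `s₁, s₂, t, v`, and `F₁`, the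
  -- square of the path `x, s₂, s₁, t, v, u`.
  by_cases hv2 : G.Adj v s₂
  · refine Or.inr (Or.inl ?_)
    exact F₂_isIndContained (v₀ := s₁) (v₁ := s₂) (v₂ := t) (v₃ := v) (v₄ := x) (v₅ := u) hs
      ht1.symm hv1.symm ht2.symm hv2.symm hvt.symm hx1.symm hx2.symm hut.symm huv.symm
      (fun h => hxt h.symm) (fun h => hxv h.symm) (fun h => hu1 h.symm) (fun h => hu2 h.symm) hxu
  · refine Or.inl ?_
    exact F₁_isIndContained (v₀ := x) (v₁ := s₂) (v₂ := s₁) (v₃ := t) (v₄ := v) (v₅ := u) hx2 hx1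
      hs.symm ht2.symm ht1.symm hv1.symm hvt.symm hut.symm huv.symm hxt hxv hxu
      (fun h => hv2 h.symm) (fun h => hu2 h.symm) (fun h => hu1 h.symm)

/-- The condition in `EdgeConn` is symmetric in a part and its complement, and one of these misses
`p`. -/
theorem edgeConn_of_avoiding {X : Set V} (p : V)
    (h : ∀ Y ⊆ X, p ∉ Y → Y.Nonempty → ∃ y ∈ Y, ∃ z ∈ X \ Y, G.Adj y z) : EdgeConn G X := by
  intro Y hY hne hne'
  by_cases hpY : p ∈ Y
  · obtain ⟨y, hy, z, hz, hyz⟩ := h (X \ Y) Set.sdiff_subset (fun h => h.2 hpY) hne'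
    refine ⟨z, ?_, y, hy, hyz.symm⟩
    by_contra hzY
    exact hz.2 ⟨hz.1, hzY⟩
  · exact h Y hY hpY hne

end Obstructions

/-! ### Sweeping a clique through the region between two cuts -/

section Sweep

variable {V : Type*} {G : SimpleGraph V}

/-- The vertices `x, s₁, s₂, a` form the first diamond of an `H i`. Its path follows an induced path
in `Z` from `a` to `b'`, up to the first vertex with a neighbor in `T`, where the second diamond
begins. Both `b'` in `Z` and `b`, which has no neighbor in `Z`, are complete to `T`; this supplies
the rest of that diamond. -/
theorem hasObstruction_of_cutvertex (hG : IsChordal G) [Finite V] {T Z : Set V}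
    {a b b' x s₁ s₂ t₀ t₀' : V}
    (ht₀ : t₀ ∈ T) (ht₀' : t₀' ∈ T) (htt : t₀ ≠ t₀') (hT : G.IsClique T)
    (hb : ∀ t ∈ T, G.Adj b t) (hTZ : ∀ t ∈ T, t ∉ Z) (hZ : EdgeConn G Z) (ha : a ∈ Z)
    (hb' : b' ∈ Z) (hb'T : ∀ t ∈ T, G.Adj t b') (hbZ : ∀ z ∈ Z, ¬ G.Adj b z)
    (hxZ : ∀ z ∈ Z, ¬ G.Adj x z) (hxT : ∀ t ∈ T, ¬ G.Adj x t) (hxb : ¬ G.Adj x b)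
    (hs1Z : ∀ z ∈ Z, z ≠ a → ¬ G.Adj s₁ z) (hs2Z : ∀ z ∈ Z, z ≠ a → ¬ G.Adj s₂ z)
    (hs1T : ∀ t ∈ T, ¬ G.Adj s₁ t) (hs2T : ∀ t ∈ T, ¬ G.Adj s₂ t)
    (hs1b : ¬ G.Adj s₁ b) (hs2b : ¬ G.Adj s₂ b) (hx1 : G.Adj x s₁) (hx2 : G.Adj x s₂)
    (hs : G.Adj s₁ s₂) (hs1 : G.Adj s₁ a) (hs2 : G.Adj s₂ a) : HasObstruction G := by
  classical
  obtain ⟨k, f, hf, h0, hk, hfZ⟩ := hZ.exists_indPath ha hb'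
  have hex : ∃ i, i ≤ k ∧ ∃ t ∈ T, G.Adj (f i) t :=
    ⟨k, le_rfl, t₀, ht₀, by rw [hk]; exact (hb'T _ ht₀).symm⟩
  obtain ⟨hmk, t₁, ht₁, hmt⟩ := Nat.find_spec hex
  have hmin : ∀ i < Nat.find hex, ∀ t ∈ T, ¬ G.Adj (f i) t := fun i hi t ht h =>
    Nat.find_min hex hi ⟨by omega, t, ht, h⟩
  set m := Nat.find hex
  have hfa : ∀ i ≤ k, 0 < i → f i ≠ a := by
    intro i hi hpos he
    exact hpos.ne' (hf.inj i 0 hi (by omega) (he.trans h0.symm))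
  have hpath : IndPath G m f := by simpa using hf.shift (l := 0) (m := m) (by omega)
  -- The second diamond has tips `f m` and `u` and middle vertices `t₁` and `r₂`; it remains to find
  -- `r₂` and `u`.
  have key : ∀ r₂ u : V, G.Adj (f m) r₂ → G.Adj t₁ r₂ → G.Adj t₁ u → G.Adj r₂ u →
      ¬ G.Adj x r₂ → ¬ G.Adj x u → ¬ G.Adj s₁ r₂ → ¬ G.Adj s₁ u → ¬ G.Adj s₂ r₂ → ¬ G.Adj s₂ u →
      (∀ i < m, ¬ G.Adj (f i) r₂) → (∀ i ≤ m, ¬ G.Adj (f i) u) → HasObstruction G := by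
    intro r₂ u h1 h2 h3 h4 h5 h6 h7 h8 h9 h10 h11 h12
    refine Or.inr (Or.inr ⟨m + 1, by omega, ?_⟩)
    exact H_isIndContained hpath hx1 hx2 hs (h0 ▸ hs1) (h0 ▸ hs2)
      (fun i hi => hxZ _ (hfZ i (by omega)))
      (fun i hi h => hs1Z _ (hfZ i (by omega)) (hfa i (by omega) h))
      (fun i hi h => hs2Z _ (hfZ i (by omega)) (hfa i (by omega) h)) (hxT _ ht₁) h5 h6
      (hs1T _ ht₁) h7 h8 (hs2T _ ht₁) h9 h10 hmt h1 h2 h3 h4 (fun i hi => hmin i hi _ ht₁) h11 h12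
  have hother : ∃ t ∈ T, t ≠ t₁ := by
    by_cases h : t₀ = t₁
    · exact ⟨t₀', ht₀', fun h' => htt (h.trans h'.symm)⟩
    · exact ⟨t₀, ht₀, h⟩
  -- A second neighbor of `f m` in `T` serves as `r₂`, with `b` as the far tip.
  by_cases h2 : ∃ t₂ ∈ T, t₂ ≠ t₁ ∧ G.Adj (f m) t₂
  · obtain ⟨t₂, ht₂, hne, hmt2⟩ := h2
    exact key t₂ b hmt2 (hT ht₁ ht₂ hne.symm) (hb _ ht₁).symm (hb _ ht₂).symm (hxT _ ht₂) hxb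
      (hs1T _ ht₂) hs1b (hs2T _ ht₂) hs2b (fun i hi => hmin i hi _ ht₂)
      (fun i hi h => hbZ _ (hfZ i (by omega)) h.symm)
  push Not at h2
  have hmk' : m < k := by
    rcases hmk.eq_or_lt with h | h
    · obtain ⟨t, ht, hne⟩ := hother
      exact absurd (by rw [h, hk]; exact (hb'T t ht).symm) (h2 t ht hne)
    · exact h
  -- From `f m` on the path stays in the neighborhood of `t₁`, so `f (m + 1)` can be `r₂`; the far
  -- tip is another vertex of `T` or else `f (m + 2)`. The path is long enough because its end `b'`
  -- is adjacent to all of `T`, which has at least two vertices.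
  have hfan : ∀ i, m ≤ i → i ≤ k → G.Adj t₁ (f i) := by
    intro i hmi hik
    have := hG.fan (t := t₁) (k - m) (fun i => f (m + i)) (hf.shift (by omega))
      (fun i hi he => hTZ _ ht₁ (he ▸ hfZ _ (by omega))) (by simpa using hmt.symm)
      (by simpa [show m + (k - m) = k by omega, hk] using hb'T _ ht₁) (i - m) (by omega)
    simpa [show m + (i - m) = i by omega] using this
  have hnext : ∀ i ≤ k, 0 < i → ¬ G.Adj x (f i) ∧ ¬ G.Adj s₁ (f i) ∧ ¬ G.Adj s₂ (f i) :=
    fun i hi hpos => ⟨hxZ _ (hfZ i hi), hs1Z _ (hfZ i hi) (hfa i hi hpos),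
      hs2Z _ (hfZ i hi) (hfa i hi hpos)⟩
  obtain ⟨hn1, hn2, hn3⟩ := hnext (m + 1) (by omega) (by omega)
  have hstep : G.Adj (f m) (f (m + 1)) := (hf.adj _ _ (by omega) (by omega)).2 (Or.inl rfl)
  have hfar : ∀ i < m, ¬ G.Adj (f i) (f (m + 1)) := fun i hi h => by
    have := (hf.adj _ _ (by omega) (by omega)).1 h; omega
  by_cases h3 : ∃ t₂ ∈ T, t₂ ≠ t₁ ∧ G.Adj (f (m + 1)) t₂
  · obtain ⟨t₂, ht₂, hne, hmt2⟩ := h3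
    refine key (f (m + 1)) t₂ hstep (hfan _ (by omega) (by omega)) (hT ht₁ ht₂ hne.symm) hmt2 hn1
      (hxT _ ht₂) hn2 (hs1T _ ht₂) hn3 (hs2T _ ht₂) hfar ?_
    intro i hi h
    rcases hi.eq_or_lt with rfl | hi
    · exact h2 t₂ ht₂ hne h
    · exact hmin i hi _ ht₂ h
  push Not at h3
  have hmk2 : m + 2 ≤ k := by
    by_contra hcon
    obtain ⟨t, ht, hne⟩ := hother
    refine h3 t ht hne ?_
    rw [show m + 1 = k by omega, hk]
    exact (hb'T t ht).symm
  obtain ⟨hn4, hn5, hn6⟩ := hnext (m + 2) (by omega) (by omega)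
  refine key (f (m + 1)) (f (m + 2)) hstep (hfan _ (by omega) (by omega))
    (hfan _ (by omega) (by omega)) ((hf.adj _ _ (by omega) (by omega)).2 (Or.inl rfl)) hn1 hn4 hn2
    hn5 hn3 hn6 hfar ?_
  intro i hi h
  have := (hf.adj _ _ (by omega) (by omega)).1 h
  omega

/-- `S` is the front of the sweep, `C` the region ahead of it with `T` at its far end, and `b` a
vertex beyond `T`. The vertex `x` lies behind the front and `S₀`, of size at least two, is the set
of its neighbors there. The front moves past a vertex `a` of `C` that is complete to `S`. If `a` is
in `T`, triangles at `a` yield `F₁` or `F₂`; if the front shrinks to `a` alone, some `H i` appears;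
otherwise the region has become smaller. -/
theorem hasObstruction_of_sweep (hG : IsChordal G) [Finite V] {T : Set V} {b t₀ t₀' : V}
    (ht₀ : t₀ ∈ T) (ht₀' : t₀' ∈ T) (htt : t₀ ≠ t₀') (hT : G.IsClique T)
    (hb : ∀ t ∈ T, G.Adj b t) (m : ℕ) :
    ∀ (x : V) (S₀ S C : Set V), C.ncard = m → T ⊆ C → EdgeConn G C → S₀ ⊆ S →
      (∃ s ∈ S₀, ∃ s' ∈ S₀, s ≠ s') → G.IsClique S → (∀ s ∈ S, s ∉ C) →
      (∀ s ∈ S, ∃ c ∈ C, G.Adj s c) → (∀ s ∈ S₀, G.Adj x s) → (∀ s ∈ S, s ∉ S₀ → ¬ G.Adj x s) →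
      (∀ c ∈ C, ¬ G.Adj x c) → ¬ G.Adj x b → EdgeConn G (C \ T ∪ S) →
      (∀ t ∈ T, ∃ z ∈ C \ T ∪ S, G.Adj t z) → (∀ z ∈ C \ T ∪ S, ¬ G.Adj b z) →
      HasObstruction G := by
  classical
  induction m using Nat.strong_induction_on with
  | _ m ih =>
    intro x S₀ S C hm hTC hC hS₀S hS₀ hS hSC hSnb hxS₀ hxS hxC hxb hZS hTnb hbZ
    obtain ⟨a, haC, haS⟩ := hG.exists_complete hS hC ⟨t₀, hTC ht₀⟩ hSC hSnb
    obtain ⟨s₁, hs₁, s₂, hs₂, hs12⟩ := hS₀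
    have hother : ∀ s ∈ S₀, ∃ s' ∈ S₀, s' ≠ s := by
      intro s _
      by_cases h : s₁ = s
      · exact ⟨s₂, hs₂, fun h' => hs12 (h.trans h'.symm)⟩
      · exact ⟨s₁, hs₁, h⟩
    -- If `a ∈ T`, it suffices to find `v ∈ C` adjacent to `a` and to the front. If `v` has a
    -- neighbor in `S₀`, then `strip` applies, given a common neighbor `u` of `a` and `v` that is
    -- not adjacent to `x` or the front. If all its neighbors in the front are outside `S₀`, then
    -- `clique` applies.
    by_cases haT : a ∈ T
    · have : ∃ t ∈ T, t ≠ a := by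
        by_cases h : t₀ = a
        · exact ⟨t₀', ht₀', fun h' => htt (h.trans h'.symm)⟩
        · exact ⟨t₀, ht₀, h⟩
      obtain ⟨t, ht, hta⟩ := this
      have hadj : G.Adj t a := hT ht haT hta
      have strip : ∀ s ∈ S₀, ∀ v ∈ C, ∀ u : V, G.Adj v a → G.Adj v s → G.Adj u a → G.Adj u v →
          ¬ G.Adj x u → (∀ s' ∈ S, ¬ G.Adj u s') → HasObstruction G := by
        intro s hs v hv u h1 h2 h3 h4 h5 h6
        obtain ⟨s', hs', hne⟩ := hother s hs
        exact hasObstruction_of_strip (hxS₀ s hs) (hxS₀ s' hs') (hS (hS₀S hs) (hS₀S hs') hne.symm)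
          (haS s (hS₀S hs)).symm (haS s' (hS₀S hs')).symm h1 h2 h3 h4 (hxC a haC) (hxC v hv) h5
          (h6 _ (hS₀S hs)) (h6 _ (hS₀S hs'))
      have clique : ∀ s ∈ S, s ∉ S₀ → ∀ v ∈ C, G.Adj v a → G.Adj v s →
          (∀ s' ∈ S₀, ¬ G.Adj v s') → HasObstruction G := by
        intro s hs hsn v hv h1 h2 h3
        refine Or.inr (Or.inl (F₂_isIndContained (v₀ := s₁) (v₁ := s₂) (v₂ := s) (v₃ := a)
          (v₄ := x) (v₅ := v) (hS (hS₀S hs₁) (hS₀S hs₂) hs12)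
          (hS (hS₀S hs₁) hs (fun h => hsn (h ▸ hs₁))) (haS _ (hS₀S hs₁))
          (hS (hS₀S hs₂) hs (fun h => hsn (h ▸ hs₂))) (haS _ (hS₀S hs₂)) (haS _ hs)
          (hxS₀ _ hs₁).symm (hxS₀ _ hs₂).symm h2.symm h1.symm (fun h => hxS s hs hsn h.symm)
          (fun h => hxC a haC h.symm) (fun h => h3 _ hs₁ h.symm) (fun h => h3 _ hs₂ h.symm)
          (hxC v hv)))
      by_cases h1 : ∃ s ∈ S₀, G.Adj t s
      · obtain ⟨s, hs, hts⟩ := h1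
        exact strip s hs t (hTC ht) b hadj hts (hb a haT) (hb t ht) hxb
          (fun s' hs' => hbZ _ (Or.inr hs'))
      push Not at h1
      by_cases h2 : ∃ s ∈ S, s ∉ S₀ ∧ G.Adj t s
      · obtain ⟨s, hs, hsn, hts⟩ := h2
        exact clique s hs hsn t (hTC ht) hadj hts h1
      push Not at h2
      have htS : ∀ s ∈ S, ¬ G.Adj t s := fun s hs h => by
        by_cases hsn : s ∈ S₀
        · exact h1 s hsn h
        · exact h2 s hs hsn h
      -- Here `t` has no neighbor in the front. By `fan`, `a` is adjacent to all of an induced path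
      -- from `t` to the front that avoids the rest of `T`. Its first vertex with a neighbor in `S`
      -- serves as `v`, the vertex before that as `u`.
      obtain ⟨z, hz, htz⟩ := hTnb t ht
      obtain ⟨k, f, hf, h0, hk, hfX⟩ := (hZS.insert hz htz).exists_indPath (Set.mem_insert _ _)
        (Set.mem_insert_of_mem _ (Or.inr (hS₀S hs₁)))
      have hk0 : 0 < k := by
        rcases Nat.eq_zero_or_pos k with rfl | h
        · exact absurd (hTC ht) (by rw [← h0, hk]; exact hSC _ (hS₀S hs₁))
        · exact h
      have hfan : ∀ i ≤ k, G.Adj a (f i) := by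
        refine hG.fan k f hf ?_ (h0 ▸ hadj.symm) (hk ▸ (haS _ (hS₀S hs₁)).symm)
        intro i hi he
        rcases hfX i hi with h | h | h
        · exact hta (h.symm.trans he.symm)
        · exact h.2 (he ▸ haT)
        · exact hSC _ h (he ▸ haC)
      have hex : ∃ i, i < k ∧ ∃ s ∈ S, G.Adj (f i) s :=
        ⟨k - 1, by omega, s₁, hS₀S hs₁, by
          rw [← hk]; exact (hf.adj _ _ (by omega) (by omega)).2 (by omega)⟩
      obtain ⟨hqk, s, hs, hqs⟩ := Nat.find_spec hex
      have hmin : ∀ i < Nat.find hex, ∀ s ∈ S, ¬ G.Adj (f i) s := fun i hi s hs h =>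
        Nat.find_min hex hi ⟨by omega, s, hs, h⟩
      set q := Nat.find hex
      have hq0 : 0 < q := by
        rcases Nat.eq_zero_or_pos q with h | h
        · exact absurd (by rw [h, h0] at hqs; exact hqs) (htS s hs)
        · exact h
      have huv : G.Adj (f (q - 1)) (f q) := (hf.adj _ _ (by omega) (by omega)).2 (by omega)
      have hqC : f q ∈ C := by
        rcases hfX q (by omega) with h | h | h
        · exact h ▸ hTC ht
        · exact h.1
        · exact absurd huv (hmin (q - 1) (by omega) _ h)
      have huC : f (q - 1) ∈ C := by
        rcases hfX (q - 1) (by omega) with h | h | h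
        · exact h ▸ hTC ht
        · exact h.1
        · exfalso
          by_cases h3 : s₁ = f (q - 1)
          · exact hmin (q - 1) (by omega) s₂ (hS₀S hs₂) (hS h (hS₀S hs₂) (h3 ▸ hs12))
          · exact hmin (q - 1) (by omega) s₁ (hS₀S hs₁) (hS h (hS₀S hs₁) (Ne.symm h3))
      by_cases h3 : ∃ s ∈ S₀, G.Adj (f q) s
      · obtain ⟨s', hs', hqs'⟩ := h3
        exact strip s' hs' (f q) hqC (f (q - 1)) (hfan q (by omega)).symm hqs'
          (hfan (q - 1) (by omega)).symm huv (hxC _ huC) (hmin (q - 1) (by omega))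
      · push Not at h3
        exact clique s hs (fun h => h3 s h hqs) (f q) hqC (hfan q (by omega)).symm hqs h3
    · have hTa : T ⊆ C \ {a} := fun t ht => ⟨hTC ht, fun h => haT (h ▸ ht)⟩
      -- The sweep passes `a`: the new region is the part of `C \ {a}` around `T`, and the new front
      -- consists of the vertices of `S` and `a` that still touch it.
      set C₁ := comp G (C \ {a}) t₀ with hC₁def
      have hC₁ : C₁ ⊆ C \ {a} := comp_subset (hTa ht₀)
      have hTC₁ : T ⊆ C₁ := by
        intro t ht
        by_cases h : t₀ = t
        · exact h ▸ mem_comp_self _ _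
        · exact comp_closed (mem_comp_self _ _) (hT ht₀ ht h) (hTa ht)
      have haC₁ : a ∉ C₁ := fun h => (hC₁ h).2 rfl
      set S₁ : Set V := {s | s ∈ insert a S ∧ ∃ c ∈ C₁, G.Adj s c} with hS₁def
      have haS₁ : a ∈ S₁ := by
        obtain ⟨y, hy, z, hz, hyz⟩ := hC C₁ (fun c hc => (hC₁ hc).1) ⟨t₀, hTC₁ ht₀⟩ ⟨a, haC, haC₁⟩
        by_cases hza : z = a
        · exact ⟨Set.mem_insert _ _, y, hy, hza ▸ hyz.symm⟩
        · exact absurd (comp_closed hy hyz ⟨hz.1, hza⟩) hz.2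
      have hS' : G.IsClique (insert a S) :=
        hS.insert fun s hs _ => (haS s hs).symm
      have hS₁ : G.IsClique S₁ := hS'.subset fun s hs => hs.1
      have hZS₁sub : C₁ \ T ∪ S₁ ⊆ C \ T ∪ S := by
        rintro z (hz | ⟨rfl | hz, _⟩)
        · exact Or.inl ⟨(hC₁ hz.1).1, hz.2⟩
        · exact Or.inl ⟨haC, haT⟩
        · exact Or.inr hz
      have hback : ∀ y ∈ C₁, ∀ z ∈ C \ T ∪ S, G.Adj y z → z ∈ C₁ \ T ∪ S₁ := by
        intro y hy z hz hyz
        rcases hz with hz | hz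
        · by_cases hza : z = a
          · exact Or.inr (hza ▸ haS₁)
          · exact Or.inl ⟨comp_closed hy hyz ⟨hz.1, hza⟩, hz.2⟩
        · exact Or.inr ⟨Set.mem_insert_of_mem _ hz, y, hy, hyz.symm⟩
      have hZS₁ : EdgeConn G (C₁ \ T ∪ S₁) := by
        refine edgeConn_of_avoiding a ?_
        intro Y hY haY hYne
        by_cases h : ∃ s ∈ Y, s ∈ S₁
        · obtain ⟨s, hsY, hs⟩ := h
          exact ⟨s, hsY, a, ⟨Or.inr haS₁, haY⟩, hS₁ hs haS₁ (fun h => haY (h ▸ hsY))⟩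
        · push Not at h
          obtain ⟨y, hy, z, hz, hyz⟩ := hZS Y (hY.trans hZS₁sub) hYne ⟨a, Or.inl ⟨haC, haT⟩, haY⟩
          refine ⟨y, hy, z, ⟨hback y ?_ z hz.1 hyz, hz.2⟩, hyz⟩
          rcases hY hy with h1 | h1
          · exact h1.1
          · exact absurd h1 (h y hy)
      have hTnb₁ : ∀ t ∈ T, ∃ z ∈ C₁ \ T ∪ S₁, G.Adj t z := by
        intro t ht
        obtain ⟨z, hz, htz⟩ := hTnb t ht
        exact ⟨z, hback t (hTC₁ ht) z hz htz, htz⟩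
      have hbZ₁ : ∀ z ∈ C₁ \ T ∪ S₁, ¬ G.Adj b z := fun z hz => hbZ z (hZS₁sub hz)
      have hlt : C₁.ncard < m := by
        rw [← hm]
        exact Set.ncard_lt_ncard (t := C) (Set.ssubset_iff_subset_ne.2
          ⟨fun c hc => (hC₁ hc).1, fun h => haC₁ (h.symm ▸ haC)⟩) (Set.toFinite C)
      have hSC₁ : ∀ s ∈ S₁, s ∉ C₁ := by
        rintro s ⟨rfl | hs, _⟩ h
        · exact haC₁ h
        · exact hSC s hs (hC₁ h).1
      by_cases hone : ∃ s ∈ S₁, s ≠ a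
      · by_cases hsub : S₀ ⊆ S₁
        · refine ih _ hlt x S₀ S₁ C₁ rfl hTC₁ (edgeConn_comp _ _) hsub ⟨s₁, hs₁, s₂, hs₂, hs12⟩ hS₁
            hSC₁ (fun s hs => hs.2) hxS₀ ?_ (fun c hc => hxC c (hC₁ hc).1) hxb hZS₁ hTnb₁ hbZ₁
          rintro s ⟨rfl | hs, _⟩ hsn
          · exact hxC _ haC
          · exact hxS s hs hsn
        · obtain ⟨x₁, hx₁, hx₁n⟩ := Set.not_subset.1 hsub
          obtain ⟨s', hs', hs'a⟩ := hone
          refine ih _ hlt x₁ S₁ S₁ C₁ rfl hTC₁ (edgeConn_comp _ _) subset_rfl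
            ⟨a, haS₁, s', hs', hs'a.symm⟩ hS₁ hSC₁ (fun s hs => hs.2) ?_
            (fun s hs hsn => absurd hs hsn) ?_ (fun h => hbZ _ (Or.inr (hS₀S hx₁)) h.symm) hZS₁
            hTnb₁ hbZ₁
          · intro s hs
            exact hS' (Set.mem_insert_of_mem _ (hS₀S hx₁)) hs.1 (fun h => hx₁n (h ▸ hs))
          · intro c hc h
            exact hx₁n ⟨Set.mem_insert_of_mem _ (hS₀S hx₁), c, hc, h⟩
      · push Not at hone
        have hSC₁' : ∀ s ∈ S, ∀ c ∈ C₁, ¬ G.Adj s c := by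
          intro s hs c hc h
          have := hone s ⟨Set.mem_insert_of_mem _ hs, c, hc, h⟩
          exact hSC s hs (this ▸ haC)
        have hTZ : ∀ t ∈ T, t ∉ C \ T ∪ S := by
          rintro t ht (h | h)
          · exact h.2 ht
          · exact hSC t h (hTC ht)
        -- The front has shrunk to `a`. On this side of `T` there is a vertex complete to `T`, to
        -- which the path of an `H i` can be directed.
        obtain ⟨b', hb', hb'T⟩ := hG.exists_complete hT hZS ⟨a, Or.inl ⟨haC, haT⟩⟩ hTZ hTnb
        have hsZ : ∀ s ∈ S, ∀ z ∈ C₁ \ T ∪ S₁, z ≠ a → ¬ G.Adj s z := by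
          rintro s hs z (hz | hz) hza
          · exact hSC₁' s hs z hz.1
          · exact absurd (hone z hz) hza
        refine hasObstruction_of_cutvertex hG ht₀ ht₀' htt hT hb (fun t ht h => hTZ t ht (hZS₁sub h))
          hZS₁ (Or.inr haS₁) (hback t₀ (hTC₁ ht₀) b' hb' (hb'T t₀ ht₀)) hb'T hbZ₁ ?_
          (fun t ht => hxC t (hTC ht)) hxb (hsZ s₁ (hS₀S hs₁)) (hsZ s₂ (hS₀S hs₂))
          (fun t ht => hSC₁' s₁ (hS₀S hs₁) t (hTC₁ ht)) (fun t ht => hSC₁' s₂ (hS₀S hs₂) t (hTC₁ ht))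
          (fun h => hbZ _ (Or.inr (hS₀S hs₁)) h.symm) (fun h => hbZ _ (Or.inr (hS₀S hs₂)) h.symm)
          (hxS₀ _ hs₁) (hxS₀ _ hs₂) (hS (hS₀S hs₁) (hS₀S hs₂) hs12) (haS _ (hS₀S hs₁))
          (haS _ (hS₀S hs₂))
        rintro z (hz | hz)
        · exact hxC z (hC₁ hz.1).1
        · rw [hone z hz]; exact hxC a haC

end Sweep

/-! ### Cuts, connected dominating sets, and minimal cuts of chordal graphs -/

section Cuts

variable {V : Type*} {G : SimpleGraph V}

/-- `C` meets every connected set that spans `G`: deleting `C` leaves a disconnected or empty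
graph. -/
def IsCut (G : SimpleGraph V) (C : Set V) : Prop := ¬ (G.induce Cᶜ).Connected

theorem connected_induce_iff {X : Set V} :
    (G.induce X).Connected ↔ X.Nonempty ∧ EdgeConn G X := by
  rw [SimpleGraph.connected_iff, edgeConn_iff_preconnected, and_comm, Set.nonempty_coe_sort]

theorem isCut_iff {C : Set V} : IsCut G C ↔ (Cᶜ.Nonempty → ¬ EdgeConn G Cᶜ) := by
  rw [IsCut, connected_induce_iff]; tauto

theorem isCut_of_closed {C D : Set V} (hD : D ⊆ Cᶜ) (hne : D.Nonempty) (hne' : (Cᶜ \ D).Nonempty)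
    (hcl : ∀ u ∈ D, ∀ v ∈ Cᶜ, G.Adj u v → v ∈ D) : IsCut G C := by
  rw [isCut_iff]
  intro _ h
  obtain ⟨y, hy, z, hz, hyz⟩ := h D hD hne hne'
  exact hz.2 (hcl y hy z hz.1 hyz)

/-- A set is a connected dominating set if and only if it meets every cut. -/
theorem isConnectedDominating_iff {S : Set V} :
    IsConnectedDominating G S ↔ ∀ C, IsCut G C → (S ∩ C).Nonempty := by
  constructor
  · rintro ⟨hdom, hconn⟩ C hC
    by_contra hne
    obtain ⟨hne1, hS⟩ := connected_induce_iff.1 hconn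
    -- If `S` avoids `C`, then `Cᶜ` is connected: `S` is, and every other vertex is attached to it.
    have hSC : S ⊆ Cᶜ := fun s hs hsC => hne ⟨s, hs, hsC⟩
    refine isCut_iff.1 hC (hne1.mono hSC) ?_
    obtain ⟨s₀, hs₀⟩ := hne1
    have : comp G Cᶜ s₀ = Cᶜ := by
      refine subset_antisymm (comp_subset (hSC hs₀)) fun v hv => ?_
      have hSm : S ⊆ comp G Cᶜ s₀ := hS.subset_comp hs₀ hSC
      rcases hdom v with h | ⟨u, hu, hvu⟩
      · exact hSm h
      · exact comp_closed (hSm hu) hvu.symm hv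
    rw [← this]
    exact edgeConn_comp _ _
  · intro h
    -- No superset of `S` has a cut as complement, so all supersets are connected. For `insert v S`
    -- this gives a neighbor of `v` in `S`.
    have hsup : ∀ X, S ⊆ X → X.Nonempty ∧ EdgeConn G X := by
      intro X hSX
      by_contra hX
      obtain ⟨s, hs, hs'⟩ := h Xᶜ (by rw [IsCut, compl_compl, connected_induce_iff]; exact hX)
      exact hs' (hSX hs)
    refine ⟨fun v => ?_, connected_induce_iff.2 (hsup S subset_rfl)⟩
    by_contra hv
    push Not at hv
    obtain ⟨s, hs⟩ := (hsup S subset_rfl).1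
    obtain ⟨y, hy, z, hz, hyz⟩ := (hsup (insert v S) (Set.subset_insert _ _)).2 {v}
      (by simp) (by simp) ⟨s, Or.inr hs, fun h => hv.1 (h ▸ hs)⟩
    rcases hz.1 with h | h
    · exact hz.2 h
    · exact hv.2 z h (hy ▸ hyz)

theorem IsCut.exists_minimal [Finite V] {C : Set V} (hC : IsCut G C) :
    ∃ S ⊆ C, Minimal (IsCut G) S := by
  obtain ⟨S, hS, hmin⟩ := (Set.toFinite {C | IsCut G C}).exists_le_minimal hC
  exact ⟨S, hS, hmin⟩

/-- By minimality, putting `s` back makes the rest connected, and `s` is then the only vertex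
through which `D` can be left. -/
theorem minimalCut_adj_closed {S : Set V} (hS : Minimal (IsCut G) S) {D : Set V} (hD : D ⊆ Sᶜ)
    (hne : D.Nonempty) (hcl : ∀ u ∈ D, ∀ v ∈ Sᶜ, G.Adj u v → v ∈ D) {s : V} (hs : s ∈ S) :
    ∃ d ∈ D, G.Adj s d := by
  have h1 : ¬ IsCut G (S \ {s}) := fun h => by
    have h2 : S ⊆ S \ {s} := hS.2 h Set.sdiff_subset
    exact (h2 hs).2 rfl
  rw [IsCut, not_not, connected_induce_iff] at h1
  obtain ⟨y, hy, z, hz, hyz⟩ := h1.2 D (fun d hd h => hD hd h.1) hne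
    ⟨s, fun h => h.2 rfl, fun h => hD h hs⟩
  by_cases hzs : z = s
  · exact ⟨y, hy, hzs ▸ hyz.symm⟩
  · exact absurd (hcl y hy z (fun h => hz.1 ⟨h, hzs⟩) hyz) hz.2

theorem minimalCut_adj_comp {S : Set V} (hS : Minimal (IsCut G) S) {a : V} (ha : a ∈ Sᶜ) {s : V}
    (hs : s ∈ S) : ∃ d ∈ comp G Sᶜ a, G.Adj s d :=
  minimalCut_adj_closed hS (comp_subset ha) ⟨a, mem_comp_self _ _⟩
    (fun _ hu _ hv huv => comp_closed hu huv hv) hs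

theorem IsCut.exists_notMem_comp {S : Set V} (hS : IsCut G S) {a : V} (ha : a ∈ Sᶜ) :
    ∃ x ∈ Sᶜ, x ∉ comp G Sᶜ a := by
  by_contra hcon
  push Not at hcon
  have : comp G Sᶜ a = Sᶜ := subset_antisymm (comp_subset ha) hcon
  exact isCut_iff.1 hS ⟨a, ha⟩ (this ▸ edgeConn_comp _ _)

theorem comp_separated {X : Set V} {a x : V} (hx : x ∈ X) (hxa : x ∉ comp G X a)
    {u v : V} (hu : u ∈ comp G X a) (hv : v ∈ comp G X x) : u ≠ v ∧ ¬ G.Adj u v := by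
  have hdis : comp G X x ⊆ X \ comp G X a :=
    comp_subset_of_closed ⟨hx, hxa⟩ fun p hp q hq hpq =>
      ⟨hq, fun hqa => hp.2 (comp_closed hqa hpq.symm hp.1)⟩
  refine ⟨?_, fun h => (hdis hv).2 (comp_closed hu h (hdis hv).1)⟩
  rintro rfl
  exact (hdis hv).2 hu

/-- On the way from `s'` through `D` to the neighbor `d` of `s`, the component of `s'` off the
closed neighborhood of `s` has to be left, and this can only happen at a neighbor of `s`. -/
theorem exists_adj_comp_anticomplete {D : Set V} {s s' d d' : V} (hD : EdgeConn G D) (hd : d ∈ D)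
    (hsd : G.Adj s d) (hd' : d' ∈ D) (hsd' : G.Adj s' d') (hsD : s ∉ D)
    (hss' : s' ≠ s ∧ ¬ G.Adj s s') :
    ∃ p ∈ D, G.Adj s p ∧ ∃ q ∈ comp G {v | v ≠ s ∧ ¬ G.Adj s v} s', G.Adj p q := by
  set X := comp G {v | v ≠ s ∧ ¬ G.Adj s v} s' with hX
  have hXs : X ⊆ {v | v ≠ s ∧ ¬ G.Adj s v} := comp_subset hss'
  obtain ⟨y, hy, z, hz, hyz⟩ := hD.insert hd' hsd' (insert s' D ∩ X) Set.inter_subset_left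
    ⟨s', Set.mem_insert _ _, mem_comp_self _ _⟩
    ⟨d, Set.mem_insert_of_mem _ hd, fun h => (hXs h.2).2 hsd⟩
  have hzX : z ∉ X := fun h => hz.2 ⟨hz.1, h⟩
  rcases hz.1 with rfl | hzD
  · exact absurd (mem_comp_self _ _) hzX
  · refine ⟨z, hzD, ?_, y, hy.2, hyz.symm⟩
    by_contra hsz
    exact hzX (comp_closed hy.2 hyz ⟨fun h => hsD (h ▸ hzD), hsz⟩)

/-- If `s` and `s'` were not adjacent, two different components off `S` would each contain a
neighbor of `s` that is adjacent to the component of `s'` off the closed neighborhood of `s`. By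
`adj_of_adj_edgeConn` these two neighbors would be adjacent. -/
theorem IsChordal.minimalCut_isClique (hG : IsChordal G) {S : Set V} (hS : Minimal (IsCut G) S)
    {a : V} (ha : a ∈ Sᶜ) : G.IsClique S := by
  intro s hs s' hs' hne
  by_contra hadj
  obtain ⟨x, hx, hxa⟩ := hS.1.exists_notMem_comp ha
  have key : ∀ b ∈ Sᶜ, ∃ p ∈ comp G Sᶜ b, G.Adj s p ∧
      ∃ q ∈ comp G {v | v ≠ s ∧ ¬ G.Adj s v} s', G.Adj p q := by
    intro b hb
    obtain ⟨d, hd, hsd⟩ := minimalCut_adj_comp hS hb hs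
    obtain ⟨d', hd', hsd'⟩ := minimalCut_adj_comp hS hb hs'
    exact exists_adj_comp_anticomplete (edgeConn_comp _ _) hd hsd hd' hsd'
      (fun h => comp_subset hb h hs) ⟨hne.symm, hadj⟩
  obtain ⟨p, hp, hsp, q, hq, hpq⟩ := key a ha
  obtain ⟨p', hp', hsp', q', hq', hpq'⟩ := key x hx
  have hX : comp G {v | v ≠ s ∧ ¬ G.Adj s v} s' ⊆ {v | v ≠ s ∧ ¬ G.Adj s v} :=
    comp_subset ⟨hne.symm, hadj⟩
  obtain ⟨h1, h2⟩ := comp_separated hx hxa hp hp'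
  exact h2 (hG.adj_of_adj_edgeConn (edgeConn_comp _ _) (fun h => (hX h).1 rfl)
    (fun v hv => (hX hv).2) hsp hsp' h1 hq hq' hpq hpq')

/-- This is the region of the sweep: what lies on the `T` side of `S` and on the `S` side of `T`,
together with `T \ S`. A part of `M ∩ N` is left along an edge inside `M`, whose end is in `N`
unless it is in `T`. -/
theorem edgeConn_between {S T M N : Set V} {a c : V} (hTcl : G.IsClique T)
    (hM : M = comp G Sᶜ a) (hN : N = comp G Tᶜ c) (ha : a ∈ T \ S) (hTM : T \ S ⊆ M) :
    EdgeConn G (M ∩ N ∪ T \ S) := by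
  have hMS : M ⊆ Sᶜ := hM ▸ comp_subset ha.2
  refine edgeConn_of_avoiding a fun Y hY haY hne => ?_
  by_cases h : ∃ t ∈ Y, t ∈ T
  · obtain ⟨t, htY, ht⟩ := h
    exact ⟨t, htY, a, ⟨Or.inr ha, haY⟩, hTcl ht ha.1 (fun h => haY (h ▸ htY))⟩
  · push Not at h
    have hYMN : ∀ y ∈ Y, y ∈ M ∩ N := fun y hy =>
      (hY hy).resolve_right fun h1 => h y hy h1.1
    have hMc : EdgeConn G M := hM ▸ edgeConn_comp _ _
    obtain ⟨y, hy, z, hz, hyz⟩ := hMc Y (fun y hy => (hYMN y hy).1) hne ⟨a, hTM ha, haY⟩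
    refine ⟨y, hy, z, ⟨?_, hz.2⟩, hyz⟩
    by_cases hzT : z ∈ T
    · exact Or.inr ⟨hzT, hMS hz.1⟩
    · refine Or.inl ⟨hz.1, ?_⟩
      have hyN := (hYMN y hy).2
      rw [hN] at hyN ⊢
      exact comp_closed hyN hyz hzT

theorem exists_adj_between {S T M N : Set V} {a c : V} (hS : Minimal (IsCut G) S)
    (hM : M = comp G Sᶜ a) (hN : N = comp G Tᶜ c) (ha : a ∈ Sᶜ) (hSN : S \ T ⊆ N) :
    ∀ s ∈ S \ T, ∃ z ∈ M ∩ N ∪ T \ S, G.Adj s z := by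
  intro s hs
  obtain ⟨d, hd, hsd⟩ := minimalCut_adj_comp hS ha hs.1
  refine ⟨d, ?_, hsd⟩
  by_cases hdT : d ∈ T
  · exact Or.inr ⟨hdT, comp_subset ha hd⟩
  · have hsN := hSN hs
    refine Or.inl ⟨hM ▸ hd, ?_⟩
    rw [hN] at hsN ⊢
    exact comp_closed hsN hsd hdT

/-- Any component other than that of `a` will do: each vertex of the clique `S` has a neighbor in
it, so `exists_complete` applies. -/
theorem IsChordal.exists_complete_outside [Finite V] (hG : IsChordal G) {S : Set V}
    (hS : Minimal (IsCut G) S) {a : V} (ha : a ∈ Sᶜ) :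
    ∃ x ∈ Sᶜ, x ∉ comp G Sᶜ a ∧ ∀ s ∈ S, G.Adj s x := by
  obtain ⟨y, hy, hya⟩ := hS.1.exists_notMem_comp ha
  obtain ⟨x, hx, hxS⟩ := hG.exists_complete (hG.minimalCut_isClique hS ha) (edgeConn_comp Sᶜ y)
    ⟨y, mem_comp_self _ _⟩ (fun s hs h => comp_subset hy h hs)
    (fun s hs => minimalCut_adj_comp hS hy hs)
  exact ⟨x, comp_subset hy hx, fun h => (comp_separated hy hya h hx).1 rfl, hxS⟩

/-- Of two minimal cuts, one has at most one vertex outside the other. -/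
theorem IsChordal.minimalCut_subsingleton_sdiff [Finite V] (hG : IsChordal G)
    (hfree : ¬ HasObstruction G) {S T : Set V} (hS : Minimal (IsCut G) S)
    (hT : Minimal (IsCut G) T) : (S \ T).Subsingleton ∨ (T \ S).Subsingleton := by
  by_contra hcon
  rw [not_or, Set.not_subsingleton_iff, Set.not_subsingleton_iff] at hcon
  obtain ⟨⟨c, hc, c', hc', hcc⟩, ⟨a, ha, a', ha', haa⟩⟩ := hcon
  have hScl := hG.minimalCut_isClique hS ha.2
  have hTcl := hG.minimalCut_isClique hT hc.2
  set M := comp G Sᶜ a with hM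
  set N := comp G Tᶜ c with hN
  have hTM : T \ S ⊆ M := by
    intro t ht
    by_cases h : a = t
    · exact h ▸ mem_comp_self _ _
    · exact comp_closed (mem_comp_self _ _) (hTcl ha.1 ht.1 h) ht.2
  have hSN : S \ T ⊆ N := by
    intro s hs
    by_cases h : c = s
    · exact h ▸ mem_comp_self _ _
    · exact comp_closed (mem_comp_self _ _) (hScl hc.1 hs.1 h) hs.2
  have hMS : M ⊆ Sᶜ := comp_subset ha.2
  have hNT : N ⊆ Tᶜ := comp_subset hc.2
  obtain ⟨x, hxS, hxM, hx⟩ := hG.exists_complete_outside hS ha.2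
  obtain ⟨b, hbT, hbN, hb⟩ := hG.exists_complete_outside hT hc.2
  have hxanti : ∀ m ∈ M, ¬ G.Adj x m := fun m hm h => hxM (comp_closed hm h.symm hxS)
  have hbanti : ∀ n ∈ N, ¬ G.Adj b n := fun n hn h => hbN (comp_closed hn h.symm hbT)
  -- Replacing the target by the front turns the region into the one with `S` and `T` interchanged,
  -- so the same two lemmas serve both sides.
  have hCT : (M ∩ N ∪ T \ S) \ (T \ S) ∪ S \ T = N ∩ M ∪ S \ T := by
    ext v
    constructor
    · rintro (⟨h | h, h'⟩ | h)
      · exact Or.inl h.symm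
      · exact absurd h h'
      · exact Or.inr h
    · rintro (h | h)
      · exact Or.inl ⟨Or.inl h.symm, fun h' => hNT h.1 h'.1⟩
      · exact Or.inr h
  have hCM : M ∩ N ∪ T \ S ⊆ M := Set.union_subset Set.inter_subset_left hTM
  have hxN : x ∈ N := by
    refine comp_closed (hSN hc) (hx c hc.1) fun hxT => hxM (hTM ⟨hxT, hxS⟩)
  refine hfree (hasObstruction_of_sweep hG (T := T \ S) (b := b) ha ha' haa
    (hTcl.subset Set.sdiff_subset) (fun t ht => (hb t ht.1).symm) _ x (S \ T) (S \ T)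
    (M ∩ N ∪ T \ S) rfl Set.subset_union_right (edgeConn_between hTcl hM hN ha hTM) subset_rfl
    ⟨c, hc, c', hc', hcc⟩ (hScl.subset Set.sdiff_subset) (fun s hs h => hMS (hCM h) hs.1)
    (exists_adj_between hS hM hN ha.2 hSN) (fun s hs => (hx s hs.1).symm)
    (fun s hs hs' => absurd hs hs') (fun v hv => hxanti v (hCM hv))
    (fun h => hbanti x hxN h.symm) (hCT ▸ edgeConn_between hScl hN hM hc hSN)
    (hCT ▸ exists_adj_between hT hN hM hc.2 hTM) ?_)
  rw [hCT]
  rintro z (hz | hz)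
  · exact hbanti z hz.1
  · exact hbanti z (hSN hz)

/-- The neighbors of `v` that are adjacent to the component of `r` in the graph without `v` and its
neighbors; all vertices if `v` is `r` or a neighbor of `r`. -/
def sepSet (G : SimpleGraph V) (r v : V) : Set V :=
  {w | v ≠ r → ¬ G.Adj v r →
    G.Adj v w ∧ ∃ u ∈ comp G {x | x ≠ v ∧ ¬ G.Adj v x} r, G.Adj u w}

theorem isCut_univ : IsCut G Set.univ := by
  rw [isCut_iff, Set.compl_univ]
  exact fun h => absurd h Set.not_nonempty_empty

/-- In the main case, the component of `r` off the closed neighborhood of `v` can be left only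
through neighbors of `v` adjacent to it. These are the deleted vertices, and `v` remains outside the
component. -/
theorem isCut_sepSet (r v : V) : IsCut G (sepSet G r v) := by
  by_cases h : v ≠ r ∧ ¬ G.Adj v r
  · have hD : comp G {x | x ≠ v ∧ ¬ G.Adj v x} r ⊆ {x | x ≠ v ∧ ¬ G.Adj v x} :=
      comp_subset ⟨h.1.symm, h.2⟩
    refine isCut_of_closed (D := comp G {x | x ≠ v ∧ ¬ G.Adj v x} r) ?_ ⟨r, mem_comp_self _ _⟩
      ⟨v, fun hv => absurd rfl (hv h.1 h.2).1.ne, fun hv => (hD hv).1 rfl⟩ ?_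
    · intro u hu hu'
      exact (hD hu).2 (hu' h.1 h.2).1
    · intro u hu w hw huw
      refine comp_closed hu huw ⟨?_, fun hvw => hw fun _ _ => ⟨hvw, u, hu, huw⟩⟩
      rintro rfl
      exact (hD hu).2 huw.symm
  · have : sepSet G r v = Set.univ :=
      Set.eq_univ_of_forall fun w h1 h2 => absurd ⟨h1, h2⟩ h
    rw [this]
    exact isCut_univ

/-- If `r ∉ S`, take `v` complete to `S` in a component other than that of `r`. Deleting the closed
neighborhood of `v` leaves the same component of `r` as deleting `S`, and `S` is the boundary of
that component. If `r ∈ S` and `S` is not everything, then `r` has neighbors in two components off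
`S`, which contradicts simpliciality; so `S` is everything, like `sepSet G r r`. -/
theorem IsChordal.exists_sepSet_eq [Finite V] (hG : IsChordal G) {r : V}
    (hr : G.IsClique {w | G.Adj r w}) {S : Set V} (hS : Minimal (IsCut G) S) :
    ∃ v, sepSet G r v = S := by
  by_cases hrS : r ∈ S
  · refine ⟨r, ?_⟩
    have h1 : sepSet G r r = Set.univ := Set.eq_univ_of_forall fun w h => absurd rfl h
    rw [h1]
    by_contra hne
    obtain ⟨a, ha⟩ := Set.nonempty_compl.2 (Ne.symm hne)
    obtain ⟨x, hx, hxa⟩ := hS.1.exists_notMem_comp ha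
    obtain ⟨d, hd, hrd⟩ := minimalCut_adj_comp hS ha hrS
    obtain ⟨d', hd', hrd'⟩ := minimalCut_adj_comp hS hx hrS
    obtain ⟨h2, h3⟩ := comp_separated hx hxa hd hd'
    exact h3 (hr hrd hrd' h2)
  · obtain ⟨v, hvS, hvr, hv⟩ := hG.exists_complete_outside hS hrS
    have hvanti : ∀ d ∈ comp G Sᶜ r, ¬ G.Adj v d := fun d hd h =>
      hvr (comp_closed hd h.symm hvS)
    have hne : v ≠ r := fun h => hvr (h ▸ mem_comp_self _ _)
    have hcomp : comp G {x | x ≠ v ∧ ¬ G.Adj v x} r = comp G Sᶜ r := by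
      apply subset_antisymm
      · refine (edgeConn_comp _ _).subset_comp (mem_comp_self _ _) ?_
        refine (comp_subset (X := {x | x ≠ v ∧ ¬ G.Adj v x}) ⟨hne.symm,
          hvanti r (mem_comp_self _ _)⟩).trans ?_
        exact fun x hx hxS => hx.2 (hv x hxS).symm
      · refine (edgeConn_comp _ _).subset_comp (mem_comp_self _ _) ?_
        exact fun d hd => (⟨fun h => hvr (h ▸ hd), hvanti d hd⟩ : d ≠ v ∧ ¬ G.Adj v d)
    refine ⟨v, ?_⟩
    ext w
    simp only [sepSet, hcomp, Set.mem_ofPred_eq]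
    constructor
    · intro h
      obtain ⟨h1, u, hu, huw⟩ := h hne (hvanti r (mem_comp_self _ _))
      by_contra hwS
      exact hvanti w (comp_closed hu huw hwS) h1
    · intro hw _ _
      obtain ⟨d, hd, hwd⟩ := minimalCut_adj_comp hS hrS hw
      exact ⟨(hv w hw).symm, d, hd, hwd.symm⟩

end Cuts

/-! ### One-Sperner families are threshold -/

section Threshold

variable {V : Type*}

/-- `T` meets every member of `E`. -/
def Hits (E : Finset (Finset V)) (T : Finset V) : Prop := ∀ A ∈ E, ∃ v ∈ A, v ∈ T

/-- The sets meeting every member of `E` are separated from the others by positive weights. -/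
def IsThreshold (E : Finset (Finset V)) : Prop :=
  ∃ (w : V → ℝ) (t : ℝ), (∀ v, 0 < w v) ∧ 0 ≤ t ∧ ∀ T : Finset V, t ≤ ∑ v ∈ T, w v ↔ Hits E T

/-- No member contains another one, and the smallest of the two differences of distinct members has
one element. -/
def IsOneSperner [DecidableEq V] (E : Finset (Finset V)) : Prop :=
  ∀ A ∈ E, ∀ B ∈ E, A ≠ B → ¬ A ⊆ B ∧ ((A \ B).card ≤ 1 ∨ (B \ A).card ≤ 1)

theorem exists_pos_le {ι : Type*} [Finite ι] (f : ι → ℝ) (hf : ∀ i, 0 < f i) :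
    ∃ δ > 0, ∀ i, δ ≤ f i := by
  rcases isEmpty_or_nonempty ι with h | h
  · exact ⟨1, one_pos, fun i => h.elim i⟩
  · obtain ⟨i, hi⟩ := Finite.exists_min f
    exact ⟨f i, hf i, hi⟩

theorem card_sdiff_le_one_of_card_le [DecidableEq V] {A B : Finset V}
    (h : (A \ B).card ≤ 1 ∨ (B \ A).card ≤ 1) (hc : A.card ≤ B.card) : (A \ B).card ≤ 1 := by
  have h1 := Finset.card_sdiff_add_card_inter A B
  have h2 := Finset.card_sdiff_add_card_inter B A
  rw [Finset.inter_comm] at h2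
  omega

theorem mem_of_card_sdiff_le_one [DecidableEq V] {A B : Finset V} (h : (A \ B).card ≤ 1) {u v : V}
    (hu : u ∈ A) (huB : u ∉ B) (hv : v ∈ A) (hne : v ≠ u) : v ∈ B := by
  by_contra hvB
  exact hne (Finset.card_le_one.1 h v (Finset.mem_sdiff.2 ⟨hv, hvB⟩) u
    (Finset.mem_sdiff.2 ⟨hu, huB⟩))

/-- In a one-Sperner family some vertex `z` is such that each member with `z` is, apart from `z`,
contained in each member without `z`. -/
theorem IsOneSperner.exists_split [DecidableEq V] {E : Finset (Finset V)} (hE : IsOneSperner E)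
    (hne : ∃ A ∈ E, A.Nonempty) : ∃ z, (∃ A ∈ E, z ∈ A) ∧
      ∀ A ∈ E, z ∈ A → ∀ B ∈ E, z ∉ B → ∀ v ∈ A, v ≠ z → v ∈ B := by
  obtain ⟨A₀, hA₀, hA₀ne⟩ := hne
  -- The vertex `z` is taken from a smallest member `B`, outside a largest `A` of the other members.
  obtain ⟨B, hB, hBmin⟩ := Finset.exists_min_image E Finset.card ⟨A₀, hA₀⟩
  by_cases hone : ∃ A ∈ E, A ≠ B
  · obtain ⟨A₁, hA₁, hA₁B⟩ := hone
    obtain ⟨A, hA, hAmax⟩ := Finset.exists_max_image (E.erase B) Finset.card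
      ⟨A₁, Finset.mem_erase.2 ⟨hA₁B, hA₁⟩⟩
    obtain ⟨hAB, hA⟩ := Finset.mem_erase.1 hA
    obtain ⟨z, hzB, hzA⟩ := Finset.not_subset.1 (hE B hB A hA hAB.symm).1
    have hmax : ∀ C ∈ E, C.card ≤ A.card := by
      intro C hC
      by_cases h : C = B
      · exact h ▸ hBmin A hA
      · exact hAmax C (Finset.mem_erase.2 ⟨h, hC⟩)
    have small : ∀ C ∈ E, ∀ D ∈ E, C.card ≤ D.card → ∀ u ∈ C, u ∉ D → ∀ v ∈ C, v ≠ u → v ∈ D := by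
      intro C hC D hD hcard u hu huD v hv hvu
      exact mem_of_card_sdiff_le_one (card_sdiff_le_one_of_card_le
        (hE C hC D hD (fun h => huD (h ▸ hu))).2 hcard) hu huD hv hvu
    refine ⟨z, ⟨B, hB, hzB⟩, fun C hC hzC D hD hzD v hv hvz => ?_⟩
    by_cases hcard : C.card ≤ D.card
    · exact small C hC D hD hcard z hzC hzD v hv hvz
    exfalso
    push Not at hcard
    -- For `D` smaller than `C`, the contradiction is `D ⊆ A`. Vertices of `D` in `B` or `C` lie in
    -- `A`, as `z` is all that these sets lose towards `A`. A vertex of `D` outside both would,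
    -- together with some `z' ∈ B \ C`, which lies in `D`, make two vertices of `D` outside the
    -- larger set `C`.
    refine (hE D hD A hA ?_).1 ?_
    · rintro rfl
      exact absurd (hmax C hC) (not_le.2 hcard)
    · intro u hu
      have hzne : u ≠ z := fun h => hzD (h ▸ hu)
      by_cases huC : u ∈ C
      · exact small C hC A hA (hmax C hC) z hzC hzA u huC hzne
      · by_cases huB : u ∈ B
        · exact small B hB A hA (hBmin A hA) z hzB hzA u huB hzne
        · have hBC : B ≠ C := fun h => absurd (hBmin D hD) (not_le.2 (h ▸ hcard))
          obtain ⟨z', hz'B, hz'C⟩ := Finset.not_subset.1 (hE B hB C hC hBC).1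
          have hz'D := small B hB D hD (hBmin D hD) z hzB hzD z' hz'B (fun h => hz'C (h ▸ hzC))
          exact absurd (small D hD C hC hcard.le u hu huC z' hz'D (fun h => huB (h ▸ hz'B))) hz'C
  · push Not at hone
    obtain ⟨z, hz⟩ := hA₀ne
    refine ⟨z, ⟨A₀, hA₀, hz⟩, fun A hA hzA C hC hzC => ?_⟩
    rw [hone A hA] at hzA
    rw [hone C hC] at hzC
    exact absurd hzA hzC

theorem exists_gap [Finite V] {w : V → ℝ} {t : ℝ} :
    ∃ δ > 0, ∀ T : Finset V, ∑ v ∈ T, w v < t → ∑ v ∈ T, w v + δ ≤ t := by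
  obtain ⟨δ, hδ, h⟩ := exists_pos_le
    (fun T : {T : Finset V // ∑ v ∈ T, w v < t} => t - ∑ v ∈ T.1, w v) (fun T => sub_pos.2 T.2)
  exact ⟨δ, hδ, fun T hT => by linarith [h ⟨T, hT⟩]⟩

open Classical in
/-- One-Sperner families are threshold. -/
theorem IsOneSperner.isThreshold [Fintype V] (m : ℕ) : ∀ E : Finset (Finset V), IsOneSperner E →
    (E.biUnion id).card = m → IsThreshold E := by
  induction m using Nat.strong_induction_on with
  | _ m ih =>
    intro E hE hm
    by_cases hne : ∃ A ∈ E, A.Nonempty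
    · obtain ⟨z, ⟨A₀, hA₀, hzA₀⟩, hz⟩ := hE.exists_split hne
      -- The members with `z` leave the remainders `E₁`, with union `U`. Those without `z` all
      -- contain `U` and leave the remainders `E₂`.
      set E₁ := (E.filter (z ∈ ·)).image (Finset.erase · z) with hE₁
      set U : Finset V := E₁.biUnion id with hU
      set E₂ := (E.filter (z ∉ ·)).image (· \ U) with hE₂
      have hmemU : ∀ {v}, v ∈ U ↔ ∃ A ∈ E, z ∈ A ∧ v ∈ A ∧ v ≠ z := by
        intro v
        simp only [hU, hE₁, Finset.mem_biUnion, Finset.mem_image, Finset.mem_filter, id]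
        constructor
        · rintro ⟨_, ⟨A, ⟨hA, hzA⟩, rfl⟩, hv⟩
          exact ⟨A, hA, hzA, (Finset.mem_erase.1 hv).2, (Finset.mem_erase.1 hv).1⟩
        · rintro ⟨A, hA, hzA, hv, hvz⟩
          exact ⟨_, ⟨A, ⟨hA, hzA⟩, rfl⟩, Finset.mem_erase.2 ⟨hvz, hv⟩⟩
      have hzU : z ∉ U := fun h => by
        obtain ⟨_, _, _, _, h⟩ := hmemU.1 h
        exact h rfl
      have hUsub : ∀ B ∈ E, z ∉ B → U ⊆ B := by
        intro B hB hzB v hv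
        obtain ⟨A, hA, hzA, hvA, hvz⟩ := hmemU.1 hv
        exact hz A hA hzA B hB hzB v hvA hvz
      have hzE : z ∈ E.biUnion id := Finset.mem_biUnion.2 ⟨A₀, hA₀, hzA₀⟩
      have hcard : ∀ F : Finset (Finset V), (∀ A ∈ F, z ∉ A) → (∀ A ∈ F, ∃ B ∈ E, A ⊆ B) →
          (F.biUnion id).card < m := by
        intro F h1 h2
        rw [← hm]
        refine Finset.card_lt_card (Finset.ssubset_iff_subset_ne.2 ⟨?_, ?_⟩)
        · intro v hv
          obtain ⟨A, hA, hvA⟩ := Finset.mem_biUnion.1 hv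
          obtain ⟨B, hB, hAB⟩ := h2 A hA
          exact Finset.mem_biUnion.2 ⟨B, hB, hAB hvA⟩
        · intro h
          rw [← h] at hzE
          obtain ⟨A, hA, hzA⟩ := Finset.mem_biUnion.1 hzE
          exact h1 A hA hzA
      have hsp₁ : IsOneSperner E₁ := by
        intro A' hA' B' hB' hAB
        obtain ⟨A, hA, rfl⟩ := Finset.mem_image.1 hA'
        obtain ⟨B, hB, rfl⟩ := Finset.mem_image.1 hB'
        rw [Finset.mem_filter] at hA hB
        have h := hE A hA.1 B hB.1 (fun h => hAB (by rw [h]))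
        have hd : ∀ C D : Finset V, z ∈ D → C.erase z \ D.erase z = C \ D := by
          intro C D hD
          ext v
          by_cases hv : v = z <;> simp [hv, hD]
        rw [hd A B hB.2, hd B A hA.2]
        refine ⟨fun hsub => h.1 ?_, h.2⟩
        rw [← Finset.sdiff_eq_empty_iff_subset] at hsub ⊢
        rwa [hd A B hB.2] at hsub
      have hsp₂ : IsOneSperner E₂ := by
        intro A' hA' B' hB' hAB
        obtain ⟨A, hA, rfl⟩ := Finset.mem_image.1 hA'
        obtain ⟨B, hB, rfl⟩ := Finset.mem_image.1 hB'
        rw [Finset.mem_filter] at hA hB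
        have h := hE A hA.1 B hB.1 (fun h => hAB (by rw [h]))
        have hd : ∀ C D : Finset V, U ⊆ D → (C \ U) \ (D \ U) = C \ D := by
          intro C D hD
          ext v
          by_cases hv : v ∈ U
          · simp [hv, hD hv]
          · simp [hv]
        rw [hd A B (hUsub B hB.1 hB.2), hd B A (hUsub A hA.1 hA.2)]
        refine ⟨fun hsub => h.1 ?_, h.2⟩
        rw [← Finset.sdiff_eq_empty_iff_subset] at hsub ⊢
        rwa [hd A B (hUsub B hB.1 hB.2)] at hsub
      obtain ⟨w₁, t₁, hw₁, ht₁, h₁⟩ := ih _ (hcard E₁ (by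
        intro A hA
        obtain ⟨B, _, rfl⟩ := Finset.mem_image.1 hA
        exact Finset.notMem_erase _ _) (by
        intro A hA
        obtain ⟨B, hB, rfl⟩ := Finset.mem_image.1 hA
        exact ⟨B, (Finset.mem_filter.1 hB).1, Finset.erase_subset _ _⟩)) E₁ hsp₁ rfl
      obtain ⟨w₂, t₂, hw₂, ht₂, h₂⟩ := ih _ (hcard E₂ (by
        intro A hA
        obtain ⟨B, hB, rfl⟩ := Finset.mem_image.1 hA
        exact fun h => (Finset.mem_filter.1 hB).2 (Finset.mem_sdiff.1 h).1) (by
        intro A hA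
        obtain ⟨B, hB, rfl⟩ := Finset.mem_image.1 hA
        exact ⟨B, (Finset.mem_filter.1 hB).1, Finset.sdiff_subset⟩)) E₂ hsp₂ rfl
      -- A set without `z` has to hit all of `E₁`; then it meets `U`, which is contained in every
      -- member without `z`. For a set with `z` only the members without `z` matter, and any vertex
      -- of `U` hits all of those.
      have hitsE : ∀ T : Finset V, Hits E T ↔ Hits E₁ (T ∩ U) ∨
          (z ∈ T ∧ ((T ∩ U).Nonempty ∨ Hits E₂ (T \ insert z U))) := by
        intro T
        constructor
        · intro hT
          by_cases hzT : z ∈ T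
          · by_cases hTU : (T ∩ U).Nonempty
            · exact Or.inr ⟨hzT, Or.inl hTU⟩
            · refine Or.inr ⟨hzT, Or.inr fun A hA => ?_⟩
              obtain ⟨B, hB, rfl⟩ := Finset.mem_image.1 hA
              rw [Finset.mem_filter] at hB
              obtain ⟨v, hvB, hvT⟩ := hT B hB.1
              have hvU : v ∉ U := fun h => hTU ⟨v, Finset.mem_inter.2 ⟨hvT, h⟩⟩
              refine ⟨v, Finset.mem_sdiff.2 ⟨hvB, hvU⟩, Finset.mem_sdiff.2 ⟨hvT, fun h => ?_⟩⟩
              rcases Finset.mem_insert.1 h with rfl | h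
              · exact hB.2 hvB
              · exact hvU h
          · refine Or.inl fun A hA => ?_
            obtain ⟨B, hB, rfl⟩ := Finset.mem_image.1 hA
            rw [Finset.mem_filter] at hB
            obtain ⟨v, hvB, hvT⟩ := hT B hB.1
            have hvz : v ≠ z := fun h => hzT (h ▸ hvT)
            exact ⟨v, Finset.mem_erase.2 ⟨hvz, hvB⟩,
              Finset.mem_inter.2 ⟨hvT, hmemU.2 ⟨B, hB.1, hB.2, hvB, hvz⟩⟩⟩
        · have hTU : (T ∩ U).Nonempty → ∀ B ∈ E, z ∉ B → ∃ v ∈ B, v ∈ T := by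
            rintro ⟨v, hv⟩ B hB hzB
            rw [Finset.mem_inter] at hv
            exact ⟨v, hUsub B hB hzB hv.2, hv.1⟩
          rintro (h | ⟨hzT, h⟩) B hB
          · have hmem : ∀ A ∈ E, z ∈ A → ∃ v ∈ A, v ∈ T ∩ U := by
              intro A hA hzA
              obtain ⟨v, hv, hvT⟩ := h (A.erase z)
                (Finset.mem_image.2 ⟨A, Finset.mem_filter.2 ⟨hA, hzA⟩, rfl⟩)
              exact ⟨v, (Finset.mem_erase.1 hv).2, hvT⟩
            by_cases hzB : z ∈ B
            · obtain ⟨v, hv, hvT⟩ := hmem B hB hzB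
              exact ⟨v, hv, (Finset.mem_inter.1 hvT).1⟩
            · obtain ⟨v, _, hvT⟩ := hmem A₀ hA₀ hzA₀
              exact hTU ⟨v, hvT⟩ B hB hzB
          · by_cases hzB : z ∈ B
            · exact ⟨z, hzB, hzT⟩
            · rcases h with h | h
              · exact hTU h B hB hzB
              · obtain ⟨v, hv, hvT⟩ := h (B \ U)
                  (Finset.mem_image.2 ⟨B, Finset.mem_filter.2 ⟨hB, hzB⟩, rfl⟩)
                exact ⟨v, (Finset.mem_sdiff.1 hv).1, (Finset.mem_sdiff.1 hvT).1⟩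
      have ht₁pos : 0 < t₁ := by
        rcases ht₁.eq_or_lt with h | h
        · obtain ⟨v, _, hv⟩ := (h₁ ∅).1 (by simp [← h]) (A₀.erase z)
            (Finset.mem_image.2 ⟨A₀, Finset.mem_filter.2 ⟨hA₀, hzA₀⟩, rfl⟩)
          exact absurd hv (Finset.notMem_empty _)
        · exact h
      obtain ⟨δ, hδ, hgap⟩ := exists_gap (V := V) (w := w₁) (t := t₁)
      obtain ⟨μ, hμ, hmin⟩ := exists_pos_le w₁ hw₁
      -- The weights for `E₂` are scaled by an `ε` so small that they cannot bridge the gap `δ`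
      -- below `t₁`. The weight `t₁ - ε * t₂` of `z` leaves exactly the scaled threshold to be
      -- reached by the vertices outside `U`. Any vertex of `U` makes up for it, since its weight is
      -- at least `μ`; the comparison with `t₁` keeps the weight of `z` positive.
      set K := ∑ v, w₂ v + t₂ + 1 with hK
      have hsum0 : 0 ≤ ∑ v, w₂ v := Finset.sum_nonneg fun v _ => (hw₂ v).le
      have hKpos : 0 < K := by linarith
      have hmpos : 0 < min δ (min μ t₁) := lt_min hδ (lt_min hμ ht₁pos)
      set ε := min δ (min μ t₁) / K with hε
      have hεpos : 0 < ε := div_pos hmpos hKpos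
      have hεK : ε * K = min δ (min μ t₁) := div_mul_cancel₀ _ hKpos.ne'
      have hbound : ε * (∑ v, w₂ v) + ε * t₂ < min δ (min μ t₁) := by
        rw [← hεK, hK]; nlinarith
      have hs0 : 0 ≤ ε * ∑ v, w₂ v := mul_nonneg hεpos.le hsum0
      have ht0 : 0 ≤ ε * t₂ := mul_nonneg hεpos.le ht₂
      have hbδ := hbound.trans_le (min_le_left _ _)
      have hbμ := hbound.trans_le ((min_le_right _ _).trans (min_le_left _ _))
      have hbt := hbound.trans_le ((min_le_right _ _).trans (min_le_right _ _))
      refine ⟨fun v => if v ∈ U then w₁ v else if v = z then t₁ - ε * t₂ else ε * w₂ v, t₁, ?_,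
        ht₁, ?_⟩
      · intro v
        dsimp only
        split_ifs
        · exact hw₁ v
        · linarith
        · exact mul_pos hεpos (hw₂ v)
      intro T
      have hsplit : ∑ v ∈ T, (if v ∈ U then w₁ v else if v = z then t₁ - ε * t₂ else ε * w₂ v) =
          ∑ v ∈ T ∩ U, w₁ v + (if z ∈ T then t₁ - ε * t₂ else 0) +
            ε * ∑ v ∈ T \ insert z U, w₂ v := by
        rw [← Finset.sum_inter_add_sum_sdiff T U, add_assoc]
        congr 1
        · exact Finset.sum_congr rfl fun v hv => if_pos (Finset.mem_inter.1 hv).2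
        · have h1 : ∑ v ∈ T \ U, (if v ∈ U then w₁ v else if v = z then t₁ - ε * t₂
              else ε * w₂ v) = ∑ v ∈ T \ U, ((if v = z then t₁ - ε * t₂ else 0) +
                if v ∉ insert z U then ε * w₂ v else 0) := by
            refine Finset.sum_congr rfl fun v hv => ?_
            have hvU := (Finset.mem_sdiff.1 hv).2
            by_cases hvz : v = z
            · rw [hvz]; simp [hzU]
            · simp [hvU, hvz]
          rw [h1, Finset.sum_add_distrib, Finset.sum_ite_eq', ← Finset.sum_filter, Finset.mul_sum]
          congr 1
          · simp [hzU]
          · refine Finset.sum_congr ?_ fun _ _ => rfl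
            ext v
            simp only [Finset.mem_filter, Finset.mem_sdiff, Finset.mem_insert]
            tauto
      rw [hsplit, hitsE T, ← h₁, ← h₂]
      have hle : ε * ∑ v ∈ T \ insert z U, w₂ v ≤ ε * ∑ v, w₂ v :=
        mul_le_mul_of_nonneg_left (Finset.sum_le_univ_sum_of_nonneg fun v => (hw₂ v).le) hεpos.le
      have hge : 0 ≤ ε * ∑ v ∈ T \ insert z U, w₂ v :=
        mul_nonneg hεpos.le (Finset.sum_nonneg fun v _ => (hw₂ v).le)
      have hge₁ : 0 ≤ ∑ v ∈ T ∩ U, w₁ v := Finset.sum_nonneg fun v _ => (hw₁ v).le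
      by_cases hzT : z ∈ T
      · simp only [hzT, if_true, true_and]
        by_cases hTU : (T ∩ U).Nonempty
        · simp only [hTU, true_or, or_true, iff_true]
          obtain ⟨v, hv⟩ := hTU
          have := Finset.single_le_sum (f := w₁) (fun v _ => (hw₁ v).le) hv
          linarith [hmin v]
        · rw [Finset.not_nonempty_iff_eq_empty] at hTU
          simp only [hTU, Finset.sum_empty, Finset.not_nonempty_empty, false_or, not_le.2 ht₁pos]
          rw [← mul_le_mul_iff_of_pos_left hεpos (b := t₂)]
          constructor <;> intro h <;> linarith
      · simp only [hzT, if_false, false_and, or_false, add_zero]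
        constructor
        · intro h
          by_contra hcon
          linarith [hgap (T ∩ U) (not_le.1 hcon)]
        · intro h
          linarith
    · push Not at hne
      -- What remains is the empty family, hit by every set, and the family consisting of `∅`, hit
      -- by none.
      by_cases hE0 : E = ∅
      · exact ⟨fun _ => 1, 0, fun _ => one_pos, le_rfl, fun T =>
          iff_of_true (Finset.sum_nonneg fun _ _ => zero_le_one) (by simp [Hits, hE0])⟩
      · obtain ⟨A, hA⟩ := Finset.nonempty_iff_ne_empty.2 hE0
        refine ⟨fun _ => 1, Fintype.card V + 1, fun _ => one_pos, by positivity, fun T =>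
          iff_of_false ?_ fun h => ?_⟩
        · have : (T.card : ℝ) ≤ Fintype.card V := by exact_mod_cast Finset.card_le_univ T
          simp only [Finset.sum_const, nsmul_eq_mul, mul_one]
          linarith
        · obtain ⟨v, hv, _⟩ := h A hA
          rw [hne A hA] at hv
          exact absurd hv (Finset.notMem_empty _)

end Threshold

/-! ### The family of minimal cuts -/

section Family

variable {V : Type*} {G : SimpleGraph V}

open Classical in
/-- The minimal cuts of `G`. -/
noncomputable def minimalCuts [Fintype V] (G : SimpleGraph V) : Finset (Finset V) :=
  Finset.univ.filter fun A => Minimal (IsCut G) (A : Set V)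

theorem mem_minimalCuts [Fintype V] {A : Finset V} :
    A ∈ minimalCuts G ↔ Minimal (IsCut G) (A : Set V) := by
  simp [minimalCuts]

theorem isConnectedDominating_iff_minimal [Finite V] {T : Set V} :
    IsConnectedDominating G T ↔ ∀ S, Minimal (IsCut G) S → (T ∩ S).Nonempty := by
  rw [isConnectedDominating_iff]
  constructor
  · exact fun h S hS => h S hS.1
  · intro h C hC
    obtain ⟨S, hSC, hS⟩ := hC.exists_minimal
    exact (h S hS).mono (Set.inter_subset_inter_right _ hSC)

theorem isConnectedDominating_iff_hits [Fintype V] {T : Finset V} :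
    IsConnectedDominating G (T : Set V) ↔ Hits (minimalCuts G) T := by
  rw [isConnectedDominating_iff_minimal]
  constructor
  · intro h A hA
    obtain ⟨v, hvT, hvA⟩ := h A (mem_minimalCuts.1 hA)
    exact ⟨v, hvA, hvT⟩
  · intro h S hS
    obtain ⟨A, rfl⟩ := (Set.toFinite S).exists_finset_coe
    obtain ⟨v, hvA, hvT⟩ := h A (mem_minimalCuts.2 hS)
    exact ⟨v, hvT, hvA⟩

open Classical in
theorem IsChordal.isOneSperner_minimalCuts [Fintype V] (hG : IsChordal G)
    (hfree : ¬ HasObstruction G) : IsOneSperner (minimalCuts G) := by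
  intro A hA B hB hne
  rw [mem_minimalCuts] at hA hB
  have hcard : ∀ C D : Finset V, ((C : Set V) \ D).Subsingleton → (C \ D).card ≤ 1 := by
    intro C D h
    refine Finset.card_le_one.2 fun u hu v hv => h ?_ ?_
    · simpa using hu
    · simpa using hv
  refine ⟨fun hsub => hne (hsub.antisymm ?_), ?_⟩
  · exact Finset.coe_subset.1 (hB.2 hA.1 (Finset.coe_subset.2 hsub))
  · exact (hG.minimalCut_subsingleton_sdiff hfree hA hB).imp (hcard A B) (hcard B A)

theorem IsChordal.isConnectedDomishold [Finite V] (hG : IsChordal G)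
    (hfree : ¬ HasObstruction G) : IsConnectedDomishold G := by
  classical
  have := Fintype.ofFinite V
  obtain ⟨w, t, hw, ht, h⟩ := (hG.isOneSperner_minimalCuts hfree).isThreshold _ _ rfl
  exact ⟨w, t, fun v => (hw v).le, ht, fun S => (h S).trans isConnectedDominating_iff_hits.symm⟩

end Family

/-! ### Split graphs -/

section Split

variable {V : Type*} {G : SimpleGraph V}

theorem IsSplit.of_isIndContained {W : Type*} {F : SimpleGraph W} (h : F.IsIndContained G)
    (hG : IsSplit G) : IsSplit F := by
  obtain ⟨φ⟩ := h
  obtain ⟨K, hK, hI⟩ := hG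
  refine ⟨φ ⁻¹' K, fun a ha b hb hab => ?_, fun a ha b hb hab hadj => ?_⟩
  · exact φ.map_rel_iff.1 (hK ha hb (φ.injective.ne hab))
  · exact hI ha hb (φ.injective.ne hab) (φ.map_rel_iff.2 hadj)

/-- The clique contains an end of each edge, and these two ends are distinct and would have to be
adjacent. -/
theorem not_isSplit_of_disjoint_edges {a b c d : V} (hab : G.Adj a b) (hcd : G.Adj c d)
    (hac : ¬ G.Adj a c) (had : ¬ G.Adj a d) (hbc : ¬ G.Adj b c) (hbd : ¬ G.Adj b d) :
    ¬ IsSplit G := by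
  rintro ⟨K, hK, hI⟩
  have h1 : a ∈ K ∨ b ∈ K := by
    by_contra h
    rw [not_or] at h
    exact hI h.1 h.2 hab.ne hab
  have h2 : c ∈ K ∨ d ∈ K := by
    by_contra h
    rw [not_or] at h
    exact hI h.1 h.2 hcd.ne hcd
  rcases h1 with h1 | h1 <;> rcases h2 with h2 | h2
  · exact hac (hK h1 h2 (by rintro rfl; exact had hcd))
  · exact had (hK h1 h2 (by rintro rfl; exact hac hcd.symm))
  · exact hbc (hK h1 h2 (by rintro rfl; exact hbd hcd))
  · exact hbd (hK h1 h2 (by rintro rfl; exact hbc hcd.symm))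

theorem not_isSplit_of_bool {n : ℕ} {F : SimpleGraph (Fin n)}
    (h : ∀ p : Fin n → Bool, (∃ a b, a ≠ b ∧ p a ∧ p b ∧ ¬ F.Adj a b) ∨
      ∃ a b, ¬ p a ∧ ¬ p b ∧ F.Adj a b) : ¬ IsSplit F := by
  classical
  rintro ⟨K, hK, hI⟩
  rcases h (fun a => decide (a ∈ K)) with ⟨a, b, hab, ha, hb, hn⟩ | ⟨a, b, ha, hb, hab⟩
  · exact hn (hK (of_decide_eq_true ha) (of_decide_eq_true hb) hab)
  · exact hI (fun h => ha (decide_eq_true h)) (fun h => hb (decide_eq_true h)) hab.ne hab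

theorem not_isSplit_cycleGraph {k : ℕ} (hk : 4 ≤ k) : ¬ IsSplit (SimpleGraph.cycleGraph k) := by
  -- From length six on, the edges `01` and `34` are disjoint with no edge between them; the two
  -- shorter cycles are checked by exhaustion.
  obtain rfl | rfl | h6 : k = 4 ∨ k = 5 ∨ 6 ≤ k := by omega
  · exact not_isSplit_of_bool (by decide)
  · exact not_isSplit_of_bool (by decide)
  · have e : ∀ x y : Fin k, x.val < y.val → ((SimpleGraph.cycleGraph k).Adj x y ↔
        y.val = x.val + 1 ∨ (x.val = 0 ∧ y.val + 1 = k)) := by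
      intro x y hxy
      have hx := x.2
      have hy := y.2
      rw [SimpleGraph.cycleGraph_adj', Fin.sub_def, Fin.sub_def]
      dsimp only
      rw [show k - x.val + y.val = (y.val - x.val) + k by omega, Nat.add_mod_right,
        Nat.mod_eq_of_lt (show y.val - x.val < k by omega),
        Nat.mod_eq_of_lt (show k - y.val + x.val < k by omega)]
      omega
    refine not_isSplit_of_disjoint_edges (a := ⟨0, by omega⟩) (b := ⟨1, by omega⟩)
      (c := ⟨3, by omega⟩) (d := ⟨4, by omega⟩) ?_ ?_ ?_ ?_ ?_ ?_ <;>
      rw [e _ _ (by dsimp only; omega)] <;> dsimp only <;> omega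

theorem IsSplit.isChordal (hG : IsSplit G) : IsChordal G :=
  fun _ hk h => not_isSplit_cycleGraph hk (hG.of_isIndContained h)

theorem not_isSplit_F₁ : ¬ IsSplit F₁ :=
  not_isSplit_of_disjoint_edges (a := 0) (b := 1) (c := 4) (d := 5) (by decide) (by decide)
    (by decide) (by decide) (by decide) (by decide)

theorem not_isSplit_H (i : ℕ) : ¬ IsSplit (H i) := by
  refine not_isSplit_of_disjoint_edges (a := ⟨0, by omega⟩) (b := ⟨1, by omega⟩)
    (c := ⟨i + 4, by omega⟩) (d := ⟨i + 5, by omega⟩) ?_ ?_ ?_ ?_ ?_ ?_ <;>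
    rw [H_adj_of_lt (by rw [Fin.lt_def]; dsimp only; omega)] <;> dsimp only <;> omega

theorem IsSplit.isF₁F₂HFree (hG : IsSplit G) (h : ¬ F₂.IsIndContained G) : IsF₁F₂HFree G :=
  ⟨fun h1 => not_isSplit_F₁ (hG.of_isIndContained h1), h,
    fun i _ h1 => not_isSplit_H i (hG.of_isIndContained h1)⟩

theorem IsSplit.isHereditarilyConnectedDomishold [Finite V] (hG : IsSplit G)
    (h : ¬ F₂.IsIndContained G) : IsHereditarilyConnectedDomishold G := by
  intro U
  have hU : (G.induce U).IsIndContained G := ⟨SimpleGraph.Embedding.induce U⟩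
  have hs := hG.of_isIndContained hU
  exact hs.isChordal.isConnectedDomishold
    (hs.isF₁F₂HFree fun h1 => h (h1.trans hU)).not_hasObstruction

end Split

/-! ### The lower bound for the dynamic program -/

section Chain

/-- If the sets `e 0, …, e (m - 1)` form an antichain in which every set has at most one element
outside each later one, and `d` is bounded along each interval of sets by the cost of a common
element, then `d` grows by at most the cost of a set meeting all of them. -/
theorem chain_bound {V : Type*} {m : ℕ} {e : ℕ → V → Prop} {d : ℕ → ℝ} {c : V → ℝ}
    (hsp : ∀ i j, i < j → j < m → ∀ u, e i u → ¬ e j u → ∀ v, e i v → v ≠ u → e j v)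
    (hanti : ∀ i j, i < j → j < m → ∃ u, e i u ∧ ¬ e j u)
    (hd : ∀ i j, i < j → j ≤ m → ∀ w, (∀ l, i ≤ l → l < j → e l w) → d j ≤ d i + c w)
    (hc : ∀ w, 0 ≤ c w) {T : Finset V} (hT : ∀ l < m, ∃ w ∈ T, e l w) :
    d m ≤ d 0 + ∑ w ∈ T, c w := by
  classical
  -- The sets are used up from the last one backwards, each time by the vertex of `T` in set `j - 1`
  -- whose interval reaches farthest back; `U` collects these vertices. The invariant speaks of the
  -- latest one, `v`. Below `j` it lies in every set that contains a vertex of `U`; it is not in set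
  -- `j - 1`; and every vertex of `T` in set `j - 1` misses some set from `j` on that contains `v`.
  have claim : ∀ j ≤ m, ∀ U ⊆ T, d m ≤ d j + ∑ w ∈ U, c w →
      (U = ∅ ∨ ∃ v, (∀ u ∈ U, ∀ i < j, e i u → e i v) ∧ (0 < j → ¬ e (j - 1) v) ∧
        ∀ w ∈ T, 0 < j → e (j - 1) w → ∃ q, j ≤ q ∧ q < m ∧ e q v ∧ ¬ e q w) →
      d m ≤ d 0 + ∑ w ∈ T, c w := by
    intro j
    induction j using Nat.strong_induction_on with
    | _ j ih =>
      intro hjm U hUT hdU hinv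
      rcases Nat.eq_zero_or_pos j with rfl | hj
      · have := Finset.sum_le_sum_of_subset_of_nonneg (f := c) hUT fun w _ _ => hc w
        linarith
      have hex : ∀ w, ∃ a, ∀ l, a ≤ l → l < j → e l w := fun w => ⟨j, fun l h1 h2 => by omega⟩
      obtain ⟨w₀, hw₀T, hw₀⟩ := hT (j - 1) (by omega)
      obtain ⟨w, hw, hwmin⟩ := Finset.exists_min_image (T.filter (e (j - 1)))
        (fun w => Nat.find (hex w)) ⟨w₀, Finset.mem_filter.2 ⟨hw₀T, hw₀⟩⟩
      obtain ⟨hwT, hwj⟩ := Finset.mem_filter.1 hw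
      have hreach := Nat.find_spec (hex w)
      have hless : ∀ w' ∈ T, e (j - 1) w' → ∀ a, (∀ l, a ≤ l → l < j → e l w') →
          Nat.find (hex w) ≤ a := fun w' h1 h2 a ha =>
        (hwmin w' (Finset.mem_filter.2 ⟨h1, h2⟩)).trans (Nat.find_min' (hex w') ha)
      set j' := Nat.find (hex w)
      have hj' : j' < j := by
        have := hless w hwT hwj (j - 1) fun l h1 h2 => by
          rwa [show l = j - 1 by omega]
        omega
      -- No vertex is paid for twice: if one of `U` were in set `j - 1`, so would be `v`.
      have hwU : w ∉ U := by
        intro hwU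
        rcases hinv with rfl | ⟨v, h1, h2, _⟩
        · exact absurd hwU (Finset.notMem_empty _)
        · exact h2 hj (h1 w hwU (j - 1) (by omega) hwj)
      refine ih j' hj' (by omega) (insert w U) (Finset.insert_subset hwT hUT) ?_
        (Or.inr ⟨w, ?_, ?_, ?_⟩)
      · rw [Finset.sum_insert hwU]
        have := hd j' j hj' hjm w hreach
        linarith
      · intro u hu i hi hiu
        rcases Finset.mem_insert.1 hu with rfl | hu
        · exact hiu
        rcases hinv with rfl | ⟨v, h1, h2, h3⟩
        · exact absurd hu (Finset.notMem_empty _)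
        have hiv := h1 u hu i (by omega) hiu
        obtain ⟨q, hjq, hqm, hqv, hqw⟩ := h3 w hwT hj hwj
        by_contra hiw
        -- All that set `i` loses towards set `j - 1` is `v`, and all that set `j - 1` loses towards
        -- set `q` is `w`. So `x`, which is neither, would survive into set `q`.
        obtain ⟨x, hix, hqx⟩ := hanti i q (by omega) hqm
        have hxv : x ≠ v := fun h => hqx (h ▸ hqv)
        have hjx := hsp i (j - 1) (by omega) (by omega) v hiv (h2 hj) x hix hxv
        exact hqx (hsp (j - 1) q (by omega) hqm w hwj hqw x hjx fun h => hiw (h ▸ hix))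
      · intro hpos h
        have := hless w hwT hwj (j' - 1) fun l h1 h2 => by
          by_cases hl : l = j' - 1
          · rwa [hl]
          · exact hreach l (by omega) h2
        omega
      · intro w' hw'T hpos hw'
        by_contra hcon
        push Not at hcon
        -- Otherwise `w'` would cover the whole interval of `w` and set `j' - 1` in addition,
        -- reaching farther back than `w`.
        have hall : ∀ l, j' ≤ l → l < j → e l w' := fun l h1 h2 =>
          hcon l h1 (by omega) (hreach l h1 h2)
        have := hless w' hw'T (hall (j - 1) (by omega) (by omega)) (j' - 1) fun l h1 h2 => by
          by_cases hl : l = j' - 1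
          · rwa [hl]
          · exact hall l (by omega) h2
        omega
  exact claim m le_rfl ∅ (Finset.empty_subset _) (by simp) (Or.inl rfl)

end Chain

/-! ### Representatives of the minimal cuts, ordered by size -/

section Selection

variable {n : ℕ} {G : SimpleGraph (Fin n)} {r : Fin n}

/-- `sepSet G r v` is minimal among these sets, and `v` is the least vertex with this set. -/
def IsSelected (G : SimpleGraph (Fin n)) (r v : Fin n) : Prop :=
  ∀ u, sepSet G r u ⊆ sepSet G r v → sepSet G r u = sepSet G r v ∧ v ≤ u

/-- A minimal cut inside `sepSet G r v` is itself some `sepSet G r u`, and selection forces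
equality. -/
theorem IsSelected.minimal (hG : IsChordal G) (hr : G.IsClique {w | G.Adj r w}) {v : Fin n}
    (hv : IsSelected G r v) : Minimal (IsCut G) (sepSet G r v) := by
  obtain ⟨S, hSv, hS⟩ := (isCut_sepSet (G := G) r v).exists_minimal
  obtain ⟨u, rfl⟩ := hG.exists_sepSet_eq hr hS
  rw [← (hv u hSv).1]
  exact hS

theorem IsChordal.exists_isSelected (hG : IsChordal G) (hr : G.IsClique {w | G.Adj r w})
    {S : Set (Fin n)} (hS : Minimal (IsCut G) S) : ∃ v, IsSelected G r v ∧ sepSet G r v = S := by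
  obtain ⟨v, hv, hmin⟩ := (Set.toFinite {v | sepSet G r v = S}).exists_minimal
    (hG.exists_sepSet_eq hr hS)
  refine ⟨v, fun u hu => ?_, hv⟩
  have hv' : sepSet G r v = S := hv
  rw [hv'] at hu ⊢
  have huS : sepSet G r u = S := subset_antisymm hu (hS.2 (isCut_sepSet r u) hu)
  refine ⟨huS, ?_⟩
  by_contra h
  exact h (hmin huS (not_le.1 h).le)

theorem IsSelected.eq {u v : Fin n} (hu : IsSelected G r u) (hv : IsSelected G r v)
    (h : sepSet G r u = sepSet G r v) : u = v :=
  le_antisymm (hu v h.ge).2 (hv u h.le).2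

theorem isConnectedDominating_iff_selected (hG : IsChordal G) (hr : G.IsClique {w | G.Adj r w})
    {T : Set (Fin n)} : IsConnectedDominating G T ↔
      ∀ v, IsSelected G r v → ∃ w ∈ T, w ∈ sepSet G r v := by
  rw [isConnectedDominating_iff_minimal]
  constructor
  · intro h v hv
    exact h _ (hv.minimal hG hr)
  · intro h S hS
    obtain ⟨v, hv, rfl⟩ := hG.exists_isSelected hr hS
    exact h v hv

/-- A list of all selected vertices, by increasing size of their sets. -/
structure IsSelectionList (G : SimpleGraph (Fin n)) (r : Fin n) (m : ℕ) (L : ℕ → Fin n) :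
    Prop where
  selected : ∀ j < m, IsSelected G r (L j)
  surj : ∀ v, IsSelected G r v → ∃ j < m, L j = v
  inj : ∀ i j, i < j → j < m → L i ≠ L j
  sorted : ∀ i j, i < j → j < m → (sepSet G r (L i)).ncard ≤ (sepSet G r (L j)).ncard

/-- These are the combinatorial hypotheses of `chain_bound`. In the order by size the earlier set
has the smaller of the two differences, so at most one vertex; it has one because minimal cuts are
not nested. -/
theorem IsSelectionList.chain (hG : IsChordal G) (hfree : ¬ HasObstruction G)
    (hr : G.IsClique {w | G.Adj r w}) {m : ℕ} {L : ℕ → Fin n} (hL : IsSelectionList G r m L)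
    {i j : ℕ} (hij : i < j) (hj : j < m) :
    (∀ u ∈ sepSet G r (L i), u ∉ sepSet G r (L j) → ∀ v ∈ sepSet G r (L i), v ≠ u →
      v ∈ sepSet G r (L j)) ∧ ∃ u ∈ sepSet G r (L i), u ∉ sepSet G r (L j) := by
  have hi := hL.selected i (by omega)
  have hj' := hL.selected j hj
  have hne : sepSet G r (L i) ≠ sepSet G r (L j) := fun h => hL.inj i j hij hj (hi.eq hj' h)
  have hmi := hi.minimal hG hr
  have hmj := hj'.minimal hG hr
  have hsub : (sepSet G r (L i) \ sepSet G r (L j)).Subsingleton := by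
    rcases hG.minimalCut_subsingleton_sdiff hfree hmi hmj with h | h
    · exact h
    · have h1 := Set.ncard_le_one_iff_subsingleton.2 h
      have h2 := Set.ncard_inter_add_ncard_sdiff_eq_ncard (sepSet G r (L i)) (sepSet G r (L j))
      have h3 := Set.ncard_inter_add_ncard_sdiff_eq_ncard (sepSet G r (L j)) (sepSet G r (L i))
      rw [Set.inter_comm] at h3
      have h4 := hL.sorted i j hij hj
      exact Set.ncard_le_one_iff_subsingleton.1 (by omega)
  constructor
  · intro u hu huj v hv hvu
    by_contra hvj
    exact hvu (hsub ⟨hv, hvj⟩ ⟨hu, huj⟩)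
  · by_contra hcon
    push Not at hcon
    exact hne (subset_antisymm hcon (hmj.2 hmi.1 hcon))

end Selection

/-! ### A language of bounded loops, its semantics and running time -/

section Code

/-- Programs whose only loops are `rep i p`, which runs `p` with the variable `i` from `0` up to the
content of variable `1`, exclusively. -/
inductive Code : Type
  | nop
  | setN (a : ℕ) (addr e : NExpr)
  | setR (a : ℕ) (addr : NExpr) (e : RExpr)
  | seq (p q : Code)
  | cond (b : Test) (p q : Code)
  | rep (i : ℕ) (p : Code)

/-- The scalar variable `a`, kept at address `0` of the word array `a`. -/
def NExpr.var (a : ℕ) : NExpr := .read a (.const 0)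

namespace Code

/-- Translation to programs. -/
def toProg : Code → Prog
  | nop => .nop
  | setN a addr e => .setN a addr e
  | setR a addr e => .setR a addr e
  | seq p q => .seq p.toProg q.toProg
  | cond b p q => .cond b p.toProg q.toProg
  | rep i p => .seq (.setN i (.const 0) (.const 0))
      (.loop (.ltN (.var i) (.var 1))
        (.seq p.toProg (.setN i (.const 0) (.add (.var i) (.const 1)))))

open Classical in
/-- The store after running a program. -/
noncomputable def run (W : ℕ) : Code → Store → Store
  | nop, s => s
  | setN a addr e, s => s.setWord a (addr.eval W s) (e.eval W s)
  | setR a addr e, s => s.setReal a (addr.eval W s) (e.eval W s)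
  | seq p q, s => q.run W (p.run W s)
  | cond b p q, s => if b.Holds W s then p.run W s else q.run W s
  | rep i p, s => Nat.rec (s.setWord i 0 0)
      (fun k s' => (p.run W s').setWord i 0 (k + 1)) (s.word 1 0)

/-- The word arrays that a program writes to. -/
def writes : Code → List ℕ
  | nop => []
  | setN a _ _ => [a]
  | setR _ _ _ => []
  | seq p q => p.writes ++ q.writes
  | cond _ p q => p.writes ++ q.writes
  | rep i p => i :: p.writes

/-- The real arrays that a program writes to. -/
def writesReal : Code → List ℕ
  | nop => []
  | setN _ _ _ => []
  | setR a _ _ => [a]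
  | seq p q => p.writesReal ++ q.writesReal
  | cond _ p q => p.writesReal ++ q.writesReal
  | rep _ p => p.writesReal

/-- Loop bodies change neither their loop variable nor variable `1`. -/
def WellFormed : Code → Prop
  | nop => True
  | setN _ _ _ => True
  | setR _ _ _ => True
  | seq p q => p.WellFormed ∧ q.WellFormed
  | cond _ p q => p.WellFormed ∧ q.WellFormed
  | rep i p => p.WellFormed ∧ i ∉ p.writes ∧ 1 ∉ p.writes ∧ i ≠ 1

instance decidableWellFormed : ∀ c : Code, Decidable c.WellFormed
  | nop => .isTrue trivial
  | setN _ _ _ => .isTrue trivial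
  | setR _ _ _ => .isTrue trivial
  | seq p q => @instDecidableAnd _ _ (decidableWellFormed p) (decidableWellFormed q)
  | cond _ p q => @instDecidableAnd _ _ (decidableWellFormed p) (decidableWellFormed q)
  | rep _ p => @instDecidableAnd _ _ (decidableWellFormed p) inferInstance

/-- The nesting depth of loops. -/
def depth : Code → ℕ
  | nop => 0
  | setN _ _ _ => 0
  | setR _ _ _ => 0
  | seq p q => max p.depth q.depth
  | cond _ p q => max p.depth q.depth
  | rep _ p => p.depth + 1

/-- The constant in the bound for the running time. -/
def weight : Code → ℕ
  | nop => 1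
  | setN _ addr e => addr.cost + e.cost + 1
  | setR _ addr e => addr.cost + e.cost + 1
  | seq p q => p.weight + q.weight
  | cond b p q => b.cost + 1 + (p.weight + q.weight)
  -- Besides its body, each iteration costs 6 steps for the test and 6 for the increment;
  -- initialization and final test cost 3 and 6. All are charged to the power of `n`.
  | rep _ p => p.weight + 21

end Code

theorem Store.setWord_word_self (s : Store) (a i x : ℕ) :
    (s.setWord a i x).word a = Function.update (s.word a) i x := by
  simp [Store.setWord]

theorem Store.setWord_word_of_ne (s : Store) {a b : ℕ} (i x : ℕ) (h : b ≠ a) :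
    (s.setWord a i x).word b = s.word b := by
  simp [Store.setWord, h]

theorem Store.setWord_word (s : Store) (a i x b : ℕ) :
    (s.setWord a i x).word b = if b = a then Function.update (s.word a) i x else s.word b := by
  by_cases h : b = a
  · rw [if_pos h, h, Store.setWord_word_self]
  · rw [if_neg h, Store.setWord_word_of_ne _ _ _ h]

theorem Store.setWord_real (s : Store) (a i x : ℕ) : (s.setWord a i x).real = s.real := rfl

theorem Store.setReal_word (s : Store) (a i : ℕ) (x : ℝ) : (s.setReal a i x).word = s.word := rfl

theorem Store.setReal_real_self (s : Store) (a i : ℕ) (x : ℝ) :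
    (s.setReal a i x).real a = Function.update (s.real a) i x := by
  simp [Store.setReal]

theorem Store.setReal_real_of_ne (s : Store) {a b : ℕ} (i : ℕ) (x : ℝ) (h : b ≠ a) :
    (s.setReal a i x).real b = s.real b := by
  simp [Store.setReal, h]

namespace Code

/-- The frame rule: for concrete programs and arrays, `decide` settles its side condition. -/
theorem run_word (W : ℕ) (c : Code) : ∀ (s : Store) (a : ℕ), a ∉ c.writes →
    (c.run W s).word a = s.word a := by
  induction c with
  | nop => intro s a _; rfl
  | setN b addr e =>
    intro s a h
    exact Store.setWord_word_of_ne _ _ _ (by simpa [writes] using h)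
  | setR b addr e => intro s a _; rfl
  | seq p q ihp ihq =>
    intro s a h
    simp only [writes, List.mem_append, not_or] at h
    simp only [run]
    rw [ihq _ a h.2, ihp _ a h.1]
  | cond b p q ihp ihq =>
    intro s a h
    simp only [writes, List.mem_append, not_or] at h
    simp only [run]
    split_ifs
    · exact ihp s a h.1
    · exact ihq s a h.2
  | rep i p ih =>
    intro s a h
    simp only [writes, List.mem_cons, not_or] at h
    simp only [run]
    induction s.word 1 0 with
    | zero => exact Store.setWord_word_of_ne _ _ _ h.1
    | succ k ihk =>
      dsimp only
      rw [Store.setWord_word_of_ne _ _ _ h.1, ih _ a h.2]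
      exact ihk

theorem run_real (W : ℕ) (c : Code) : ∀ (s : Store) (a : ℕ), a ∉ c.writesReal →
    (c.run W s).real a = s.real a := by
  induction c with
  | nop => intro s a _; rfl
  | setN b addr e => intro s a _; rfl
  | setR b addr e =>
    intro s a h
    exact Store.setReal_real_of_ne _ _ _ (by simpa [writesReal] using h)
  | seq p q ihp ihq =>
    intro s a h
    simp only [writesReal, List.mem_append, not_or] at h
    simp only [run]
    rw [ihq _ a h.2, ihp _ a h.1]
  | cond b p q ihp ihq =>
    intro s a h
    simp only [writesReal, List.mem_append, not_or] at h
    simp only [run]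
    split_ifs
    · exact ihp s a h.1
    · exact ihq s a h.2
  | rep i p ih =>
    intro s a h
    simp only [run]
    induction s.word 1 0 with
    | zero => rfl
    | succ k ihk =>
      dsimp only
      rw [Store.setWord_real, ih _ a h]
      exact ihk

/-- The store before the `k`-th iteration of a loop. -/
noncomputable def iter (W i : ℕ) (p : Code) (s : Store) (k : ℕ) : Store :=
  Nat.rec (s.setWord i 0 0) (fun k s' => (p.run W s').setWord i 0 (k + 1)) k

theorem iter_frame (W : ℕ) {i : ℕ} {p : Code} (s : Store) (k : ℕ) :
    (∀ a, a ∉ (rep i p).writes → (iter W i p s k).word a = s.word a) ∧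
      (∀ a, a ∉ p.writesReal → (iter W i p s k).real a = s.real a) ∧
      (iter W i p s k).word i 0 = k := by
  induction k with
  | zero =>
    refine ⟨fun a h => ?_, fun a _ => rfl, ?_⟩
    · simp only [writes, List.mem_cons, not_or] at h
      exact Store.setWord_word_of_ne _ _ _ h.1
    · simp [iter, Store.setWord_word_self]
  | succ k ih =>
    have hs : iter W i p s (k + 1) = (p.run W (iter W i p s k)).setWord i 0 (k + 1) := rfl
    rw [hs]
    refine ⟨fun a h => ?_, fun a h => ?_, ?_⟩
    · have h' := h
      simp only [writes, List.mem_cons, not_or] at h'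
      rw [Store.setWord_word_of_ne _ _ _ h'.1, run_word _ _ _ _ h'.2]
      exact ih.1 a h
    · rw [Store.setWord_real, run_real _ _ _ _ h]
      exact ih.2.1 a h
    · simp [Store.setWord_word_self]

/-- The invariant rule for loops. -/
theorem run_rep {W i n : ℕ} {p : Code} {s : Store} (hn : s.word 1 0 = n) (I : ℕ → Store → Prop)
    (h0 : I 0 (s.setWord i 0 0))
    (hI : ∀ k s x, I k s → I k (s.setWord i 0 x))
    (hstep : ∀ k < n, ∀ s', (∀ a, a ∉ (rep i p).writes → s'.word a = s.word a) →
      (∀ a, a ∉ p.writesReal → s'.real a = s.real a) → s'.word i 0 = k → I k s' →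
      I (k + 1) (p.run W s')) :
    I n ((rep i p).run W s) := by
  have key : ∀ k ≤ n, I k (iter W i p s k) := by
    intro k
    induction k with
    | zero => intro _; exact h0
    | succ k ih =>
      intro hk
      obtain ⟨h1, h2, h3⟩ := iter_frame W (i := i) (p := p) s k
      -- The loop variable is incremented after the body; `hI` absorbs this write.
      exact hI _ _ _ (hstep k hk _ h1 h2 h3 (ih (by omega)))
  have : (rep i p).run W s = iter W i p s n := by
    simp only [run, iter, hn]
  rw [this]
  exact key n le_rfl

/-- Each loop multiplies the time by `n`, up to a constant, so the nesting depth is the exponent.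
The bound `n < W` keeps loop counters from overflowing, and `1 ≤ n` lets lower powers be absorbed.
-/
theorem exec_toProg {W n : ℕ} (hn : 1 ≤ n) (hW : n < W) (c : Code) : c.WellFormed → 1 ∉ c.writes →
    ∀ s : Store, s.word 1 0 = n →
      ∃ t, Exec W c.toProg s t (c.run W s) ∧ t ≤ c.weight * n ^ c.depth := by
  have h0 : 0 % W = 0 := Nat.zero_mod _
  have h1 : 1 % W = 1 := Nat.mod_eq_of_lt (by omega)
  induction c with
  | nop => exact fun _ _ s _ => ⟨1, .nop s, by simp [weight, depth]⟩
  | setN a addr e => exact fun _ _ s _ => ⟨_, .setN a addr e s, by simp [weight, depth]⟩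
  | setR a addr e => exact fun _ _ s _ => ⟨_, .setR a addr e s, by simp [weight, depth]⟩
  | seq p q ihp ihq =>
    intro hwf hw s hs
    simp only [writes, List.mem_append, not_or] at hw
    obtain ⟨t, ht, hle⟩ := ihp hwf.1 hw.1 s hs
    obtain ⟨t', ht', hle'⟩ := ihq hwf.2 hw.2 (p.run W s) (by rw [run_word _ _ _ _ hw.1, hs])
    refine ⟨t + t', .seq ht ht', ?_⟩
    simp only [weight, depth]
    have e1 : n ^ p.depth ≤ n ^ max p.depth q.depth := Nat.pow_le_pow_right hn (le_max_left _ _)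
    have e2 : n ^ q.depth ≤ n ^ max p.depth q.depth := Nat.pow_le_pow_right hn (le_max_right _ _)
    calc t + t' ≤ p.weight * n ^ p.depth + q.weight * n ^ q.depth := add_le_add hle hle'
      _ ≤ p.weight * n ^ max p.depth q.depth + q.weight * n ^ max p.depth q.depth := by gcongr
      _ = _ := by ring
  | cond b p q ihp ihq =>
    intro hwf hw s hs
    simp only [writes, List.mem_append, not_or] at hw
    have e0 : 1 ≤ n ^ max p.depth q.depth := Nat.one_le_pow _ _ hn
    have e1 : n ^ p.depth ≤ n ^ max p.depth q.depth := Nat.pow_le_pow_right hn (le_max_left _ _)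
    have e2 : n ^ q.depth ≤ n ^ max p.depth q.depth := Nat.pow_le_pow_right hn (le_max_right _ _)
    have e3 : p.weight * n ^ p.depth ≤ p.weight * n ^ max p.depth q.depth := by gcongr
    have e4 : q.weight * n ^ q.depth ≤ q.weight * n ^ max p.depth q.depth := by gcongr
    have e5 : b.cost + 1 ≤ (b.cost + 1) * n ^ max p.depth q.depth := Nat.le_mul_of_pos_right _ e0
    simp only [weight, depth, run, toProg, add_mul _ (p.weight + q.weight), add_mul p.weight]
    by_cases hb : b.Holds W s
    · obtain ⟨t, ht, hle⟩ := ihp hwf.1 hw.1 s hs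
      rw [if_pos hb]
      exact ⟨_, .condTrue hb ht, by omega⟩
    · obtain ⟨t, ht, hle⟩ := ihq hwf.2 hw.2 s hs
      rw [if_neg hb]
      exact ⟨_, .condFalse hb ht, by omega⟩
  | rep i p ih =>
    intro hwf hw s hs
    obtain ⟨hwfp, hip, h1p, hi1⟩ := hwf
    -- Here `l` counts the iterations still to come, so that the induction step prepends one
    -- iteration to the execution.
    have hloop : ∀ l ≤ n, ∃ t, Exec W (.loop (.ltN (.var i) (.var 1))
        (.seq p.toProg (.setN i (.const 0) (.add (.var i) (.const 1))))) (iter W i p s (n - l)) t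
        (iter W i p s n) ∧ t ≤ l * (p.weight * n ^ p.depth + 12) + 6 := by
      intro l
      induction l with
      | zero =>
        intro _
        obtain ⟨f1, f2, f3⟩ := iter_frame W (i := i) (p := p) s n
        refine ⟨_, .loopFalse ?_, ?_⟩
        · simp only [Test.Holds, NExpr.var, NExpr.eval, h0, Nat.sub_zero, f3, f1 1 hw, hs]
          omega
        · simp [Test.cost, NExpr.var, NExpr.cost]
      | succ l ihl =>
        intro hl
        obtain ⟨t', ht', hle'⟩ := ihl (by omega)
        obtain ⟨f1, f2, f3⟩ := iter_frame W (i := i) (p := p) s (n - (l + 1))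
        obtain ⟨t, ht, hle⟩ := ih hwfp h1p (iter W i p s (n - (l + 1))) (by rw [f1 1 hw, hs])
        have hnext : Exec W (.setN i (.const 0) (.add (.var i) (.const 1)))
            (p.run W (iter W i p s (n - (l + 1)))) 6 (iter W i p s (n - l)) := by
          have := Exec.setN (W := W) i (.const 0) (.add (.var i) (.const 1))
            (p.run W (iter W i p s (n - (l + 1))))
          have e : (p.run W (iter W i p s (n - (l + 1)))).setWord i
              ((NExpr.const 0).eval W (p.run W (iter W i p s (n - (l + 1)))))
              ((NExpr.add (.var i) (.const 1)).eval W (p.run W (iter W i p s (n - (l + 1))))) =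
              iter W i p s (n - l) := by
            rw [show n - l = (n - (l + 1)) + 1 by omega]
            simp only [NExpr.eval, NExpr.var, h0, h1, run_word _ _ _ _ hip, f3]
            rw [Nat.mod_eq_of_lt (by omega)]
            rfl
          rw [e] at this
          exact this
        refine ⟨_, .loopTrue ?_ (.seq ht hnext) ht', ?_⟩
        · simp only [Test.Holds, NExpr.var, NExpr.eval, h0, f3, f1 1 hw, hs]
          omega
        · simp only [Test.cost, NExpr.var, NExpr.cost]
          rw [add_mul]
          omega
    obtain ⟨t, ht, hle⟩ := hloop n le_rfl
    have hinit : Exec W (.setN i (.const 0) (.const 0)) s 3 (iter W i p s (n - n)) := by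
      have := Exec.setN (W := W) i (.const 0) (.const 0) s
      simp only [NExpr.eval, NExpr.cost, h0] at this
      rw [Nat.sub_self]
      exact this
    have hrun : (rep i p).run W s = iter W i p s n := by
      simp only [run, iter, hs]
    rw [hrun]
    refine ⟨_, .seq hinit ht, ?_⟩
    simp only [weight, depth, pow_succ]
    have e0 : 1 ≤ n ^ p.depth := Nat.one_le_pow _ _ hn
    have e1 : n ≤ n ^ p.depth * n := Nat.le_mul_of_pos_left _ e0
    calc 3 + t ≤ n * (p.weight * n ^ p.depth + 12) + 9 := by omega
      _ = p.weight * (n ^ p.depth * n) + 12 * n + 9 := by ring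
      _ ≤ p.weight * (n ^ p.depth * n) + 12 * (n ^ p.depth * n) + 9 * (n ^ p.depth * n) := by
        omega
      _ = _ := by ring

end Code

/-- The entry of array `a` at the address in variable `i`. -/
def NExpr.at (a i : ℕ) : NExpr := .read a (.var i)

/-- The entry of the matrix `a` in the row in variable `i` and the column in variable `j`. -/
def NExpr.cell (a i j : ℕ) : NExpr := .read a (.add (.mul (.var i) (.var 1)) (.var j))

theorem NExpr.eval_zero (W : ℕ) (s : Store) : (NExpr.const 0).eval W s = 0 := Nat.zero_mod _

theorem NExpr.eval_one {W : ℕ} (hW : 1 < W) (s : Store) : (NExpr.const 1).eval W s = 1 :=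
  Nat.mod_eq_of_lt hW

theorem NExpr.eval_var (W : ℕ) (s : Store) (a : ℕ) : (NExpr.var a).eval W s = s.word a 0 := by
  simp [NExpr.var, NExpr.eval]

theorem NExpr.eval_at (W : ℕ) (s : Store) (a i : ℕ) :
    (NExpr.at a i).eval W s = s.word a (s.word i 0) := by
  simp [NExpr.at, NExpr.eval, NExpr.eval_var]

theorem mul_add_lt_mul {n x y : ℕ} (hx : x < n) (hy : y < n) : x * n + y < n * n := by
  have : (x + 1) * n ≤ n * n := Nat.mul_le_mul_right _ hx
  rw [add_mul] at this
  omega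

theorem mul_add_inj {n x y x' y' : ℕ} (hy : y < n) (hy' : y' < n)
    (h : x * n + y = x' * n + y') : x = x' ∧ y = y' := by
  have h1 : (x * n + y) / n = x := by
    rw [mul_comm, Nat.mul_add_div (by omega), Nat.div_eq_of_lt hy, add_zero]
  have h2 : (x' * n + y') / n = x' := by
    rw [mul_comm, Nat.mul_add_div (by omega), Nat.div_eq_of_lt hy', add_zero]
  have h3 : x = x' := by rw [← h1, ← h2, h]
  subst h3
  exact ⟨rfl, by omega⟩

/-- Since `n * n < W`, reduction modulo `W` has no effect on matrix addresses. -/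
theorem NExpr.eval_cell_addr {W n : ℕ} {s : Store} (hW : n * n < W) (hn : s.word 1 0 = n) {i j : ℕ}
    (hi : s.word i 0 < n) (hj : s.word j 0 < n) :
    (NExpr.add (.mul (.var i) (.var 1)) (.var j)).eval W s = s.word i 0 * n + s.word j 0 := by
  have := mul_add_lt_mul hi hj
  simp only [NExpr.eval, NExpr.eval_var, hn]
  rw [Nat.mod_eq_of_lt (a := s.word i 0 * n) (by omega), Nat.mod_eq_of_lt (by omega)]

theorem NExpr.eval_cell {W n : ℕ} {s : Store} (hW : n * n < W) (hn : s.word 1 0 = n) (a : ℕ)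
    {i j : ℕ} (hi : s.word i 0 < n) (hj : s.word j 0 < n) :
    (NExpr.cell a i j).eval W s = s.word a (s.word i 0 * n + s.word j 0) := by
  rw [NExpr.cell, NExpr.eval, NExpr.eval_cell_addr hW hn hi hj]

end Code

namespace Code

/-- Assignment to a scalar variable. -/
def assign (a : ℕ) (e : NExpr) : Code := .setN a (.const 0) e

theorem run_assign (W a : ℕ) (e : NExpr) (s : Store) :
    (assign a e).run W s = s.setWord a 0 (e.eval W s) := by
  simp [assign, run, NExpr.eval_zero]

theorem run_seq (W : ℕ) (p q : Code) (s : Store) : (seq p q).run W s = q.run W (p.run W s) := rfl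

theorem run_cond_pos {W : ℕ} {b : Test} {s : Store} (p q : Code) (h : b.Holds W s) :
    (cond b p q).run W s = p.run W s := if_pos h

theorem run_cond_neg {W : ℕ} {b : Test} {s : Store} (p q : Code) (h : ¬ b.Holds W s) :
    (cond b p q).run W s = q.run W s := if_neg h

theorem run_nop (W : ℕ) (s : Store) : nop.run W s = s := rfl

/-- A loop whose body clears the flag `f` unless a condition holds checks this condition for all
values of the loop variable. -/
theorem run_rep_flag {W i f n : ℕ} {p : Code} {s : Store} (hn : s.word 1 0 = n) (hif : f ≠ i)
    (P : ℕ → Prop)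
    (hp : ∀ k < n, ∀ s', (∀ a, a ∉ (rep i p).writes → s'.word a = s.word a) → s'.word i 0 = k →
      ((p.run W s').word f 0 = 1 ↔ s'.word f 0 = 1 ∧ P k)) :
    ((rep i p).run W s).word f 0 = 1 ↔ s.word f 0 = 1 ∧ ∀ k < n, P k := by
  refine run_rep hn (fun m s' => s'.word f 0 = 1 ↔ s.word f 0 = 1 ∧ ∀ k < m, P k) ?_ ?_ ?_
  · simp [Store.setWord_word_of_ne _ _ _ hif]
  · intro k s x h
    rwa [Store.setWord_word_of_ne _ _ _ hif]
  · intro k hk s' hf _ hi h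
    rw [hp k hk s' hf hi, h, and_assoc]
    refine and_congr_right fun _ => ⟨fun h l hl => ?_, fun h => ⟨fun l hl => h l (by omega),
      h k (by omega)⟩⟩
    rcases Nat.lt_succ_iff_lt_or_eq.1 hl with h' | rfl
    · exact h.1 l h'
    · exact h.2

theorem run_clear_flag {W f : ℕ} {b : Test} {s : Store} {P : Prop} (hb : b.Holds W s ↔ ¬ P) :
    ((cond b (assign f (.const 0)) nop).run W s).word f 0 = 1 ↔ s.word f 0 = 1 ∧ P := by
  by_cases h : b.Holds W s
  · rw [run_cond_pos _ _ h, run_assign, Store.setWord_word_self, NExpr.eval_zero]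
    simp [hb.1 h]
  · rw [run_cond_neg _ _ h, run_nop]
    have : P := by
      by_contra hP
      exact h (hb.2 hP)
    simp [this]

end Code

/-- Disjunction of tests. -/
def Test.disj (b d : Test) : Test := .neg (.conj (.neg b) (.neg d))

theorem Test.holds_disj (W : ℕ) (s : Store) (b d : Test) :
    (b.disj d).Holds W s ↔ b.Holds W s ∨ d.Holds W s := by
  simp only [Test.disj, Test.Holds]; tauto

open Code

/-! ### Program: finding a simplicial vertex -/

section Simplicial

/-- Is the vertex in variable `3` simplicial?  The answer is put into variable `6`. -/
def simplicialTest : Code :=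
  rep 4 (rep 5 (cond (.conj (.conj (.eqN (.cell 0 3 4) (.const 1)) (.eqN (.cell 0 3 5) (.const 1)))
    (.conj (.neg (.eqN (.var 4) (.var 5))) (.neg (.eqN (.cell 0 4 5) (.const 1)))))
    (assign 6 (.const 0)) nop))

/-- Put a simplicial vertex into variable `7`. -/
def simplicialCode : Code :=
  rep 3 (seq (assign 6 (.const 1)) (seq simplicialTest
    (cond (.eqN (.var 6) (.const 1)) (assign 7 (.var 3)) nop)))

theorem run_simplicialTest {W n : ℕ} {s : Store} (hW : n * n < W) (hW1 : 1 < W)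
    (hn : s.word 1 0 = n) (hr : s.word 3 0 < n) :
    (simplicialTest.run W s).word 6 0 = 1 ↔ s.word 6 0 = 1 ∧ ∀ a < n, ∀ b < n,
      s.word 0 (s.word 3 0 * n + a) = 1 → s.word 0 (s.word 3 0 * n + b) = 1 → a ≠ b →
        s.word 0 (a * n + b) = 1 := by
  refine run_rep_flag hn (by decide) _ fun a ha s' hf ha' => ?_
  have h0 := hf 0 (by decide)
  have h1 := hf 1 (by decide)
  have h3 := hf 3 (by decide)
  refine run_rep_flag (by rw [h1, hn]) (by decide) _ fun b hb s'' hf' hb' => ?_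
  have h0' := hf' 0 (by decide)
  have h1' := hf' 1 (by decide)
  have h3' := hf' 3 (by decide)
  have h4' := hf' 4 (by decide)
  refine run_clear_flag ?_
  have e1 : s''.word 1 0 = n := by rw [h1', h1, hn]
  have e3 : s''.word 3 0 < n := by rw [h3', h3]; exact hr
  have e4 : s''.word 4 0 < n := by rw [h4', ha']; exact ha
  have e5 : s''.word 5 0 < n := by rw [hb']; exact hb
  simp only [Test.Holds, NExpr.eval_one hW1, NExpr.eval_var, NExpr.eval_cell hW e1 0 e3 e4,
    NExpr.eval_cell hW e1 0 e3 e5, NExpr.eval_cell hW e1 0 e4 e5]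
  rw [h0', h0, h3', h3, h4', ha', hb']
  tauto

/-- Variable `7` is overwritten at every simplicial vertex and ends up with the last one. -/
theorem run_simplicialCode {W n : ℕ} {s : Store} (hW : n * n < W) (hW1 : 1 < W)
    (hn : s.word 1 0 = n) {Q : ℕ → Prop} (hQ : ∀ r < n, (Q r ↔ ∀ a < n, ∀ b < n,
      s.word 0 (r * n + a) = 1 → s.word 0 (r * n + b) = 1 → a ≠ b → s.word 0 (a * n + b) = 1))
    (hex : ∃ r < n, Q r) :
    (simplicialCode.run W s).word 7 0 < n ∧ Q ((simplicialCode.run W s).word 7 0) := by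
  refine run_rep hn (fun k s' => (∃ r < k, Q r) → s'.word 7 0 < n ∧ Q (s'.word 7 0)) ?_ ?_ ?_ hex
  · rintro ⟨r, hr, _⟩
    omega
  · intro k s x h
    rwa [Store.setWord_word_of_ne _ _ _ (by decide)]
  · intro k hk s' hf _ hi h
    have h0 := hf 0 (by decide)
    have h1 := hf 1 (by decide)
    rw [run_seq, run_seq, run_assign, NExpr.eval_one hW1]
    set s₁ := s'.setWord 6 0 1 with hs₁
    have g : ∀ a, a ≠ 6 → s₁.word a = s'.word a := fun a ha => Store.setWord_word_of_ne _ _ _ ha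
    have g6 : s₁.word 6 0 = 1 := by rw [hs₁, Store.setWord_word_self]; simp
    have ht := run_simplicialTest (W := W) (n := n) (s := s₁) hW hW1
      (by rw [g 1 (by decide), h1, hn]) (by rw [g 3 (by decide), hi]; exact hk)
    set s₂ := simplicialTest.run W s₁ with hs₂
    have f : ∀ a, a ∉ simplicialTest.writes → s₂.word a = s₁.word a := run_word _ _ _
    have e3 : s₂.word 3 0 = k := by rw [f 3 (by decide), g 3 (by decide), hi]
    rw [g6, g 0 (by decide), g 3 (by decide), hi, h0, ← hQ k hk] at ht
    by_cases hq : Q k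
    · rw [run_cond_pos]
      · rw [run_assign, Store.setWord_word_self, NExpr.eval_var, e3]
        simpa using fun _ _ _ => ⟨hk, hq⟩
      · simp only [Test.Holds, NExpr.eval_one hW1, NExpr.eval_var]
        exact ht.2 ⟨rfl, hq⟩
    · rw [run_cond_neg, run_nop, f 7 (by decide), g 7 (by decide)]
      · rintro ⟨r, hr, hrQ⟩
        refine h ⟨r, ?_, hrQ⟩
        have : r ≠ k := fun h => hq (h ▸ hrQ)
        omega
      · simp only [Test.Holds, NExpr.eval_one hW1, NExpr.eval_var]
        exact fun h => hq (ht.1 h).2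

end Simplicial

/-! ### Program: computing the separating sets by graph search -/

section Search

/-- The vertices reached from `r` avoiding `v` and its neighbors, with adjacency matrix `A`. -/
def Reach (A : ℕ → ℕ) (n r v u : ℕ) : Prop :=
  Relation.ReflTransGen (fun a b => A (a * n + b) = 1 ∧ b < n ∧ b ≠ v ∧ A (v * n + b) ≠ 1) r u

/-- Membership of `w` in the set separating `v` from `r`, with adjacency matrix `A`. -/
def SepRow (A : ℕ → ℕ) (n r v w : ℕ) : Prop :=
  v ≠ r → A (v * n + r) ≠ 1 → A (v * n + w) = 1 ∧ ∃ u < n, Reach A n r v u ∧ A (u * n + w) = 1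

/-- The address of the entry of a matrix in the row in variable `i` and the column in variable
`j`. -/
def NExpr.cellAddr (i j : ℕ) : NExpr := .add (.mul (.var i) (.var 1)) (.var j)

/-- Visit the neighbors of the vertex in variable `12`. -/
def visitCode : Code :=
  rep 5 (cond (.eqN (.cell 0 12 5) (.const 1))
    (cond (.eqN (.cell 0 3 5) (.const 1)) (.setN 8 (.cellAddr 3 5) (.const 1))
      (.setN 9 (.var 5) (.const 1))) nop)

/-- Put a marked vertex that has not been visited into variable `12`, if there is one; variable `11`
tells whether this is the case. -/
def pickCode : Code :=
  seq (assign 11 (.const 0)) (rep 4 (cond (.conj (.eqN (.at 9 4) (.const 1))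
    (.neg (.eqN (.at 10 4) (.const 1)))) (seq (assign 11 (.const 1)) (assign 12 (.var 4))) nop))

/-- Pick a vertex and visit its neighbors. -/
def searchStep : Code :=
  seq pickCode (cond (.eqN (.var 11) (.const 1))
    (seq (.setN 10 (.var 12) (.const 1)) visitCode) nop)

/-- Unmark all vertices, and then mark the vertex in variable `7`. -/
def resetCode : Code :=
  seq (rep 5 (seq (.setN 9 (.var 5) (.const 0)) (.setN 10 (.var 5) (.const 0))))
    (.setN 9 (.var 7) (.const 1))

/-- Compute the row for the vertex in variable `3` of the matrix `8` of separating sets. -/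
def rowCode : Code :=
  cond (.conj (.neg (.eqN (.var 3) (.var 7))) (.neg (.eqN (.cell 0 3 7) (.const 1))))
    (seq resetCode (rep 13 searchStep))
    (rep 5 (.setN 8 (.cellAddr 3 5) (.const 1)))

/-- Compute the matrix `8` of separating sets. -/
def sepCode : Code := rep 3 rowCode

variable {W n : ℕ} {s : Store} {A : ℕ → ℕ}

/-- A neighbor of `u` that is also a neighbor of `v` belongs to the separating set and is entered
into row `v`; any other one is marked. So the search does not enter the neighborhood of `v`. -/
theorem run_visitCode (hW : n * n < W) (hW1 : 1 < W) (hn : s.word 1 0 = n) (hA : s.word 0 = A)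
    {u v : ℕ} (hu : s.word 12 0 = u) (hun : u < n) (hv : s.word 3 0 = v) (hvn : v < n) :
    (∀ x < n, (visitCode.run W s).word 9 x = 1 ↔
      s.word 9 x = 1 ∨ x < n ∧ A (u * n + x) = 1 ∧ A (v * n + x) ≠ 1) ∧
    (∀ x < n, (visitCode.run W s).word 8 (v * n + x) = 1 ↔
      s.word 8 (v * n + x) = 1 ∨ x < n ∧ A (u * n + x) = 1 ∧ A (v * n + x) = 1) ∧
    ∀ y < n, y ≠ v → ∀ x < n,
      (visitCode.run W s).word 8 (y * n + x) = s.word 8 (y * n + x) := by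
  refine run_rep hn (fun k s' =>
    (∀ x < n, s'.word 9 x = 1 ↔
      s.word 9 x = 1 ∨ x < k ∧ A (u * n + x) = 1 ∧ A (v * n + x) ≠ 1) ∧
    (∀ x < n, s'.word 8 (v * n + x) = 1 ↔
      s.word 8 (v * n + x) = 1 ∨ x < k ∧ A (u * n + x) = 1 ∧ A (v * n + x) = 1) ∧
    ∀ y < n, y ≠ v → ∀ x < n, s'.word 8 (y * n + x) = s.word 8 (y * n + x)) ?_ ?_ ?_
  · rw [Store.setWord_word_of_ne _ _ _ (by decide), Store.setWord_word_of_ne _ _ _ (by decide)]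
    simp
  · intro k s' x h
    rwa [Store.setWord_word_of_ne _ _ _ (by decide), Store.setWord_word_of_ne _ _ _ (by decide)]
  · rintro k hk s' hf _ hi ⟨h1, h2, h3⟩
    have e0 := (hf 0 (by decide)).trans hA
    have e1 : s'.word 1 0 = n := by rw [hf 1 (by decide), hn]
    have e3 : s'.word 3 0 = v := by rw [hf 3 (by decide), hv]
    have e12 : s'.word 12 0 = u := by rw [hf 12 (by decide), hu]
    have lt3 : s'.word 3 0 < n := by omega
    have lt5 : s'.word 5 0 < n := by omega
    have lt12 : s'.word 12 0 < n := by omega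
    have t1 : (Test.eqN (.cell 0 12 5) (.const 1)).Holds W s' ↔ A (u * n + k) = 1 := by
      simp only [Test.Holds, NExpr.eval_one hW1, NExpr.eval_cell hW e1 0 lt12 lt5, e0, e12, hi]
    have t2 : (Test.eqN (.cell 0 3 5) (.const 1)).Holds W s' ↔ A (v * n + k) = 1 := by
      simp only [Test.Holds, NExpr.eval_one hW1, NExpr.eval_cell hW e1 0 lt3 lt5, e0, e3, hi]
    have step : ∀ {p : ℕ → Prop} {x : ℕ}, (x < k + 1 ∧ p x ↔ x < k ∧ p x ∨ x = k ∧ p k) := by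
      intro p x
      constructor
      · rintro ⟨h, hp⟩
        rcases Nat.lt_succ_iff_lt_or_eq.1 h with h | rfl
        · exact Or.inl ⟨h, hp⟩
        · exact Or.inr ⟨rfl, hp⟩
      · rintro (⟨h, hp⟩ | ⟨rfl, hp⟩)
        · exact ⟨by omega, hp⟩
        · exact ⟨by omega, hp⟩
    have st1 := fun x => step (p := fun x => A (u * n + x) = 1 ∧ A (v * n + x) ≠ 1) (x := x)
    have st2 := fun x => step (p := fun x => A (u * n + x) = 1 ∧ A (v * n + x) = 1) (x := x)
    simp only [st1, st2, ← or_assoc]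
    by_cases c1 : A (u * n + k) = 1
    · rw [run_cond_pos _ _ (t1.2 c1)]
      by_cases c2 : A (v * n + k) = 1
      · rw [run_cond_pos _ _ (t2.2 c2)]
        simp only [run, NExpr.cellAddr, NExpr.eval_cell_addr hW e1 lt3 lt5, NExpr.eval_one hW1, e3,
          hi, Store.setWord_word_self]
        rw [Store.setWord_word_of_ne _ _ _ (by decide)]
        refine ⟨fun x hx => by simp [h1 x hx, c1, c2], fun x hx => ?_, fun y hy hyv x hx => ?_⟩
        · by_cases hxk : x = k
          · simp [hxk, c1, c2]
          · rw [Function.update_of_ne (by omega), h2 x hx]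
            simp [hxk]
        · rw [Function.update_of_ne, h3 y hy hyv x hx]
          exact fun h => hyv (mul_add_inj hx hk h).1
      · rw [run_cond_neg _ _ (fun h => c2 (t2.1 h))]
        simp only [run, NExpr.eval_one hW1, NExpr.eval_var, hi, Store.setWord_word_self]
        rw [Store.setWord_word_of_ne _ _ _ (by decide)]
        refine ⟨fun x hx => ?_, fun x hx => by simp [h2 x hx, c1, c2], h3⟩
        by_cases hxk : x = k
        · simp [hxk, c1, c2]
        · rw [Function.update_of_ne hxk, h1 x hx]
          simp [hxk]
    · rw [run_cond_neg _ _ (fun h => c1 (t1.1 h)), run_nop]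
      exact ⟨fun x hx => by simp [h1 x hx, c1], fun x hx => by simp [h2 x hx, c1], h3⟩

theorem run_pickCode (hW1 : 1 < W) (hn : s.word 1 0 = n) :
    ((pickCode.run W s).word 11 0 = 1 ∧ (pickCode.run W s).word 12 0 < n ∧
      s.word 9 ((pickCode.run W s).word 12 0) = 1 ∧ s.word 10 ((pickCode.run W s).word 12 0) ≠ 1) ∨
    ((pickCode.run W s).word 11 0 ≠ 1 ∧ ∀ x < n, s.word 9 x = 1 → s.word 10 x = 1) := by
  rw [pickCode, run_seq, run_assign, NExpr.eval_zero]
  refine run_rep (n := n) (by rw [Store.setWord_word_of_ne _ _ _ (by decide), hn]) (fun k s' =>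
    (s'.word 11 0 = 1 ∧ s'.word 12 0 < n ∧
      s.word 9 (s'.word 12 0) = 1 ∧ s.word 10 (s'.word 12 0) ≠ 1) ∨
    (s'.word 11 0 ≠ 1 ∧ ∀ x < k, s.word 9 x = 1 → s.word 10 x = 1)) ?_ ?_ ?_
  · right
    rw [Store.setWord_word_of_ne _ _ _ (by decide), Store.setWord_word_self]
    simp
  · intro k s' x h
    rwa [Store.setWord_word_of_ne _ _ _ (by decide), Store.setWord_word_of_ne _ _ _ (by decide)]
  · intro k hk s' hf _ hi h
    have e9 : s'.word 9 = s.word 9 := by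
      rw [hf 9 (by decide), Store.setWord_word_of_ne _ _ _ (by decide)]
    have e10 : s'.word 10 = s.word 10 := by
      rw [hf 10 (by decide), Store.setWord_word_of_ne _ _ _ (by decide)]
    have t : (Test.conj (.eqN (.at 9 4) (.const 1)) (.neg (.eqN (.at 10 4) (.const 1)))).Holds W s' ↔
        s.word 9 k = 1 ∧ s.word 10 k ≠ 1 := by
      simp only [Test.Holds, NExpr.eval_one hW1, NExpr.eval_at, e9, e10, hi, ne_eq]
    by_cases c : s.word 9 k = 1 ∧ s.word 10 k ≠ 1
    · rw [run_cond_pos _ _ (t.2 c), run_seq, run_assign, run_assign, NExpr.eval_one hW1,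
        NExpr.eval_var]
      left
      simpa [Store.setWord_word, hi] using ⟨hk, c⟩
    · rw [run_cond_neg _ _ (fun h => c (t.1 h)), run_nop]
      refine h.imp id fun h => ⟨h.1, fun x hx => ?_⟩
      rcases Nat.lt_succ_iff_lt_or_eq.1 hx with h' | rfl
      · exact h.2 x h'
      · intro h9
        by_contra h10
        exact c ⟨h9, h10⟩

/-- The invariant of the search for the vertex `v`; `s₀` is the store at its beginning. -/
structure SearchInv (A : ℕ → ℕ) (n r v : ℕ) (s₀ : Store) (k : ℕ) (s : Store) : Prop where
  mark_reach : ∀ x < n, s.word 9 x = 1 → Reach A n r v x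
  done_mark : ∀ x < n, s.word 10 x = 1 → s.word 9 x = 1
  done_sep : ∀ x < n, s.word 10 x = 1 → ∀ w < n, A (x * n + w) = 1 → A (v * n + w) = 1 →
    s.word 8 (v * n + w) = 1
  done_next : ∀ x < n, s.word 10 x = 1 → ∀ w < n, A (x * n + w) = 1 → A (v * n + w) ≠ 1 →
    s.word 9 w = 1
  sep : ∀ w < n, s.word 8 (v * n + w) = 1 →
    A (v * n + w) = 1 ∧ ∃ u < n, Reach A n r v u ∧ A (u * n + w) = 1
  root : s.word 9 r = 1
  -- Either nothing is left to pick and further steps change nothing, or every step so far has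
  -- finished a new vertex; so `n` steps are enough.
  progress : (∀ x < n, s.word 9 x = 1 → s.word 10 x = 1) ∨
    k ≤ ((Finset.range n).filter fun x => s.word 10 x = 1).card
  other : ∀ y < n, y ≠ v → ∀ x < n, s.word 8 (y * n + x) = s₀.word 8 (y * n + x)

/-- This keeps `v` itself from being marked: it is not adjacent to any vertex reached. -/
theorem Reach.not_adj {r v u : ℕ} (h : Reach A n r v u) (hr : A (v * n + r) ≠ 1) :
    A (v * n + u) ≠ 1 := by
  cases h with
  | refl => exact hr
  | tail _ h => exact h.2.2.2

theorem run_searchStep (hW : n * n < W) (hW1 : 1 < W) (hn : s.word 1 0 = n) (hA : s.word 0 = A)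
    (hsymm : ∀ x < n, ∀ y < n, A (x * n + y) = 1 → A (y * n + x) = 1)
    {r v : ℕ} (hv : s.word 3 0 = v) (hvn : v < n) (hrn : r < n)
    (hvr : A (v * n + r) ≠ 1) {s₀ : Store} {k : ℕ} (h : SearchInv A n r v s₀ k s) :
    SearchInv A n r v s₀ (k + 1) (searchStep.run W s) := by
  have hpick := run_pickCode (W := W) hW1 hn
  rw [searchStep, run_seq]
  have hf : ∀ a, a ∉ pickCode.writes → (pickCode.run W s).word a = s.word a := run_word _ _ _
  set s₁ := pickCode.run W s with hs₁
  have f8 := hf 8 (by decide)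
  have f9 := hf 9 (by decide)
  have f10 := hf 10 (by decide)
  have t : (Test.eqN (.var 11) (.const 1)).Holds W s₁ ↔ s₁.word 11 0 = 1 := by
    simp only [Test.Holds, NExpr.eval_one hW1, NExpr.eval_var]
  rcases hpick with ⟨h11, hun, hum, hud⟩ | ⟨h11, hall⟩
  · rw [run_cond_pos _ _ (t.2 h11), run_seq]
    set u := s₁.word 12 0 with hu
    have hset : (Code.setN 10 (.var 12) (.const 1)).run W s₁ = s₁.setWord 10 u 1 := by
      simp only [run, NExpr.eval_one hW1, NExpr.eval_var]
      rfl
    rw [hset]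
    set s₂ := s₁.setWord 10 u 1 with hs₂
    have g : ∀ a, a ≠ 10 → s₂.word a = s₁.word a := fun a ha => Store.setWord_word_of_ne _ _ _ ha
    have g10 : s₂.word 10 = Function.update (s.word 10) u 1 := by
      rw [hs₂, Store.setWord_word_self, f10]
    obtain ⟨v9, v8, vo⟩ := run_visitCode (W := W) (s := s₂) (A := A) (u := u) (v := v) hW hW1
      (by rw [g 1 (by decide), hf 1 (by decide), hn])
      (by rw [g 0 (by decide), hf 0 (by decide), hA])
      (by rw [g 12 (by decide)]) hun (by rw [g 3 (by decide), hf 3 (by decide), hv]) hvn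
    rw [g 9 (by decide), f9] at v9
    rw [g 8 (by decide), f8] at v8 vo
    have f10' : (visitCode.run W s₂).word 10 = Function.update (s.word 10) u 1 := by
      rw [run_word _ _ _ _ (by decide), g10]
    set s₃ := visitCode.run W s₂ with hs₃
    have hureach := h.mark_reach u hun hum
    have hdone : ∀ x, s₃.word 10 x = 1 ↔ x = u ∨ s.word 10 x = 1 := by
      intro x
      rw [f10']
      by_cases hx : x = u
      · simp [hx]
      · simp [hx]
    constructor
    · intro x hx hmx
      rcases (v9 x hx).1 hmx with h1 | ⟨_, h1, h2⟩
      · exact h.mark_reach x hx h1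
      · refine Relation.ReflTransGen.tail hureach ⟨h1, hx, ?_, h2⟩
        rintro rfl
        exact hureach.not_adj hvr (hsymm _ hun _ hx h1)
    · intro x hx hdx
      rw [v9 x hx]
      rcases (hdone x).1 hdx with rfl | h1
      · exact Or.inl hum
      · exact Or.inl (h.done_mark x hx h1)
    · intro x hx hdx w hw h1 h2
      rw [v8 w hw]
      rcases (hdone x).1 hdx with rfl | h3
      · exact Or.inr ⟨hw, h1, h2⟩
      · exact Or.inl (h.done_sep x hx h3 w hw h1 h2)
    · intro x hx hdx w hw h1 h2
      rw [v9 w hw]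
      rcases (hdone x).1 hdx with rfl | h3
      · exact Or.inr ⟨hw, h1, h2⟩
      · exact Or.inl (h.done_next x hx h3 w hw h1 h2)
    · intro w hw hsw
      rcases (v8 w hw).1 hsw with h1 | ⟨_, h1, h2⟩
      · exact h.sep w hw h1
      · exact ⟨h2, u, hun, hureach, h1⟩
    · exact (v9 r hrn).2 (Or.inl h.root)
    · right
      rcases h.progress with h1 | h1
      · exact absurd (h1 u hun hum) hud
      · refine lt_of_le_of_lt h1 (Finset.card_lt_card
          (Finset.ssubset_iff_subset_ne.2 ⟨fun x hx => ?_, fun he => ?_⟩))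
        · rw [Finset.mem_filter] at hx ⊢
          exact ⟨hx.1, (hdone x).2 (Or.inr hx.2)⟩
        · have : u ∈ (Finset.range n).filter fun x => s.word 10 x = 1 := by
            rw [he]
            exact Finset.mem_filter.2 ⟨Finset.mem_range.2 hun, (hdone u).2 (Or.inl rfl)⟩
          exact hud (Finset.mem_filter.1 this).2
    · intro y hy hyv x hx
      rw [vo y hy hyv x hx]
      exact h.other y hy hyv x hx
  · rw [run_cond_neg _ _ (fun h => h11 (t.1 h)), run_nop]
    constructor
    · rw [f9]; exact h.mark_reach
    · rw [f9, f10]; exact h.done_mark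
    · rw [f8, f10]; exact h.done_sep
    · rw [f9, f10]; exact h.done_next
    · rw [f8]; exact h.sep
    · rw [f9]; exact h.root
    · rw [f9, f10]; exact Or.inl hall
    · rw [f8]; exact h.other

theorem run_resetCode (hW1 : 1 < W) (hn : s.word 1 0 = n) {r : ℕ} (hr : s.word 7 0 = r) :
    (∀ x < n, (resetCode.run W s).word 9 x = 1 ↔ x = r) ∧
      ∀ x < n, (resetCode.run W s).word 10 x ≠ 1 := by
  rw [resetCode, run_seq]
  have hloop := run_rep (W := W) (i := 5) (s := s) hn
    (p := seq (.setN 9 (.var 5) (.const 0)) (.setN 10 (.var 5) (.const 0)))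
    (fun k s' => (∀ x < k, s'.word 9 x = 0) ∧ ∀ x < k, s'.word 10 x = 0) (by simp)
    (by
      intro k s' x h
      rwa [Store.setWord_word_of_ne _ _ _ (by decide), Store.setWord_word_of_ne _ _ _ (by decide)])
    (by
      rintro k hk s' hf _ hi ⟨h1, h2⟩
      have e : (seq (.setN 9 (.var 5) (.const 0)) (.setN 10 (.var 5) (.const 0))).run W s' =
          (s'.setWord 9 k 0).setWord 10 k 0 := by
        simp [run, NExpr.eval_zero, NExpr.eval_var, Store.setWord_word, hi]
      rw [e, Store.setWord_word_of_ne (a := 10) (b := 9) _ _ _ (by decide),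
        Store.setWord_word_self, Store.setWord_word_self,
        Store.setWord_word_of_ne (a := 9) (b := 10) _ _ _ (by decide)]
      constructor
      · intro x hx
        by_cases hxk : x = k
        · simp [hxk]
        · simpa [hxk] using h1 x (by omega)
      · intro x hx
        by_cases hxk : x = k
        · simp [hxk]
        · simpa [hxk] using h2 x (by omega))
  have h7 : ((rep 5 (seq (.setN 9 (.var 5) (.const 0)) (.setN 10 (.var 5) (.const 0)))).run W
      s).word 7 = s.word 7 := run_word _ _ _ _ (by decide)
  set s₁ := (rep 5 (seq (.setN 9 (.var 5) (.const 0)) (.setN 10 (.var 5) (.const 0)))).run W s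
  simp only [run, NExpr.eval_one hW1, NExpr.eval_var, Store.setWord_word_self, h7, hr]
  rw [Store.setWord_word_of_ne _ _ _ (by decide)]
  constructor
  · intro x hx
    by_cases hxr : x = r
    · simp [hxr]
    · simp [hxr, hloop.1 x hx]
  · intro x hx
    rw [hloop.2 x hx]
    omega

/-- The search only enters ones, so row `v` has to be zero beforehand. At the end all marked
vertices are finished, and hence everything reachable is marked. -/
theorem run_rowCode (hW : n * n < W) (hW1 : 1 < W) (hn : s.word 1 0 = n) (hA : s.word 0 = A)
    (hsymm : ∀ x < n, ∀ y < n, A (x * n + y) = 1 → A (y * n + x) = 1)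
    {r v : ℕ} (hv : s.word 3 0 = v) (hvn : v < n) (hr : s.word 7 0 = r) (hrn : r < n)
    (hrow : ∀ w < n, s.word 8 (v * n + w) = 0) :
    (∀ w < n, (rowCode.run W s).word 8 (v * n + w) = 1 ↔ SepRow A n r v w) ∧
      ∀ y < n, y ≠ v → ∀ x < n, (rowCode.run W s).word 8 (y * n + x) = s.word 8 (y * n + x) := by
  have lt3 : s.word 3 0 < n := by omega
  have lt7 : s.word 7 0 < n := by omega
  have t : (Test.conj (.neg (.eqN (.var 3) (.var 7)))
      (.neg (.eqN (.cell 0 3 7) (.const 1)))).Holds W s ↔ v ≠ r ∧ A (v * n + r) ≠ 1 := by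
    simp only [Test.Holds, NExpr.eval_one hW1, NExpr.eval_var, NExpr.eval_cell hW hn 0 lt3 lt7, hA,
      hv, hr, ne_eq]
  by_cases c : v ≠ r ∧ A (v * n + r) ≠ 1
  · rw [rowCode, run_cond_pos _ _ (t.2 c), run_seq]
    obtain ⟨r9, r10⟩ := run_resetCode (W := W) hW1 hn hr
    have g : ∀ a, a ∉ resetCode.writes → (resetCode.run W s).word a = s.word a := run_word _ _ _
    set s₁ := resetCode.run W s
    have g8 := g 8 (by decide)
    have hinv : SearchInv A n r v s n ((rep 13 searchStep).run W s₁) := by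
      refine run_rep (n := n) (by rw [g 1 (by decide), hn]) (SearchInv A n r v s) ?_ ?_ ?_
      · constructor <;> repeat rw [Store.setWord_word_of_ne _ _ _ (by decide)]
        · intro x hx h
          rw [(r9 x hx).1 h]
          exact Relation.ReflTransGen.refl
        · exact fun x hx h => absurd h (r10 x hx)
        · exact fun x hx h => absurd h (r10 x hx)
        · exact fun x hx h => absurd h (r10 x hx)
        · intro w hw h
          rw [g8, hrow w hw] at h
          exact absurd h (by omega)
        · exact (r9 r hrn).2 rfl
        · exact Or.inr (Nat.zero_le _)
        · intro y hy hyv x hx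
          rw [g8]
      · intro k s' x h
        constructor <;> repeat rw [Store.setWord_word_of_ne _ _ _ (by decide)]
        exacts [h.mark_reach, h.done_mark, h.done_sep, h.done_next, h.sep, h.root, h.progress,
          h.other]
      · intro k hk s' hf _ _ h
        exact run_searchStep hW hW1 (by rw [hf 1 (by decide), g 1 (by decide), hn])
          (by rw [hf 0 (by decide), g 0 (by decide), hA]) hsymm
          (by rw [hf 3 (by decide), g 3 (by decide), hv]) hvn hrn c.2 h
    set s₂ := (rep 13 searchStep).run W s₁
    refine ⟨fun w hw => ⟨fun h _ _ => hinv.sep w hw h, fun h => ?_⟩, hinv.other⟩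
    have hall : ∀ x < n, s₂.word 9 x = 1 → s₂.word 10 x = 1 := by
      rcases hinv.progress with h1 | h1
      · exact h1
      · intro x hx _
        have : (Finset.range n).filter (fun x => s₂.word 10 x = 1) = Finset.range n :=
          Finset.eq_of_subset_of_card_le (Finset.filter_subset _ _) (by rwa [Finset.card_range])
        have hx' := Finset.mem_range.2 hx
        rw [← this] at hx'
        exact (Finset.mem_filter.1 hx').2
    have hreach : ∀ u, Reach A n r v u → u < n ∧ s₂.word 9 u = 1 := by
      intro u hu
      induction hu with
      | refl => exact ⟨hrn, hinv.root⟩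
      | tail _ h ih =>
        exact ⟨h.2.1, hinv.done_next _ ih.1 (hall _ ih.1 ih.2) _ h.2.1 h.1 h.2.2.2⟩
    obtain ⟨h1, u, hun, hu, h2⟩ := h c.1 c.2
    exact hinv.done_sep u hun (hall u hun (hreach u hu).2) w hw h2 h1
  · rw [rowCode, run_cond_neg _ _ (fun h => c (t.1 h))]
    have hs : ∀ w, SepRow A n r v w := fun w h1 h2 => absurd ⟨h1, h2⟩ c
    simp only [hs, iff_true]
    refine run_rep hn (fun k s' => (∀ w < k, s'.word 8 (v * n + w) = 1) ∧
      ∀ y < n, y ≠ v → ∀ x < n, s'.word 8 (y * n + x) = s.word 8 (y * n + x)) ?_ ?_ ?_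
    · rw [Store.setWord_word_of_ne _ _ _ (by decide)]
      simp
    · intro k s' x h
      rwa [Store.setWord_word_of_ne _ _ _ (by decide)]
    · rintro k hk s' hf _ hi ⟨h1, h2⟩
      have e1 : s'.word 1 0 = n := by rw [hf 1 (by decide), hn]
      have e3 : s'.word 3 0 = v := by rw [hf 3 (by decide), hv]
      simp only [run, NExpr.cellAddr, NExpr.eval_one hW1, Store.setWord_word_self,
        NExpr.eval_cell_addr hW e1 (show s'.word 3 0 < n by omega) (show s'.word 5 0 < n by omega),
        e3, hi]
      constructor
      · intro w hw
        by_cases hwk : w = k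
        · simp [hwk]
        · rw [Function.update_of_ne (by omega), h1 w (by omega)]
      · intro y hy hyv x hx
        rw [Function.update_of_ne, h2 y hy hyv x hx]
        exact fun h => hyv (mul_add_inj hx hk h).1

theorem run_sepCode (hW : n * n < W) (hW1 : 1 < W) (hn : s.word 1 0 = n) (hA : s.word 0 = A)
    (hsymm : ∀ x < n, ∀ y < n, A (x * n + y) = 1 → A (y * n + x) = 1)
    {r : ℕ} (hr : s.word 7 0 = r) (hrn : r < n) (h8 : ∀ x, s.word 8 x = 0) :
    ∀ v < n, ∀ w < n, (sepCode.run W s).word 8 (v * n + w) = 1 ↔ SepRow A n r v w := by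
  have := run_rep (W := W) (i := 3) (p := rowCode) hn (fun k s' =>
    (∀ v < k, ∀ w < n, s'.word 8 (v * n + w) = 1 ↔ SepRow A n r v w) ∧
      ∀ v < n, k ≤ v → ∀ w < n, s'.word 8 (v * n + w) = 0) ?_ ?_ ?_
  · exact this.1
  · rw [Store.setWord_word_of_ne _ _ _ (by decide)]
    simp [h8]
  · intro k s' x h
    rwa [Store.setWord_word_of_ne _ _ _ (by decide)]
  · rintro k hk s' hf _ hi ⟨h1, h2⟩
    obtain ⟨h3, h4⟩ := run_rowCode (W := W) (s := s') (A := A) (r := r) (v := k) hW hW1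
      (by rw [hf 1 (by decide), hn]) (by rw [hf 0 (by decide), hA]) hsymm hi hk
      (by rw [hf 7 (by decide), hr]) hrn (h2 k hk le_rfl)
    constructor
    · intro v hv w hw
      by_cases hvk : v = k
      · rw [hvk]; exact h3 w hw
      · rw [h4 v (by omega) hvk w hw]
        exact h1 v (by omega) w hw
    · intro v hv hkv w hw
      rw [h4 v hv (by omega) w hw]
      exact h2 v hv (by omega) w hw

end Search

/-! ### Program: selecting minimal rows and sorting them -/

section Lists

/-- Compute the sizes of the rows of the matrix `8`. -/
def sizeCode : Code :=
  rep 3 (seq (.setN 14 (.var 3) (.const 0))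
    (rep 5 (cond (.eqN (.cell 8 3 5) (.const 1))
      (.setN 14 (.var 3) (.add (.at 14 3) (.const 1))) nop)))

/-- Clear variable `11` unless row `4` of the matrix `8` is contained in row `3`. -/
def subsetCode : Code :=
  rep 5 (cond (.conj (.eqN (.cell 8 4 5) (.const 1)) (.neg (.eqN (.cell 8 3 5) (.const 1))))
    (assign 11 (.const 0)) nop)

/-- Clear variable `6` if row `4` of the matrix `8` is a proper subset of row `3`, or equal to it and
of smaller index. -/
def compareCode : Code :=
  seq (assign 11 (.const 1)) (seq subsetCode
    (cond (.conj (.eqN (.var 11) (.const 1)) (.disj (.ltN (.at 14 4) (.at 14 3))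
      (.conj (.eqN (.at 14 4) (.at 14 3)) (.ltN (.var 4) (.var 3))))) (assign 6 (.const 0)) nop))

/-- Select the rows of the matrix `8` that are minimal and not repetitions. -/
def keepCode : Code :=
  rep 3 (seq (assign 6 (.const 1)) (seq (rep 4 compareCode) (.setN 15 (.var 3) (.var 6))))

/-- Append the vertex in variable `3` to the list, if it is selected and its row has one element
more than the content of variable `4`. -/
def appendCode : Code :=
  cond (.conj (.eqN (.at 15 3) (.const 1)) (.eqN (.at 14 3) (.add (.var 4) (.const 1))))
    (seq (.setN 17 (.var 16) (.var 3)) (assign 16 (.add (.var 16) (.const 1)))) nop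

/-- List the selected rows by increasing size. -/
def listCode : Code := rep 4 (rep 3 appendCode)

variable {W n : ℕ} {s : Store}

theorem run_sizeCode (hW : n * n < W) (hnW : n < W) (hW1 : 1 < W) (hn : s.word 1 0 = n) :
    ∀ v < n, (sizeCode.run W s).word 14 v =
      ((Finset.range n).filter fun w => s.word 8 (v * n + w) = 1).card := by
  refine run_rep hn (fun k s' => ∀ v < k, s'.word 14 v =
      ((Finset.range n).filter fun w => s.word 8 (v * n + w) = 1).card) (by simp) ?_ ?_
  · intro k s' x h
    rwa [Store.setWord_word_of_ne _ _ _ (by decide)]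
  · intro k hk s' hf _ hi h
    rw [run_seq]
    have e : (Code.setN 14 (.var 3) (.const 0)).run W s' = s'.setWord 14 k 0 := by
      simp [run, NExpr.eval_zero, NExpr.eval_var, hi]
    rw [e]
    have key := run_rep (W := W) (i := 5) (n := n) (s := s'.setWord 14 k 0)
      (p := cond (.eqN (.cell 8 3 5) (.const 1))
        (.setN 14 (.var 3) (.add (.at 14 3) (.const 1))) nop)
      (by rw [Store.setWord_word_of_ne _ _ _ (by decide), hf 1 (by decide), hn])
      (fun l s'' => s''.word 14 k =
        ((Finset.range l).filter fun w => s.word 8 (k * n + w) = 1).card ∧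
        ∀ v, v ≠ k → s''.word 14 v = s'.word 14 v) ?_ ?_ ?_
    · intro v hv
      by_cases hvk : v = k
      · rw [hvk]; exact key.1
      · rw [key.2 v hvk]; exact h v (by omega)
    · rw [Store.setWord_word_of_ne _ _ _ (by decide), Store.setWord_word_self]
      refine ⟨by simp, fun v hv => by simp [hv]⟩
    · intro l s'' x h
      rwa [Store.setWord_word_of_ne _ _ _ (by decide)]
    · rintro l hl s'' hf' _ hi' ⟨h1, h2⟩
      have g : ∀ a, a ∉ (Code.rep 3 (seq (.setN 14 (.var 3) (.const 0))
          (rep 5 (cond (.eqN (.cell 8 3 5) (.const 1))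
            (.setN 14 (.var 3) (.add (.at 14 3) (.const 1))) nop)))).writes → a ≠ 14 → a ≠ 5 →
          s''.word a = s.word a := by
        intro a ha h14 h5
        rw [hf' a (by simp [writes, h14, h5]), Store.setWord_word_of_ne _ _ _ h14, hf a ha]
      have e1 : s''.word 1 0 = n := by rw [g 1 (by decide) (by decide) (by decide), hn]
      have e8 := g 8 (by decide) (by decide) (by decide)
      have e3 : s''.word 3 0 = k := by
        rw [hf' 3 (by decide), Store.setWord_word_of_ne _ _ _ (by decide), hi]
      have t : (Test.eqN (.cell 8 3 5) (.const 1)).Holds W s'' ↔ s.word 8 (k * n + l) = 1 := by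
        simp only [Test.Holds, NExpr.eval_one hW1, NExpr.eval_cell hW e1 8
          (show s''.word 3 0 < n by omega) (show s''.word 5 0 < n by omega), e8, e3, hi']
      rw [Finset.range_add_one, Finset.filter_insert]
      by_cases c : s.word 8 (k * n + l) = 1
      · rw [run_cond_pos _ _ (t.2 c), if_pos c, Finset.card_insert_of_notMem (by simp), ← h1]
        simp only [run, NExpr.eval, NExpr.eval_var, NExpr.eval_at, e3, Store.setWord_word_self]
        have hle : s''.word 14 k ≤ l := by
          rw [h1]
          exact (Finset.card_filter_le _ _).trans (Finset.card_range l).le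
        constructor
        · rw [Function.update_self, Nat.mod_eq_of_lt (a := 1) hW1, Nat.mod_eq_of_lt (by omega)]
        · intro v hv
          rw [Function.update_of_ne hv, h2 v hv]
      · rw [run_cond_neg _ _ (fun h => c (t.1 h)), if_neg c, run_nop]
        exact ⟨h1, h2⟩

/-- Once row `u` is known to be contained in row `v`, comparing the sizes tells proper containment
from equality; among equal rows the index decides. -/
theorem run_compareCode (hW : n * n < W) (hW1 : 1 < W) (hn : s.word 1 0 = n) {u v : ℕ}
    (hu : s.word 4 0 = u) (hun : u < n) (hv : s.word 3 0 = v) (hvn : v < n) :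
    (compareCode.run W s).word 6 0 = 1 ↔ s.word 6 0 = 1 ∧
      ¬ ((∀ w < n, s.word 8 (u * n + w) = 1 → s.word 8 (v * n + w) = 1) ∧
        (s.word 14 u < s.word 14 v ∨ s.word 14 u = s.word 14 v ∧ u < v)) := by
  rw [compareCode, run_seq, run_assign, NExpr.eval_one hW1, run_seq]
  set s₁ := s.setWord 11 0 1 with hs₁
  have g : ∀ a, a ≠ 11 → s₁.word a = s.word a := fun a ha => Store.setWord_word_of_ne _ _ _ ha
  have g11 : s₁.word 11 0 = 1 := by rw [hs₁, Store.setWord_word_self]; simp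
  have hsub : (subsetCode.run W s₁).word 11 0 = 1 ↔
      ∀ w < n, s.word 8 (u * n + w) = 1 → s.word 8 (v * n + w) = 1 := by
    have := run_rep_flag (W := W) (i := 5) (f := 11) (n := n) (s := s₁)
      (p := cond (.conj (.eqN (.cell 8 4 5) (.const 1)) (.neg (.eqN (.cell 8 3 5) (.const 1))))
        (assign 11 (.const 0)) nop)
      (by rw [g 1 (by decide), hn]) (by decide)
      (fun w => s.word 8 (u * n + w) = 1 → s.word 8 (v * n + w) = 1) ?_
    · rw [g11] at this
      exact this.trans (by simp)
    · intro w hw s' hf hi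
      refine run_clear_flag ?_
      have e1 : s'.word 1 0 = n := by rw [hf 1 (by decide), g 1 (by decide), hn]
      have e3 : s'.word 3 0 = v := by rw [hf 3 (by decide), g 3 (by decide), hv]
      have e4 : s'.word 4 0 = u := by rw [hf 4 (by decide), g 4 (by decide), hu]
      have e8 : s'.word 8 = s.word 8 := by rw [hf 8 (by decide), g 8 (by decide)]
      simp only [Test.Holds, NExpr.eval_one hW1, e8, e3, e4, hi,
        NExpr.eval_cell hW e1 8 (show s'.word 3 0 < n by omega) (show s'.word 5 0 < n by omega),
        NExpr.eval_cell hW e1 8 (show s'.word 4 0 < n by omega) (show s'.word 5 0 < n by omega)]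
      tauto
  have hf : ∀ a, a ∉ subsetCode.writes → (subsetCode.run W s₁).word a = s₁.word a :=
    run_word _ _ _
  set s₂ := subsetCode.run W s₁
  have e : ∀ a, a ∉ subsetCode.writes → a ≠ 11 → s₂.word a = s.word a := fun a h1 h2 => by
    rw [hf a h1, g a h2]
  rw [← e 6 (by decide) (by decide)]
  refine run_clear_flag ?_
  simp only [Test.Holds, Test.holds_disj, NExpr.eval_one hW1, NExpr.eval_var, NExpr.eval_at,
    e 14 (by decide) (by decide), e 4 (by decide) (by decide), e 3 (by decide) (by decide), hu, hv,
    hsub]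
  tauto

theorem run_keepCode (hW : n * n < W) (hW1 : 1 < W) (hn : s.word 1 0 = n) :
    ∀ v < n, (keepCode.run W s).word 15 v = 1 ↔ ∀ u < n,
      ¬ ((∀ w < n, s.word 8 (u * n + w) = 1 → s.word 8 (v * n + w) = 1) ∧
        (s.word 14 u < s.word 14 v ∨ s.word 14 u = s.word 14 v ∧ u < v)) := by
  refine run_rep hn (fun k s' => ∀ v < k, s'.word 15 v = 1 ↔ ∀ u < n,
      ¬ ((∀ w < n, s.word 8 (u * n + w) = 1 → s.word 8 (v * n + w) = 1) ∧
        (s.word 14 u < s.word 14 v ∨ s.word 14 u = s.word 14 v ∧ u < v))) (by simp) ?_ ?_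
  · intro k s' x h
    rwa [Store.setWord_word_of_ne _ _ _ (by decide)]
  · intro k hk s' hf _ hi h
    rw [run_seq, run_assign, NExpr.eval_one hW1, run_seq]
    set s₁ := s'.setWord 6 0 1 with hs₁
    have g : ∀ a, a ≠ 6 → s₁.word a = s'.word a := fun a ha => Store.setWord_word_of_ne _ _ _ ha
    have g6 : s₁.word 6 0 = 1 := by rw [hs₁, Store.setWord_word_self]; simp
    have key := run_rep_flag (W := W) (i := 4) (f := 6) (n := n) (s := s₁) (p := compareCode)
      (by rw [g 1 (by decide), hf 1 (by decide), hn]) (by decide)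
      (fun u => ¬ ((∀ w < n, s.word 8 (u * n + w) = 1 → s.word 8 (k * n + w) = 1) ∧
        (s.word 14 u < s.word 14 k ∨ s.word 14 u = s.word 14 k ∧ u < k))) ?_
    · have hf' : ∀ a, a ∉ (Code.rep 4 compareCode).writes →
        ((rep 4 compareCode).run W s₁).word a = s₁.word a := run_word _ _ _
      set s₂ := (rep 4 compareCode).run W s₁
      have e : (Code.setN 15 (.var 3) (.var 6)).run W s₂ = s₂.setWord 15 k (s₂.word 6 0) := by
        simp only [run, NExpr.eval_var]
        rw [hf' 3 (by decide), g 3 (by decide), hi]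
      rw [e, Store.setWord_word_self, hf' 15 (by decide), g 15 (by decide)]
      intro v hv
      by_cases hvk : v = k
      · rw [hvk, Function.update_self, key, g6]
        simp
      · rw [Function.update_of_ne hvk]
        exact h v (by omega)
    · intro u hu s'' hf' hi'
      have e : ∀ a, a ∉ (Code.rep 4 compareCode).writes → a ≠ 3 → a ≠ 6 → a ≠ 15 →
          s''.word a = s.word a := by
        intro a ha h3 h6 h15
        rw [hf' a ha, g a h6, hf a ?_]
        intro h
        have : (Code.rep 3 (seq (assign 6 (.const 1)) (seq (rep 4 compareCode)
          (.setN 15 (.var 3) (.var 6))))).writes =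
            3 :: 6 :: ((Code.rep 4 compareCode).writes ++ [15]) := rfl
        rw [this] at h
        simp only [List.mem_cons, List.mem_append, List.not_mem_nil, or_false] at h
        tauto
      rw [run_compareCode hW hW1 (by rw [e 1 (by decide) (by decide) (by decide) (by decide), hn])
        hi' hu (by rw [hf' 3 (by decide), g 3 (by decide), hi]) hk,
        e 8 (by decide) (by decide) (by decide) (by decide),
        e 14 (by decide) (by decide) (by decide) (by decide)]

/-- The list contains, ordered by size, the selected vertices of size at most `t`, and those of size
`t + 1` that are smaller than `v`. -/
structure ListInv (n : ℕ) (size keep : ℕ → ℕ) (t v : ℕ) (s : Store) : Prop where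
  bound : s.word 16 0 ≤ t * n + v
  mem : ∀ j < s.word 16 0, s.word 17 j < n ∧ keep (s.word 17 j) = 1 ∧
    (size (s.word 17 j) ≤ t ∨ size (s.word 17 j) = t + 1 ∧ s.word 17 j < v)
  surj : ∀ x < n, keep x = 1 → 1 ≤ size x → (size x ≤ t ∨ size x = t + 1 ∧ x < v) →
    ∃ j < s.word 16 0, s.word 17 j = x
  sorted : ∀ i j, i < j → j < s.word 16 0 → size (s.word 17 i) < size (s.word 17 j) ∨
    size (s.word 17 i) = size (s.word 17 j) ∧ s.word 17 i < s.word 17 j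

theorem ListInv.setWord {size keep : ℕ → ℕ} {t v : ℕ} (h : ListInv n size keep t v s) {a : ℕ}
    (ha : a ≠ 16) (ha' : a ≠ 17) (x : ℕ) : ListInv n size keep t v (s.setWord a 0 x) := by
  obtain ⟨h1, h2, h3, h4⟩ := h
  rw [← Store.setWord_word_of_ne s 0 x ha.symm] at h1 h2 h3 h4
  rw [← Store.setWord_word_of_ne s 0 x ha'.symm] at h2 h3 h4
  exact ⟨h1, h2, h3, h4⟩

theorem run_appendCode (hW : n * n < W) (hnW : n < W) (hW1 : 1 < W) {size keep : ℕ → ℕ}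
    (hs : s.word 14 = size) (hk : s.word 15 = keep) {t v : ℕ} (ht : s.word 4 0 = t) (htn : t < n)
    (hv : s.word 3 0 = v) (hvn : v < n) (h : ListInv n size keep t v s) :
    ListInv n size keep t (v + 1) (appendCode.run W s) := by
  -- The crude bound `t * n + v` on the length of the list guarantees that incrementing it does not
  -- overflow.
  have hlt := mul_add_lt_mul htn hvn
  have hb := h.bound
  have hc : (Test.conj (.eqN (.at 15 3) (.const 1))
      (.eqN (.at 14 3) (.add (.var 4) (.const 1)))).Holds W s ↔ keep v = 1 ∧ size v = t + 1 := by
    simp only [Test.Holds, NExpr.eval_at, NExpr.eval, NExpr.eval_var, hs, hk,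
      hv, ht]
    rw [Nat.mod_eq_of_lt hW1, Nat.mod_eq_of_lt (show t + 1 < W by omega)]
  by_cases c : keep v = 1 ∧ size v = t + 1
  · rw [appendCode, run_cond_pos _ _ (hc.2 c)]
    have e : (seq (.setN 17 (.var 16) (.var 3)) (assign 16 (.add (.var 16) (.const 1)))).run W s =
        (s.setWord 17 (s.word 16 0) v).setWord 16 0 (s.word 16 0 + 1) := by
      simp only [run_assign, run, NExpr.eval, NExpr.eval_var, hv]
      rw [Store.setWord_word_of_ne _ _ _ (by decide), Nat.mod_eq_of_lt hW1,
        Nat.mod_eq_of_lt (show s.word 16 0 + 1 < W by omega)]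
    rw [e]
    set s' := (s.setWord 17 (s.word 16 0) v).setWord 16 0 (s.word 16 0 + 1) with hs'
    have e16 : s'.word 16 0 = s.word 16 0 + 1 := by
      rw [hs', Store.setWord_word_self, Function.update_self]
    have e17 : s'.word 17 = Function.update (s.word 17) (s.word 16 0) v := by
      rw [hs', Store.setWord_word_of_ne _ _ _ (by decide), Store.setWord_word_self]
    have old : ∀ j, j < s.word 16 0 → s'.word 17 j = s.word 17 j := fun j hj => by
      rw [e17, Function.update_of_ne hj.ne]
    have new : s'.word 17 (s.word 16 0) = v := by rw [e17, Function.update_self]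
    constructor
    · omega
    · intro j hj
      rcases Nat.lt_succ_iff_lt_or_eq.1 (e16 ▸ hj) with hj | rfl
      · rw [old j hj]
        obtain ⟨h1, h2, h3⟩ := h.mem j hj
        exact ⟨h1, h2, by omega⟩
      · rw [new]
        exact ⟨hvn, c.1, Or.inr ⟨c.2, by omega⟩⟩
    · intro x hx hkx hsx hpx
      by_cases hxv : x = v
      · exact ⟨s.word 16 0, by omega, by rw [new, hxv]⟩
      · obtain ⟨j, hj, hjx⟩ := h.surj x hx hkx hsx (by omega)
        exact ⟨j, by omega, by rw [old j hj, hjx]⟩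
    · intro i j hij hj
      rcases Nat.lt_succ_iff_lt_or_eq.1 (e16 ▸ hj) with hj | rfl
      · rw [old i (by omega), old j hj]
        exact h.sorted i j hij hj
      · rw [new, old i hij]
        obtain ⟨h1, h2, h3⟩ := h.mem i hij
        omega
  · rw [appendCode, run_cond_neg _ _ (fun h => c (hc.1 h)), run_nop]
    constructor
    · omega
    · intro j hj
      obtain ⟨h1, h2, h3⟩ := h.mem j hj
      exact ⟨h1, h2, by omega⟩
    · intro x hx hkx hsx hpx
      refine h.surj x hx hkx hsx ?_
      by_cases hxv : x = v
      · subst hxv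
        omega
      · omega
    · exact h.sorted

/-- Pass `t` appends the rows of size `t + 1`, so `n` passes sort the list. Rows of size zero would
be skipped, but a connected graph has none (`sepSet_nonempty`). -/
theorem run_listCode (hW : n * n < W) (hnW : n < W) (hW1 : 1 < W) (hn : s.word 1 0 = n)
    (h16 : s.word 16 0 = 0) :
    ListInv n (s.word 14) (s.word 15) n 0 (listCode.run W s) := by
  refine run_rep hn (fun t => ListInv n (s.word 14) (s.word 15) t 0) ?_ ?_ ?_
  · refine ListInv.setWord ?_ (by decide) (by decide) _
    refine ⟨by omega, ?_, ?_, ?_⟩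
    · intro j hj
      omega
    · intro x hx _ h1 h2
      omega
    · intro i j _ hj
      omega
  · exact fun k s' x h => h.setWord (by decide) (by decide) x
  · intro t ht s' hf _ hi h
    have key := run_rep (W := W) (i := 3) (n := n) (s := s') (p := appendCode)
      (by rw [hf 1 (by decide), hn]) (fun v => ListInv n (s.word 14) (s.word 15) t v)
      (h.setWord (by decide) (by decide) _) (fun k s' x h => h.setWord (by decide) (by decide) x)
      (fun v hv s'' hf' _ hi' h' => run_appendCode hW hnW hW1
        (by rw [hf' 14 (by decide), hf 14 (by decide)])
        (by rw [hf' 15 (by decide), hf 15 (by decide)])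
        (by rw [hf' 4 (by decide), hi]) ht hi' hv h')
    refine ⟨?_, ?_, ?_, key.sorted⟩
    · rw [add_mul]
      have := key.bound
      omega
    · intro j hj
      obtain ⟨h1, h2, h3⟩ := key.mem j hj
      exact ⟨h1, h2, by omega⟩
    · intro x hx hkx hsx hpx
      exact key.surj x hx hkx hsx (by omega)

end Lists

/-! ### Program: the table of optimal costs and the trace back -/

section DynamicProgram

/-- Update the first index of the final run of rows that contain the vertex in variable `5`, in view
of row `12` of the matrix `8`; its index plus one is in variable `22`. -/
def startCode : Code :=
  rep 5 (cond (.neg (.eqN (.cell 8 12 5) (.const 1))) (.setN 18 (.var 5) (.var 22)) nop)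

/-- The cost of the solution that is obtained from the entry in variable `4` by adding the vertex in
variable `5`. -/
def candidate : RExpr := .add (.read 1 (.var 4)) (.read 0 (.var 5))

/-- If adding the vertex in variable `5` to the solution in variable `4` is possible, and better than
what was known before, record this. -/
def relaxCode : Code :=
  cond (.conj (.neg (.ltN (.var 4) (.at 18 5))) (.conj (.neg (.ltN (.var 21) (.var 4)))
      (.disj (.neg (.eqN (.var 11) (.const 1))) (.ltR candidate (.read 1 (.var 22))))))
    (seq (.setR 1 (.var 22) candidate) (seq (.setN 19 (.var 22) (.var 4))
      (seq (.setN 20 (.var 22) (.var 5)) (assign 11 (.const 1))))) nop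

/-- Compute the optimal solution for the rows up to the one in variable `21`. -/
def entryCode : Code :=
  seq (assign 12 (.at 17 21)) (seq (assign 22 (.add (.var 21) (.const 1)))
    (seq startCode (seq (assign 11 (.const 0)) (rep 5 (rep 4 relaxCode)))))

/-- The dynamic program. -/
def tableCode : Code := rep 21 (cond (.ltN (.var 21) (.var 16)) entryCode nop)

/-- Mark the vertices of the optimal solution in array `2`. -/
def traceCode : Code :=
  seq (assign 23 (.var 16)) (rep 5 (cond (.ltN (.const 0) (.var 23))
    (seq (.setN 2 (.at 20 23) (.const 1)) (assign 23 (.at 19 23))) nop))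

/-- The entry `i` of the table can be extended to row `j` by the vertex `w`. -/
def Extends (n : ℕ) (E : ℕ → ℕ → Prop) (j i w : ℕ) : Prop :=
  i ≤ j ∧ w < n ∧ ∀ l, i ≤ l → l ≤ j → E l w

/-- Entry `j + 1` of the table is optimal among the extensions that have been seen; `s₀` is the store
at the beginning. -/
structure EntryInv (n : ℕ) (E : ℕ → ℕ → Prop) (j : ℕ) (s₀ : Store) (seen : ℕ → ℕ → Prop)
    (s : Store) : Prop where
  attained : s.word 11 0 = 1 → Extends n E j (s.word 19 (j + 1)) (s.word 20 (j + 1)) ∧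
    s.real 1 (j + 1) = s₀.real 1 (s.word 19 (j + 1)) + s₀.real 0 (s.word 20 (j + 1))
  le : ∀ i w, seen i w → Extends n E j i w →
    s.word 11 0 = 1 ∧ s.real 1 (j + 1) ≤ s₀.real 1 i + s₀.real 0 w
  source : ∀ x, x ≠ j + 1 → s.word 19 x = s₀.word 19 x
  choice : ∀ x, x ≠ j + 1 → s.word 20 x = s₀.word 20 x
  value : ∀ x, x ≠ j + 1 → s.real 1 x = s₀.real 1 x

variable {W n : ℕ} {s s₀ : Store} {E : ℕ → ℕ → Prop} {j : ℕ} {seen : ℕ → ℕ → Prop}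

theorem EntryInv.mono (h : EntryInv n E j s₀ seen s) {seen' : ℕ → ℕ → Prop}
    (hs : ∀ i w, seen' i w → Extends n E j i w → seen i w) : EntryInv n E j s₀ seen' s :=
  ⟨h.attained, fun i w h1 h2 => h.le i w (hs i w h1 h2) h2, h.source, h.choice, h.value⟩

theorem EntryInv.setWord (h : EntryInv n E j s₀ seen s) {a : ℕ} (h11 : a ≠ 11) (h19 : a ≠ 19)
    (h20 : a ≠ 20) (x : ℕ) : EntryInv n E j s₀ seen (s.setWord a 0 x) := by
  obtain ⟨h1, h2, h3, h4, h5⟩ := h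
  rw [← Store.setWord_word_of_ne s 0 x h11.symm] at h1 h2
  rw [← Store.setWord_word_of_ne s 0 x h19.symm] at h1 h3
  rw [← Store.setWord_word_of_ne s 0 x h20.symm] at h1 h4
  exact ⟨h1, h2, h3, h4, h5⟩

theorem run_startCode (hW : n * n < W) (hW1 : 1 < W) (hn : s.word 1 0 = n)
    (h12 : s.word 12 0 < n) :
    ∀ w < n, (startCode.run W s).word 18 w =
      if s.word 8 (s.word 12 0 * n + w) = 1 then s.word 18 w else s.word 22 0 := by
  have key := run_rep (W := W) (i := 5) (s := s) hn
    (p := cond (.neg (.eqN (.cell 8 12 5) (.const 1))) (.setN 18 (.var 5) (.var 22)) nop)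
    (fun k s' => ∀ w < n, s'.word 18 w =
      if s.word 8 (s.word 12 0 * n + w) = 1 ∨ k ≤ w then s.word 18 w else s.word 22 0) ?_ ?_ ?_
  · intro w hw
    rw [startCode, key w hw]
    simp only [show ¬ n ≤ w by omega, or_false]
  · intro w _
    rw [Store.setWord_word_of_ne _ _ _ (by decide)]
    simp
  · intro k s' x h
    rwa [Store.setWord_word_of_ne _ _ _ (by decide)]
  · intro k hk s' hf _ hi h
    have e1 : s'.word 1 0 = n := by rw [hf 1 (by decide), hn]
    have e8 := hf 8 (by decide)
    have e12 := hf 12 (by decide)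
    have e22 := hf 22 (by decide)
    have lt12 : s'.word 12 0 < n := by rw [e12]; exact h12
    have t : (Test.neg (.eqN (.cell 8 12 5) (.const 1))).Holds W s' ↔
        ¬ s.word 8 (s.word 12 0 * n + k) = 1 := by
      simp only [Test.Holds, NExpr.eval_one hW1, NExpr.eval_cell hW e1 8
        lt12 (show s'.word 5 0 < n by omega), e8, e12, hi]
    by_cases c : s.word 8 (s.word 12 0 * n + k) = 1
    · rw [run_cond_neg _ _ (fun h => t.1 h c), run_nop]
      intro w hw
      rw [h w hw]
      by_cases hwk : w = k
      · simp [hwk, c]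
      · simp only [show k ≤ w ↔ k + 1 ≤ w by omega]
    · rw [run_cond_pos _ _ (t.2 c)]
      simp only [run, NExpr.eval_var, hi, Store.setWord_word_self, e22]
      intro w hw
      by_cases hwk : w = k
      · simp [hwk, c]
      · rw [Function.update_of_ne hwk, h w hw]
        simp only [show k ≤ w ↔ k + 1 ≤ w by omega]

/-- The pair `(i, w)` joins those that have been seen. Variable `11` tells whether entry `j + 1` has
been set at all, in place of an infinite initial value. -/
theorem run_relaxCode (hW1 : 1 < W) {i w : ℕ} (hi : s.word 4 0 = i) (hw : s.word 5 0 = w)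
    (hj : s.word 21 0 = j) (hj' : s.word 22 0 = j + 1) (h0 : s.real 0 = s₀.real 0)
    (hext : ¬ i < s.word 18 w ∧ ¬ j < i ↔ Extends n E j i w)
    (h : EntryInv n E j s₀ seen s) :
    EntryInv n E j s₀ (fun i' w' => seen i' w' ∨ i' = i ∧ w' = w) (relaxCode.run W s) := by
  have hc : candidate.eval W s = s.real 1 i + s₀.real 0 w := by
    simp only [candidate, RExpr.eval, NExpr.eval_var, hi, hw, h0]
  have ht : (Test.conj (.neg (.ltN (.var 4) (.at 18 5))) (.conj (.neg (.ltN (.var 21) (.var 4)))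
      (.disj (.neg (.eqN (.var 11) (.const 1))) (.ltR candidate (.read 1 (.var 22)))))).Holds W s ↔
      Extends n E j i w ∧
        (¬ s.word 11 0 = 1 ∨ s.real 1 i + s₀.real 0 w < s.real 1 (j + 1)) := by
    simp only [Test.Holds, Test.holds_disj, NExpr.eval_one hW1, NExpr.eval_var, NExpr.eval_at, hc,
      RExpr.eval, hi, hw, hj, hj', ← hext, and_assoc]
  rw [relaxCode]
  by_cases c : Extends n E j i w ∧
      (¬ s.word 11 0 = 1 ∨ s.real 1 i + s₀.real 0 w < s.real 1 (j + 1))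
  · have hij : i ≠ j + 1 := by
      have := c.1.1
      omega
    rw [run_cond_pos _ _ (ht.2 c)]
    rw [h.value i hij] at c hc
    set p := seq (.setR 1 (.var 22) candidate) (seq (.setN 19 (.var 22) (.var 4))
      (seq (.setN 20 (.var 22) (.var 5)) (assign 11 (.const 1)))) with hp
    have e11 : (p.run W s).word 11 0 = 1 := by
      rw [hp, run_seq, run_seq, run_seq, run_assign, NExpr.eval_one hW1, Store.setWord_word_self,
        Function.update_self]
    have e19 : (p.run W s).word 19 = Function.update (s.word 19) (j + 1) i := by
      simp [hp, run, assign, NExpr.eval_var, Store.setWord_word, hj', hi, Store.setReal_word]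
    have e20 : (p.run W s).word 20 = Function.update (s.word 20) (j + 1) w := by
      simp [hp, run, assign, NExpr.eval_var, Store.setWord_word, hj', hw, Store.setReal_word]
    have er : (p.run W s).real 1 =
        Function.update (s.real 1) (j + 1) (s₀.real 1 i + s₀.real 0 w) := by
      simp [hp, run, assign, NExpr.eval_var, Store.setWord_real, Store.setReal_real_self, hj', hc]
    constructor
    · intro _
      rw [e19, e20, er, Function.update_self, Function.update_self, Function.update_self]
      exact ⟨c.1, rfl⟩
    · intro i' w' hs hx
      rw [er, Function.update_self]
      refine ⟨e11, ?_⟩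
      rcases hs with hs | ⟨rfl, rfl⟩
      · obtain ⟨h1, h2⟩ := h.le i' w' hs hx
        rcases c.2 with c2 | c2
        · exact absurd h1 c2
        · exact c2.le.trans h2
      · exact le_rfl
    · intro x hx
      rw [e19, Function.update_of_ne hx, h.source x hx]
    · intro x hx
      rw [e20, Function.update_of_ne hx, h.choice x hx]
    · intro x hx
      rw [er, Function.update_of_ne hx, h.value x hx]
  · rw [run_cond_neg _ _ (fun h => c (ht.1 h)), run_nop]
    refine ⟨h.attained, ?_, h.source, h.choice, h.value⟩
    rintro i' w' (hs | ⟨rfl, rfl⟩) hx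
    · exact h.le i' w' hs hx
    · have hij : i' ≠ j + 1 := by
        have := hx.1
        omega
      rw [h.value i' hij] at c
      by_contra hcon
      refine c ⟨hx, ?_⟩
      by_contra hcon'
      push Not at hcon'
      exact hcon ⟨hcon'.1, hcon'.2⟩

/-- The table is correct up to entry `k`. -/
structure TableInv (n : ℕ) (E : ℕ → ℕ → Prop) (c : ℕ → ℝ) (k : ℕ) (s : Store) : Prop where
  start_le : ∀ w < n, s.word 18 w ≤ k
  start : ∀ w < n, ∀ i ≤ k, (s.word 18 w ≤ i ↔ ∀ l, i ≤ l → l < k → E l w)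
  zero : s.real 1 0 = 0
  -- This is the bound along intervals that `chain_bound` needs; `attained` is what tracing back
  -- needs.
  le : ∀ j ≤ k, ∀ i < j, ∀ w < n, (∀ l, i ≤ l → l < j → E l w) → s.real 1 j ≤ s.real 1 i + c w
  attained : ∀ j, 1 ≤ j → j ≤ k → s.word 19 j < j ∧ s.word 20 j < n ∧
    (∀ l, s.word 19 j ≤ l → l < j → E l (s.word 20 j)) ∧
      s.real 1 j = s.real 1 (s.word 19 j) + c (s.word 20 j)

theorem run_relaxCode_loop (hW1 : 1 < W) (hn : s.word 1 0 = n) (hjn : j < n)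
    (hj : s.word 21 0 = j) (hj' : s.word 22 0 = j + 1) (h11 : s.word 11 0 = 0)
    (hstart : ∀ w < n, ∀ i, ¬ i < s.word 18 w ∧ ¬ j < i ↔ Extends n E j i w) :
    EntryInv n E j s (fun _ _ => True) ((rep 5 (rep 4 relaxCode)).run W s) := by
  refine (run_rep hn (fun k => EntryInv n E j s (fun _ w => w < k)) ?_ ?_ ?_).mono
    fun i w _ hx => hx.2.1
  · refine EntryInv.setWord ⟨?_, fun i w h => absurd h (Nat.not_lt_zero _), fun _ _ => rfl,
      fun _ _ => rfl, fun _ _ => rfl⟩ (by decide) (by decide) (by decide) _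
    intro h
    omega
  · exact fun k s x h => h.setWord (by decide) (by decide) (by decide) x
  · intro w hw s' hf hr hi h
    have key := run_rep (W := W) (i := 4) (n := n) (s := s') (p := relaxCode)
      (by rw [hf 1 (by decide), hn])
      (fun k => EntryInv n E j s (fun i' w' => w' < w ∨ i' < k ∧ w' = w)) ?_ ?_ ?_
    · refine key.mono fun i' w' hw' hx => ?_
      have := hx.1
      omega
    · refine EntryInv.setWord (h.mono fun i' w' h _ => ?_) (by decide) (by decide) (by decide) _
      omega
    · exact fun k s x h => h.setWord (by decide) (by decide) (by decide) x
    · intro i hin s'' hf' hr' hi' h'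
      refine (run_relaxCode hW1 (w := w) hi' (by rw [hf' 5 (by decide), hi])
        (by rw [hf' 21 (by decide), hf 21 (by decide), hj])
        (by rw [hf' 22 (by decide), hf 22 (by decide), hj'])
        (by rw [hr' 0 (by decide), hr 0 (by decide)]) ?_ h').mono fun i' w' h _ => ?_
      · rw [hf' 18 (by decide), hf 18 (by decide)]
        exact hstart w hw i
      · omega

-- With array `18` up to date, one comparison tells whether `w` lies in all sets from `i` to `j`, so
-- an entry takes quadratic time. As set `j` is nonempty, entry `j + 1` does get a value: entry `j`
-- can be extended.
open Classical in
theorem run_entryCode (hW : n * n < W) (hnW : n < W) (hW1 : 1 < W) (hn : s.word 1 0 = n)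
    (hjn : j < n) (hj : s.word 21 0 = j) (hL : s.word 17 j < n)
    (hE : ∀ w < n, E j w ↔ s.word 8 (s.word 17 j * n + w) = 1) (hne : ∃ w < n, E j w)
    (h : TableInv n E (s.real 0) j s) :
    TableInv n E (s.real 0) (j + 1) (entryCode.run W s) := by
  rw [entryCode, run_seq, run_assign, NExpr.eval_at, hj, run_seq, run_assign, run_seq]
  set s₁ := s.setWord 12 0 (s.word 17 j) with hs₁
  have hev : (NExpr.add (.var 21) (.const 1)).eval W s₁ = j + 1 := by
    simp only [NExpr.eval, NExpr.eval_var]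
    rw [hs₁, Store.setWord_word_of_ne _ _ _ (by decide), hj, Nat.mod_eq_of_lt hW1,
      Nat.mod_eq_of_lt (by omega)]
  rw [hev]
  set s₂ := s₁.setWord 22 0 (j + 1) with hs₂
  have g : ∀ a, a ≠ 12 → a ≠ 22 → s₂.word a = s.word a := fun a h1 h2 => by
    rw [hs₂, Store.setWord_word_of_ne _ _ _ h2, hs₁, Store.setWord_word_of_ne _ _ _ h1]
  have g12 : s₂.word 12 0 = s.word 17 j := by
    rw [hs₂, Store.setWord_word_of_ne _ _ _ (by decide), hs₁, Store.setWord_word_self,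
      Function.update_self]
  have g22 : s₂.word 22 0 = j + 1 := by rw [hs₂, Store.setWord_word_self, Function.update_self]
  have gr : s₂.real = s.real := rfl
  have hst := run_startCode (W := W) (n := n) (s := s₂) hW hW1
    (by rw [g 1 (by decide) (by decide), hn]) (by rw [g12]; exact hL)
  have f : ∀ a, a ∉ startCode.writes → (startCode.run W s₂).word a = s₂.word a := run_word _ _ _
  have fr : ∀ a, (startCode.run W s₂).real a = s₂.real a := fun a =>
    run_real _ _ _ _ (List.not_mem_nil (a := a))
  set s₃ := startCode.run W s₂ with hs₃
  have hst' : ∀ w < n, s₃.word 18 w = if E j w then s.word 18 w else j + 1 := by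
    intro w hw
    rw [hst w hw, g12, g22, g 18 (by decide) (by decide), g 8 (by decide) (by decide)]
    by_cases c : E j w
    · rw [if_pos c, if_pos ((hE w hw).1 c)]
    · rw [if_neg c, if_neg fun h => c ((hE w hw).2 h)]
  have hstart : ∀ w < n, ∀ i ≤ j, (s₃.word 18 w ≤ i ↔ ∀ l, i ≤ l → l < j + 1 → E l w) := by
    intro w hw i hij
    rw [hst' w hw]
    by_cases c : E j w
    · rw [if_pos c, h.start w hw i hij]
      refine ⟨fun h l h1 h2 => ?_, fun h l h1 h2 => h l h1 (by omega)⟩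
      rcases Nat.lt_succ_iff_lt_or_eq.1 h2 with h2 | rfl
      · exact h l h1 h2
      · exact c
    · rw [if_neg c]
      exact ⟨fun h => by omega, fun h => absurd (h j hij (by omega)) c⟩
  rw [run_seq, run_assign, NExpr.eval_zero]
  set s₄ := s₃.setWord 11 0 0 with hs₄
  have k4 : ∀ a, a ≠ 11 → s₄.word a = s₃.word a := fun a ha => by
    rw [hs₄, Store.setWord_word_of_ne _ _ _ ha]
  have er : ∀ a, s₄.real a = s.real a := fun a => by
    rw [hs₄, Store.setWord_real, fr, gr]
  have key := run_relaxCode_loop (W := W) (n := n) (s := s₄) (E := E) (j := j) hW1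
    (by rw [k4 1 (by decide), f 1 (by decide), g 1 (by decide) (by decide), hn]) hjn
    (by rw [k4 21 (by decide), f 21 (by decide), g 21 (by decide) (by decide), hj])
    (by rw [k4 22 (by decide), f 22 (by decide), g22])
    (by rw [hs₄, Store.setWord_word_self, Function.update_self]) ?_
  swap
  · intro w hw i
    rw [k4 18 (by decide), Extends]
    constructor
    · rintro ⟨h1, h2⟩
      exact ⟨by omega, hw, fun l h3 h4 => (hstart w hw i (by omega)).1 (by omega) l h3 (by omega)⟩
    · rintro ⟨h1, _, h2⟩
      have := (hstart w hw i h1).2 fun l h3 h4 => h2 l h3 (by omega)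
      omega
  have f18 : ((rep 5 (rep 4 relaxCode)).run W s₄).word 18 = s₄.word 18 := run_word _ _ _ _ (by decide)
  set s₅ := (rep 5 (rep 4 relaxCode)).run W s₄ with hs₅
  have old19 : ∀ x, x ≠ j + 1 → s₅.word 19 x = s.word 19 x := fun x hx => by
    rw [key.source x hx, k4 19 (by decide), f 19 (by decide), g 19 (by decide) (by decide)]
  have old20 : ∀ x, x ≠ j + 1 → s₅.word 20 x = s.word 20 x := fun x hx => by
    rw [key.choice x hx, k4 20 (by decide), f 20 (by decide), g 20 (by decide) (by decide)]
  have oldr : ∀ x, x ≠ j + 1 → s₅.real 1 x = s.real 1 x := fun x hx => by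
    rw [key.value x hx, er]
  constructor
  · intro w hw
    rw [f18, k4 18 (by decide), hst' w hw]
    have := h.start_le w hw
    split_ifs <;> omega
  · intro w hw i hi
    rw [f18, k4 18 (by decide)]
    rcases Nat.le_succ_iff.1 hi with hi | hi
    · exact hstart w hw i hi
    · have := h.start_le w hw
      rw [hst' w hw, hi]
      refine ⟨fun _ l h1 h2 => by omega, fun _ => ?_⟩
      split_ifs <;> omega
  · rw [oldr 0 (by omega), h.zero]
  · intro x hx i hi w hw hall
    rw [oldr i (by omega)]
    rcases Nat.le_succ_iff.1 hx with hx | hx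
    · rw [oldr x (by omega)]
      exact h.le x hx i hi w hw hall
    · rw [Nat.succ_eq_add_one] at hx
      subst hx
      have := (key.le i w trivial ⟨by omega, hw, fun l h1 h2 => hall l h1 (by omega)⟩).2
      rwa [er, er] at this
  · intro x h1 hx
    rcases Nat.le_succ_iff.1 hx with hx | hx
    · have := h.attained x h1 hx
      rw [old19 x (by omega), old20 x (by omega), oldr x (by omega), oldr _ (by omega)]
      exact this
    · rw [Nat.succ_eq_add_one] at hx
      subst hx
      obtain ⟨w, hw, hEw⟩ := hne
      have hfl := (key.le j w trivial ⟨le_rfl, hw, fun l h1 h2 => by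
        rwa [show l = j by omega]⟩).1
      obtain ⟨⟨a1, a2, a3⟩, a4⟩ := key.attained hfl
      refine ⟨by omega, a2, fun l h1 h2 => a3 l h1 (by omega), ?_⟩
      rw [oldr (s₅.word 19 (j + 1)) (by omega), a4, er, er]

theorem TableInv.setWord {c : ℕ → ℝ} {k : ℕ} (h : TableInv n E c k s) {a : ℕ} (h18 : a ≠ 18)
    (h19 : a ≠ 19) (h20 : a ≠ 20) (x : ℕ) : TableInv n E c k (s.setWord a 0 x) := by
  obtain ⟨h1, h2, h3, h4, h5⟩ := h
  rw [← Store.setWord_word_of_ne s 0 x h18.symm] at h1 h2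
  rw [← Store.setWord_word_of_ne s 0 x h19.symm] at h5
  rw [← Store.setWord_word_of_ne s 0 x h20.symm] at h5
  exact ⟨h1, h2, h3, h4, h5⟩

/-- The loop runs up to `n` even if the list is shorter; the test makes the surplus iterations idle,
whence `min k m` in the invariant. -/
theorem run_tableCode (hW : n * n < W) (hnW : n < W) (hW1 : 1 < W) (hn : s.word 1 0 = n) {m : ℕ}
    (hm : s.word 16 0 = m) (hmn : m ≤ n) (hL : ∀ j < m, s.word 17 j < n)
    (hE : ∀ j < m, ∀ w < n, E j w ↔ s.word 8 (s.word 17 j * n + w) = 1)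
    (hne : ∀ j < m, ∃ w < n, E j w) (h18 : ∀ w < n, s.word 18 w = 0) (hr : s.real 1 0 = 0) :
    TableInv n E (s.real 0) m (tableCode.run W s) := by
  have key := run_rep (W := W) (i := 21) (s := s) hn
    (p := cond (.ltN (.var 21) (.var 16)) entryCode nop)
    (fun k s' => TableInv n E (s.real 0) (min k m) s') ?_
    (fun k s' x h => h.setWord (by decide) (by decide) (by decide) x) ?_
  · rwa [min_eq_right hmn] at key
  · rw [Nat.zero_min]
    refine TableInv.setWord ⟨fun w hw => (h18 w hw).le, fun w hw i hi => ?_, hr, fun j hj i hi => ?_,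
      fun j h1 h2 => ?_⟩ (by decide) (by decide) (by decide) _
    · rw [h18 w hw]
      exact ⟨fun _ l _ h => by omega, fun _ => by omega⟩
    · omega
    · omega
  · intro k hk s' hf hr' hi h
    have e16 := hf 16 (by decide)
    have e17 := hf 17 (by decide)
    have e8 := hf 8 (by decide)
    have er0 := hr' 0 (by decide)
    have t : (Test.ltN (.var 21) (.var 16)).Holds W s' ↔ k < m := by
      simp only [Test.Holds, NExpr.eval_var, e16, hm, hi]
    by_cases c : k < m
    · rw [run_cond_pos _ _ (t.2 c), min_eq_left (by omega)]
      rw [min_eq_left (by omega), ← er0] at h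
      rw [← er0]
      refine run_entryCode hW hnW hW1 (by rw [hf 1 (by decide), hn]) hk hi ?_ ?_ (hne k c) h
      · rw [e17]
        exact hL k c
      · rw [e17, e8]
        exact hE k c
    · rw [run_cond_neg _ _ (fun h => c (t.1 h)), run_nop, min_eq_right (by omega)]
      rwa [min_eq_right (by omega)] at h

/-- Following the sources from entry `m` down to entry `0`, the intervals of the chosen vertices
tile the list. The pointer strictly decreases, so `n ≥ m` iterations suffice. A vertex chosen twice
is marked once, hence the inequality. -/
theorem run_traceCode (hW1 : 1 < W) (hn : s.word 1 0 = n) {m : ℕ} {c : ℕ → ℝ}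
    (hm : s.word 16 0 = m) (hmn : m ≤ n) (hc : ∀ w, 0 ≤ c w) (h2 : ∀ w < n, s.word 2 w = 0)
    (h : TableInv n E c m s) :
    (∀ l < m, ∃ w < n, (traceCode.run W s).word 2 w = 1 ∧ E l w) ∧
      ∑ w ∈ (Finset.range n).filter (fun w => (traceCode.run W s).word 2 w = 1), c w ≤
        s.real 1 m := by
  rw [traceCode, run_seq, run_assign, NExpr.eval_var, hm]
  set s₁ := s.setWord 23 0 m with hs₁
  have g : ∀ a, a ≠ 23 → s₁.word a = s.word a := fun a ha => Store.setWord_word_of_ne _ _ _ ha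
  have g23 : s₁.word 23 0 = m := by rw [hs₁, Store.setWord_word_self, Function.update_self]
  have key := run_rep (W := W) (i := 5) (n := n) (s := s₁) (p := cond (.ltN (.const 0) (.var 23))
    (seq (.setN 2 (.at 20 23) (.const 1)) (assign 23 (.at 19 23))) nop)
    (by rw [g 1 (by decide), hn])
    (fun k s' => (s'.word 23 0 + k ≤ m ∨ s'.word 23 0 = 0) ∧ s'.word 23 0 ≤ m ∧
      (∀ l, s'.word 23 0 ≤ l → l < m → ∃ w < n, s'.word 2 w = 1 ∧ E l w) ∧
      s.real 1 (s'.word 23 0) +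
        ∑ w ∈ (Finset.range n).filter (fun w => s'.word 2 w = 1), c w ≤ s.real 1 m) ?_ ?_ ?_
  · obtain ⟨k1, k2, k3, k4⟩ := key
    have h0 : ((rep 5 (cond (.ltN (.const 0) (.var 23)) (seq (.setN 2 (.at 20 23) (.const 1))
      (assign 23 (.at 19 23))) nop)).run W s₁).word 23 0 = 0 := by omega
    rw [h0] at k3 k4
    rw [h.zero, zero_add] at k4
    exact ⟨fun l hl => k3 l (Nat.zero_le _) hl, k4⟩
  · rw [Store.setWord_word_of_ne (a := 5) (b := 23) _ _ _ (by decide),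
      Store.setWord_word_of_ne (a := 5) (b := 2) _ _ _ (by decide), g23, g 2 (by decide)]
    refine ⟨by omega, le_rfl, fun l h1 h2 => by omega, ?_⟩
    rw [Finset.filter_false_of_mem]
    · simp
    · intro w hw
      rw [h2 w (Finset.mem_range.1 hw)]
      omega
  · intro k s' x h
    rwa [Store.setWord_word_of_ne _ _ _ (by decide), Store.setWord_word_of_ne _ _ _ (by decide)]
  · rintro k hk s' hf _ hi ⟨h1, h2, h3, h4⟩
    have e19 : s'.word 19 = s.word 19 := by rw [hf 19 (by decide), g 19 (by decide)]
    have e20 : s'.word 20 = s.word 20 := by rw [hf 20 (by decide), g 20 (by decide)]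
    have t : (Test.ltN (.const 0) (.var 23)).Holds W s' ↔ 0 < s'.word 23 0 := by
      simp only [Test.Holds, NExpr.eval_zero, NExpr.eval_var]
    by_cases hpos : 0 < s'.word 23 0
    · rw [run_cond_pos _ _ (t.2 hpos)]
      set x := s'.word 23 0 with hx
      obtain ⟨a1, a2, a3, a4⟩ := h.attained x hpos h2
      have e : (seq (.setN 2 (.at 20 23) (.const 1)) (assign 23 (.at 19 23))).run W s' =
          (s'.setWord 2 (s.word 20 x) 1).setWord 23 0 (s.word 19 x) := by
        rw [run_seq, run_assign, NExpr.eval_at]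
        simp only [run, NExpr.eval_at, NExpr.eval_one hW1]
        rw [Store.setWord_word_of_ne _ _ _ (by decide), Store.setWord_word_of_ne _ _ _ (by decide),
          e19, e20]
      rw [e]
      have f23 : ((s'.setWord 2 (s.word 20 x) 1).setWord 23 0 (s.word 19 x)).word 23 0 =
          s.word 19 x := by rw [Store.setWord_word_self, Function.update_self]
      have f2 : ((s'.setWord 2 (s.word 20 x) 1).setWord 23 0 (s.word 19 x)).word 2 =
          Function.update (s'.word 2) (s.word 20 x) 1 := by
        rw [Store.setWord_word_of_ne _ _ _ (by decide), Store.setWord_word_self]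
      have f2' : ∀ w, Function.update (s'.word 2) (s.word 20 x) 1 w = 1 ↔
          w = s.word 20 x ∨ s'.word 2 w = 1 := by
        intro w
        by_cases hw : w = s.word 20 x
        · simp [hw]
        · simp [hw]
      rw [f23, f2]
      simp only [f2']
      refine ⟨by omega, by omega, fun l hl1 hl2 => ?_, ?_⟩
      · by_cases hlx : x ≤ l
        · obtain ⟨w, hw, hw1, hw2⟩ := h3 l hlx hl2
          exact ⟨w, hw, Or.inr hw1, hw2⟩
        · exact ⟨_, a2, Or.inl rfl, a3 l hl1 (by omega)⟩
      · have hsub : (Finset.range n).filter (fun w => w = s.word 20 x ∨ s'.word 2 w = 1) ⊆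
            insert (s.word 20 x) ((Finset.range n).filter fun w => s'.word 2 w = 1) := by
          intro w hw
          rw [Finset.mem_filter] at hw
          rw [Finset.mem_insert, Finset.mem_filter]
          tauto
        have hle : ∑ w ∈ (Finset.range n).filter (fun w => w = s.word 20 x ∨ s'.word 2 w = 1), c w ≤
            c (s.word 20 x) + ∑ w ∈ (Finset.range n).filter (fun w => s'.word 2 w = 1), c w := by
          refine (Finset.sum_le_sum_of_subset_of_nonneg hsub fun w _ _ => hc w).trans ?_
          by_cases hmem : s.word 20 x ∈ (Finset.range n).filter fun w => s'.word 2 w = 1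
          · rw [Finset.insert_eq_of_mem hmem]
            linarith [hc (s.word 20 x)]
          · rw [Finset.sum_insert hmem]
        linarith
    · rw [run_cond_neg _ _ (fun h => hpos (t.1 h)), run_nop]
      exact ⟨by omega, h2, h3, h4⟩

end DynamicProgram

/-! ### The whole program and its correctness -/

section Solve

/-- Solve the weighted connected dominating set problem. -/
def solveCode : Code :=
  seq simplicialCode (seq sepCode (seq sizeCode (seq keepCode (seq listCode
    (seq tableCode traceCode)))))

variable {n : ℕ} {G : SimpleGraph (Fin n)} {c : Fin n → ℝ} {A : ℕ → ℕ}

theorem inputStore_adj (x y : Fin n) :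
    (inputStore G c).word 0 (x * n + y) = 1 ↔ G.Adj x y := by
  simp only [inputStore, if_true, indicator]
  split_ifs with h
  · obtain ⟨i, j, hij, hadj⟩ := h
    obtain ⟨h1, h2⟩ := mul_add_inj y.2 j.2 hij
    rw [Fin.ext h1, Fin.ext h2]
    simpa using hadj
  · simpa using fun hadj => h ⟨x, y, rfl, hadj⟩

theorem reach_iff (hA : ∀ x y : Fin n, A (x * n + y) = 1 ↔ G.Adj x y) (r v : Fin n) {u : ℕ} :
    Reach A n r v u ↔ ∃ h : u < n, (⟨u, h⟩ : Fin n) ∈ comp G {x | x ≠ v ∧ ¬ G.Adj v x} r := by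
  constructor
  · intro h
    induction h with
    | refl => exact ⟨r.2, mem_comp_self _ _⟩
    | @tail a b _ hab ih =>
      obtain ⟨ha, hra⟩ := ih
      obtain ⟨h1, h2, h3, h4⟩ := hab
      exact ⟨h2, Relation.ReflTransGen.tail hra ⟨(hA ⟨a, ha⟩ ⟨b, h2⟩).1 h1,
        fun h => h3 (congrArg Fin.val h), fun h => h4 ((hA v ⟨b, h2⟩).2 h)⟩⟩
  · rintro ⟨h, hu⟩
    have : ∀ x : Fin n, x ∈ comp G {x | x ≠ v ∧ ¬ G.Adj v x} r → Reach A n r v x := by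
      intro x hx
      induction hx with
      | refl => exact Relation.ReflTransGen.refl
      | @tail a b _ hab ih =>
        exact Relation.ReflTransGen.tail ih ⟨(hA a b).2 hab.1, b.2,
          fun h => hab.2.1 (Fin.ext h), fun h => hab.2.2 ((hA v b).1 h)⟩
    exact this ⟨u, h⟩ hu

theorem sepRow_iff (hA : ∀ x y : Fin n, A (x * n + y) = 1 ↔ G.Adj x y) (r v w : Fin n) :
    SepRow A n r v w ↔ w ∈ sepSet G r v := by
  simp only [SepRow, sepSet, Set.mem_ofPred_eq, hA, reach_iff hA, ne_eq, Fin.ext_iff]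
  refine imp_congr Iff.rfl (imp_congr Iff.rfl (and_congr Iff.rfl ⟨?_, ?_⟩))
  · rintro ⟨u, hu, ⟨_, h1⟩, h2⟩
    exact ⟨⟨u, hu⟩, h1, (hA ⟨u, hu⟩ w).1 h2⟩
  · rintro ⟨u, h1, h2⟩
    exact ⟨u, u.2, ⟨u.2, h1⟩, (hA u w).2 h2⟩

theorem card_filter_range (P : ℕ → Prop) [DecidablePred P] :
    ((Finset.range n).filter P).card = {w : Fin n | P w}.ncard := by
  rw [← Set.ncard_image_of_injective _ Fin.val_injective, ← Set.ncard_coe_finset]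
  congr 1
  ext w
  simp only [Finset.coe_filter, Finset.mem_range, Set.mem_ofPred_eq, Set.mem_image]
  exact ⟨fun h => ⟨⟨w, h.1⟩, h.2, rfl⟩, by rintro ⟨x, hx, rfl⟩; exact ⟨x.2, hx⟩⟩

/-- The empty set is not a cut of a connected graph. -/
theorem sepSet_nonempty (hG : G.Connected) (r v : Fin n) : (sepSet G r v).Nonempty := by
  by_contra h
  have hcut := isCut_sepSet (G := G) r v
  rw [Set.not_nonempty_iff_eq_empty] at h
  rw [h, isCut_iff, Set.compl_empty] at hcut
  refine hcut ⟨r, trivial⟩ (edgeConn_iff_preconnected.2 ?_)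
  exact (SimpleGraph.induceUnivIso G).preconnected_iff.2 hG.preconnected

/-- This is the form that `keepCode` tests, with sizes and indices. -/
theorem isSelected_iff {r v : Fin n} : IsSelected G r v ↔ ∀ u, ¬ (sepSet G r u ⊆ sepSet G r v ∧
    ((sepSet G r u).ncard < (sepSet G r v).ncard ∨
      (sepSet G r u).ncard = (sepSet G r v).ncard ∧ u < v)) := by
  refine forall_congr' fun u => ⟨fun h h' => ?_, fun h hsub => ?_⟩
  · obtain ⟨h1, h2⟩ := h h'.1
    rw [h1] at h'
    rcases h'.2 with h3 | h3
    · exact h3.false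
    · exact absurd h3.2 (not_lt.2 h2)
  · have hle := Set.ncard_le_ncard hsub (Set.toFinite _)
    have hge : (sepSet G r v).ncard ≤ (sepSet G r u).ncard :=
      not_lt.1 fun hlt => h ⟨hsub, Or.inl hlt⟩
    exact ⟨Set.eq_of_subset_of_ncard_le hsub hge (Set.toFinite _),
      not_lt.1 fun hlt => h ⟨hsub, Or.inr ⟨le_antisymm hle hge, hlt⟩⟩⟩

theorem IsSelectionList.length_le {r : Fin n} {m : ℕ} {L : ℕ → Fin n}
    (h : IsSelectionList G r m L) : m ≤ n := by
  have hinj : Function.Injective fun i : Fin m => L i := by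
    intro i j hij
    rcases lt_trichotomy i j with hlt | heq | hlt
    · exact absurd hij (h.inj i j hlt j.2)
    · exact heq
    · exact absurd hij.symm (h.inj j i hlt i.2)
  simpa using Fintype.card_le_of_injective _ hinj

theorem ListInv.exists_isSelectionList {size keep : ℕ → ℕ} {s : Store} {r : Fin n}
    (h : ListInv n size keep n 0 s) (hsize : ∀ v : Fin n, size v = (sepSet G r v).ncard)
    (hkeep : ∀ v : Fin n, keep v = 1 ↔ IsSelected G r v) (hpos : ∀ v : Fin n, 1 ≤ size v) :
    ∃ L : ℕ → Fin n, (∀ j < s.word 16 0, s.word 17 j = L j) ∧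
      IsSelectionList G r (s.word 16 0) L := by
  -- Array `17` holds plain numbers; the default `r` plays no role within the list.
  set L : ℕ → Fin n := fun j => if hj : s.word 17 j < n then ⟨s.word 17 j, hj⟩ else r with hLdef
  have hL : ∀ j < s.word 16 0, s.word 17 j = L j := fun j hj => by
    simp only [hLdef, dif_pos (h.mem j hj).1]
  refine ⟨L, hL, fun j hj => ?_, fun v hv => ?_, fun i j hij hj heq => ?_, fun i j hij hj => ?_⟩
  · rw [← hkeep, ← hL j hj]
    exact (h.mem j hj).2.1
  · have hle : size v ≤ n := by
      rw [hsize]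
      simpa [Nat.card_eq_fintype_card] using Set.ncard_le_card (sepSet G r v)
    obtain ⟨j, hj, hjv⟩ := h.surj v v.2 ((hkeep v).2 hv) (hpos v) (Or.inl hle)
    exact ⟨j, hj, Fin.ext (by rw [← hL j hj, hjv])⟩
  · have := h.sorted i j hij hj
    rw [hL i (by omega), hL j hj, heq] at this
    omega
  · have := h.sorted i j hij hj
    rw [hL i (by omega), hL j hj, hsize, hsize] at this
    omega

/-- The marked set hits every selected cut and costs at most the last table entry. By `chain_bound`
that entry is at most the cost of any set hitting all selected cuts. -/
theorem run_solveCode (hG : IsChordal G) (hfree : ¬ HasObstruction G) (hconn : G.Connected)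
    (hc : ∀ v, 0 ≤ c v) {W : ℕ} (hW : n * n < W) (hnW : n < W) (hW1 : 1 < W) :
    IsMinCostConnectedDominating G c (outputSet n (solveCode.run W (inputStore G c))) := by
  set s₀ := inputStore G c with hs₀
  have hA : ∀ x y : Fin n, s₀.word 0 (x * n + y) = 1 ↔ G.Adj x y := inputStore_adj
  have hn : s₀.word 1 0 = n := by simp [hs₀, inputStore]
  have hz : ∀ a x, 2 ≤ a → s₀.word a x = 0 := by
    intro a x ha
    simp [hs₀, inputStore, show a ≠ 0 by omega, show a ≠ 1 by omega]
  have := hconn.nonempty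
  -- a simplicial vertex
  obtain ⟨hr, hQ⟩ := run_simplicialCode (W := W) (n := n) (s := s₀) hW hW1 hn
    (Q := fun r => ∃ h : r < n, G.IsClique {w | G.Adj ⟨r, h⟩ w}) (by
      intro r hr
      constructor
      · rintro ⟨_, hcl⟩ a ha b hb h1 h2 hab
        exact (hA ⟨a, ha⟩ ⟨b, hb⟩).2 (hcl ((hA ⟨r, hr⟩ ⟨a, ha⟩).1 h1) ((hA ⟨r, hr⟩ ⟨b, hb⟩).1 h2)
          fun h => hab (congrArg Fin.val h))
      · refine fun h => ⟨hr, fun a ha b hb hab => ?_⟩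
        exact (hA a b).1 (h a a.2 b b.2 ((hA ⟨r, hr⟩ a).2 ha) ((hA ⟨r, hr⟩ b).2 hb)
          fun h => hab (Fin.ext h)))
    (by
      obtain ⟨r, hr⟩ := hG.exists_simplicial
      exact ⟨r, r.2, r.2, hr⟩)
  obtain ⟨_, hcl⟩ := hQ
  rw [solveCode, run_seq]
  have f₁ : ∀ a, a ∉ simplicialCode.writes → (simplicialCode.run W s₀).word a = s₀.word a :=
    run_word _ _ _
  have r₁ : ∀ a, (simplicialCode.run W s₀).real a = s₀.real a := fun a =>
    run_real _ _ _ _ (List.not_mem_nil (a := a))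
  set s₁ := simplicialCode.run W s₀
  set r : Fin n := ⟨s₁.word 7 0, hr⟩ with hrdef
  -- the separating sets
  rw [run_seq]
  have hsep := run_sepCode (W := W) (n := n) (s := s₁) (A := s₀.word 0) (r := r) hW hW1
    (by rw [f₁ 1 (by decide), hn]) (f₁ 0 (by decide))
    (fun x hx y hy h => (hA ⟨y, hy⟩ ⟨x, hx⟩).2 ((hA ⟨x, hx⟩ ⟨y, hy⟩).1 h).symm) rfl r.2
    (fun x => by rw [f₁ 8 (by decide), hz 8 x (by omega)])
  have f₂ : ∀ a, a ∉ sepCode.writes → (sepCode.run W s₁).word a = s₁.word a := run_word _ _ _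
  have r₂ : ∀ a, (sepCode.run W s₁).real a = s₁.real a := fun a =>
    run_real _ _ _ _ (List.not_mem_nil (a := a))
  set s₂ := sepCode.run W s₁
  have hrow : ∀ v w : Fin n, s₂.word 8 (v * n + w) = 1 ↔ w ∈ sepSet G r v := fun v w =>
    (hsep v v.2 w w.2).trans (sepRow_iff hA r v w)
  have n₂ : s₂.word 1 0 = n := by rw [f₂ 1 (by decide), f₁ 1 (by decide), hn]
  -- their sizes
  rw [run_seq]
  have hsize := run_sizeCode (W := W) (n := n) (s := s₂) hW hnW hW1 n₂
  have f₃ : ∀ a, a ∉ sizeCode.writes → (sizeCode.run W s₂).word a = s₂.word a := run_word _ _ _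
  have r₃ : ∀ a, (sizeCode.run W s₂).real a = s₂.real a := fun a =>
    run_real _ _ _ _ (List.not_mem_nil (a := a))
  set s₃ := sizeCode.run W s₂
  have hsize' : ∀ v : Fin n, s₃.word 14 v = (sepSet G r v).ncard := by
    intro v
    rw [hsize v v.2, card_filter_range]
    simp only [hrow, Set.ofPred_mem_eq]
  have n₃ : s₃.word 1 0 = n := by rw [f₃ 1 (by decide), n₂]
  -- the selected vertices
  rw [run_seq]
  have hkeep := run_keepCode (W := W) (n := n) (s := s₃) hW hW1 n₃
  have f₄ : ∀ a, a ∉ keepCode.writes → (keepCode.run W s₃).word a = s₃.word a := run_word _ _ _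
  have r₄ : ∀ a, (keepCode.run W s₃).real a = s₃.real a := fun a =>
    run_real _ _ _ _ (List.not_mem_nil (a := a))
  set s₄ := keepCode.run W s₃
  have hkeep' : ∀ v : Fin n, s₄.word 15 v = 1 ↔ IsSelected G r v := by
    intro v
    rw [hkeep v v.2, isSelected_iff, Fin.forall_iff]
    refine forall_congr' fun u => forall_congr' fun hu => not_congr (and_congr ?_ ?_)
    · rw [f₃ 8 (by decide)]
      exact ⟨fun h w hw => (hrow v w).1 (h w w.2 ((hrow ⟨u, hu⟩ w).2 hw)),
        fun h w hw h' => (hrow v ⟨w, hw⟩).2 (h ((hrow ⟨u, hu⟩ ⟨w, hw⟩).1 h'))⟩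
    · rw [hsize' v, hsize' ⟨u, hu⟩, Fin.lt_def]
  have n₄ : s₄.word 1 0 = n := by rw [f₄ 1 (by decide), n₃]
  -- the list
  rw [run_seq]
  have hlist := run_listCode (W := W) (n := n) (s := s₄) hW hnW hW1 n₄ (by
    rw [f₄ 16 (by decide), f₃ 16 (by decide), f₂ 16 (by decide), f₁ 16 (by decide),
      hz 16 0 (by omega)])
  have f₅ : ∀ a, a ∉ listCode.writes → (listCode.run W s₄).word a = s₄.word a := run_word _ _ _
  have r₅ : ∀ a, (listCode.run W s₄).real a = s₄.real a := fun a =>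
    run_real _ _ _ _ (List.not_mem_nil (a := a))
  set s₅ := listCode.run W s₄
  have n₅ : s₅.word 1 0 = n := by rw [f₅ 1 (by decide), n₄]
  have e14 : s₄.word 14 = s₃.word 14 := f₄ 14 (by decide)
  obtain ⟨L, hL, hsel⟩ := hlist.exists_isSelectionList (G := G) (r := r)
    (fun v => by rw [e14, hsize']) hkeep' (fun v => by
      rw [e14, hsize']
      exact (Set.ncard_pos (Set.toFinite _)).2 (sepSet_nonempty hconn r v))
  have e8 : s₅.word 8 = s₂.word 8 := by rw [f₅ 8 (by decide), f₄ 8 (by decide), f₃ 8 (by decide)]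
  have hzero : ∀ a x, 2 ≤ a → a ∉ simplicialCode.writes ++ sepCode.writes ++ sizeCode.writes ++
      keepCode.writes ++ listCode.writes → s₅.word a x = 0 := by
    intro a x ha h
    simp only [List.mem_append, not_or] at h
    rw [f₅ a h.2, f₄ a h.1.2, f₃ a h.1.1.2, f₂ a h.1.1.1.2, f₁ a h.1.1.1.1, hz a x ha]
  have hreal : ∀ a, s₅.real a = s₀.real a := fun a => by rw [r₅, r₄, r₃, r₂, r₁]
  set m := s₅.word 16 0 with hm
  have hmn : m ≤ n := hsel.length_le
  have hE : ∀ j < m, ∀ w : Fin n, s₅.word 8 (s₅.word 17 j * n + w) = 1 ↔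
      w ∈ sepSet G r (L j) := fun j hj w => by rw [hL j hj, e8, hrow]
  -- the table
  rw [run_seq]
  have htable := run_tableCode (W := W) (n := n) (s := s₅)
    (E := fun j w => s₅.word 8 (s₅.word 17 j * n + w) = 1) hW hnW hW1 n₅ hm.symm hmn
    (fun j hj => (hlist.mem j hj).1) (fun _ _ _ _ => Iff.rfl)
    (fun j hj => by
      obtain ⟨w, hw⟩ := sepSet_nonempty hconn r (L j)
      exact ⟨w, w.2, (hE j hj w).2 hw⟩)
    (fun w _ => hzero 18 w (by omega) (by decide))
    (by rw [hreal]; simp [hs₀, inputStore])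
  rw [hreal] at htable
  have f₆ : ∀ a, a ∉ tableCode.writes → (tableCode.run W s₅).word a = s₅.word a := run_word _ _ _
  set s₆ := tableCode.run W s₅
  have hcost : ∀ v : Fin n, s₀.real 0 v = c v := fun v => by simp [hs₀, inputStore]
  have hcost' : ∀ w, 0 ≤ s₀.real 0 w := by
    intro w
    simp only [hs₀, inputStore]
    split_ifs with h
    · exact hc _
    · exact le_rfl
  -- the solution
  obtain ⟨hhit, hle⟩ := run_traceCode (W := W) (n := n) (s := s₆) hW1
    (by rw [f₆ 1 (by decide), n₅]) (by rw [f₆ 16 (by decide)]) hmn hcost'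
    (fun w _ => by rw [f₆ 2 (by decide), hzero 2 w (by omega) (by decide)]) htable
  set s₇ := traceCode.run W s₆
  constructor
  · rw [isConnectedDominating_iff_selected hG hcl]
    intro v hv
    obtain ⟨j, hj, rfl⟩ := hsel.surj v hv
    obtain ⟨w, hw, hw1, hw2⟩ := hhit j hj
    exact ⟨⟨w, hw⟩, by simpa [outputSet] using hw1, (hE j hj ⟨w, hw⟩).1 hw2⟩
  · intro S' hS'
    rw [isConnectedDominating_iff_selected hG hcl] at hS'
    have hbound := chain_bound (m := m) (e := fun j w => w ∈ sepSet G r (L j)) (d := s₆.real 1)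
      (c := c) (T := S') (fun i j hij hj => (hsel.chain hG hfree hcl hij hj).1)
      (fun i j hij hj => (hsel.chain hG hfree hcl hij hj).2)
      (fun i j hij hj w hw => by
        rw [← hcost]
        exact htable.le j hj i hij w w.2 fun l h1 h2 => (hE l (by omega) w).2 (hw l h1 h2))
      hc (fun l hl => hS' (L l) (hsel.selected l hl))
    rw [htable.zero, zero_add] at hbound
    refine le_trans (le_of_eq ?_) (hle.trans hbound)
    rw [outputSet, Finset.sum_filter, Finset.sum_filter, Finset.sum_range]
    simp only [hcost]

theorem isChordal_wcdsSolvableInTime :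
    WCDSSolvableInTime (fun _ G => IsChordal G ∧ IsF₁F₂HFree G) (fun n => n ^ 3) := by
  -- A modulus of at least `(n + 1) ^ 3` exceeds `n * n + n + 1` when `n ≥ 1`, which leaves room for
  -- all matrix addresses, counters and the constant `1`.
  refine ⟨solveCode.toProg, 3, solveCode.weight, fun n G c W hG hconn hc hW => ?_⟩
  have hn : 1 ≤ n := by
    obtain ⟨v⟩ := hconn.nonempty
    have := v.2
    omega
  have hW' : n * n + n + 2 ≤ W := by
    refine le_trans ?_ hW
    nlinarith [Nat.zero_le (n ^ 3), sq_nonneg n]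
  obtain ⟨t, ht, hle⟩ := solveCode.exec_toProg hn (by omega : n < W) (by decide) (by decide)
    (inputStore G c) (by simp [inputStore])
  refine ⟨t, _, ht, ?_, run_solveCode hG.1 hG.2.not_hasObstruction hconn hc (by omega) (by omega)
    (by omega)⟩
  have hdepth : solveCode.depth = 3 := by decide
  rwa [hdepth] at hle

theorem isSplit_wcdsSolvableInTime :
    WCDSSolvableInTime (fun _ G => IsSplit G ∧ ¬ F₂.IsIndContained G) (fun n => n ^ 3) := by
  obtain ⟨p, k, C, h⟩ := isChordal_wcdsSolvableInTime
  exact ⟨p, k, C, fun n G c W hG => h n G c W ⟨hG.1.isChordal, hG.1.isF₁F₂HFree hG.2⟩⟩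

end Solve

end WCDS

theorem mainTheorem12 :
    (∀ (V : Type*) [Finite V] (G : SimpleGraph V),
      WCDS.IsSplit G → ¬ WCDS.F₂.IsIndContained G →
        WCDS.IsHereditarilyConnectedDomishold G) ∧
    WCDS.WCDSSolvableInTime
      (fun _ G => WCDS.IsChordal G ∧ WCDS.IsF₁F₂HFree G) (fun n => n ^ 3) ∧
    WCDS.WCDSSolvableInTime
      (fun _ G => WCDS.IsSplit G ∧ ¬ WCDS.F₂.IsIndContained G) (fun n => n ^ 3) :=
  ⟨fun _ _ _ hG h => hG.isHereditarilyConnectedDomishold h, WCDS.isChordal_wcdsSolvableInTime,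
    WCDS.isSplit_wcdsSolvableInTime⟩
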